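/- Let $J_0(z)=\sum_{k\ge 0}\frac{(-1)^k}{(k!)^2}\left(\frac z2\right)^{2k}$, let $Y_0$ be the Bessel function of the second kind of order $0$ (principal branch) and let $H_0=J_0+\mathrm{i}Y_0$ be the Hankel function of the first kind on $\mathbb{C}\setminus(-\infty,0]$, with complex derivatives $H_0^{(\ell)}$. For $r>0$ and $\alpha\in(0,2)$ put $$f(r;\alpha)=\frac1{2\pi}\int_0^\infty J_0(rt)\,t\,\mathrm{e}^{-t^\alpha}\,\mathrm{d}t,$$ the radial density of the spherically contoured bivariate $\alpha$-stable law with characteristic function $\exp(-|\mathbf t|^\alpha)$, and let $\pi_\alpha=\frac{\pi}{2\max(\alpha,1)}$. Then $f$ is infinitely differentiable on $(0,\infty)\times(0,2)$, and for all $\alpha\in(0,2)$, $n\in\mathbb{N}_0$ the following hold, where all the integrals in the bounds are finite. (1) For all $r>0$, $$f(r;\alpha)=\frac1{\pi^2}\sum_{k=1}^n\frac{(-1)^{k+1}2^{k\alpha}\,\Gamma\!\left(\frac{k\alpha+2}2\right)^2\sin\!\left(\frac{k\alpha\pi}2\right)}{k!}\,r^{-k\alpha-2}+\mathcal R(r;\alpha),$$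 $$|\mathcal R(r;\alpha)|\le\frac1{2\pi(n+1)!}\left(\int_0^\infty|H_0(\mathrm{e}^{\mathrm{i}\pi_\alpha}\tau)|\,\tau^{(n+1)\alpha+1}\,\mathrm{d}\tau\right)r^{-(n+1)\alpha-2};$$ in particular $\mathcal R(r;\alpha)=\mathcal O(r^{-(n+1)\alpha-2})$ as $r\to\infty$. (2) For all $\ell\in\mathbb{N}_0$ and $r>0$, $$\frac{\partial^\ell}{\partial r^\ell}f(r;\alpha)=\frac{(-1)^\ell}{\pi^2}\sum_{k=1}^n\frac{(-1)^{k+1}}{k!}\,T_{\ell,k}(r;\alpha)+\mathcal R_\ell(r;\alpha),\qquad T_{\ell,k}(r;\alpha)=\frac{2^{k\alpha}\left\{\prod_{i=2}^{\ell+1}(k\alpha+i)\right\}\Gamma\!\left(\frac{k\alpha+2}2\right)^2\sin\!\left(\frac{k\alpha\pi}2\right)}{r^{k\alpha+\ell+2}},$$ $$|\mathcal R_\ell(r;\alpha)|\le\frac1{2\pi(n+1)!}\left(\int_0^\infty|H_0^{(\ell)}(\mathrm{e}^{\mathrm{i}\pi_\alpha}\tau)|\,\tau^{(n+1)\alpha+\ell+1}\,\mathrm{d}\tau\right)r^{-(n+1)\alpha-\ell-2}.$$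 (3) Let $M_{n+1}$ be the entire function with $M_{n+1}(z)=\left(\mathrm{e}^z-\sum_{k=0}^n\frac{z^k}{k!}\right)/z^{n+1}$ for $z\neq0$. For all $\ell_1,\ell_2\in\mathbb{N}_0$, all $r>0$ and every $\varphi$ with $0<\varphi<\frac{\pi}{\max(2\alpha,1)}$ or $\varphi=\pi_\alpha$, $$\frac{\partial^{\ell_1+\ell_2}}{\partial r^{\ell_1}\partial\alpha^{\ell_2}}f(r;\alpha)=\frac{(-1)^{\ell_1}}{\pi^2}\sum_{k=1}^n\frac{(-1)^{k+1}}{k!}\,\frac{\partial^{\ell_2}}{\partial\alpha^{\ell_2}}T_{\ell_1,k}(r;\alpha)+\mathcal R_{\ell_1,\ell_2}(r;\alpha),$$ $$|\mathcal R_{\ell_1,\ell_2}(r;\alpha)|\le\frac1{2\pi}\int_0^\infty\left|H_0^{(\ell_1)}(\mathrm{e}^{\mathrm{i}\varphi}r\tau)\right|\tau^{\ell_1+1}\left|\frac{\partial^{\ell_2}}{\partial\alpha^{\ell_2}}\left[\mathrm{e}^{\mathrm{i}(n+1)\beta_1}\tau^{(n+1)\alpha}M_{n+1}\!\left(\mathrm{e}^{\mathrm{i}\beta_1}\tau^\alpha\right)\right]\right|\mathrm{d}\tau,$$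 where $\beta_1=\beta_1(\alpha)=\pi+\alpha\varphi$ and $\varphi$ is held constant in the differentiation with respect to $\alpha$. -/

import Mathlib

namespace BivariateStable

/-- The Bessel function of the first kind `J_ν` of order `ν ∈ {0, 1, 2, …}`, by its power series. -/
noncomputable def besselJ (ν : ℕ) (z : ℂ) : ℂ :=
  ∑' k : ℕ, (-1 : ℂ) ^ k / ((k.factorial : ℂ) * ((k + ν).factorial : ℂ)) * (z / 2) ^ (2 * k + ν)

/-- The Bessel function of the second kind `Y_0` on `ℂ ∖ (-∞, 0]`, by Neumann's expansion
`Y_0(z) = (2/π) ((log(z/2) + γ) J_0(z) + ∑_{k ≥ 1} (-1)^(k+1) h_k / (k!)² (z/2)^(2k))`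
with the principal branch of the logarithm, `γ` the Euler-Mascheroni constant and
`h_k = 1 + 1/2 + ⋯ + 1/k` (so that the term `k = 0` vanishes). -/
noncomputable def besselY0 (z : ℂ) : ℂ :=
  (2 / (Real.pi : ℂ)) *
    ((Complex.log (z / 2) + (Real.eulerMascheroniConstant : ℂ)) * besselJ 0 z
      + ∑' k : ℕ, (-1 : ℂ) ^ (k + 1) * ((harmonic k : ℚ) : ℂ) / ((k.factorial : ℂ) ^ 2)
          * (z / 2) ^ (2 * k))

/-- The Hankel function of the first kind `H_0 = J_0 + i Y_0` on `ℂ ∖ (-∞, 0]`. -/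
noncomputable def hankel0 (z : ℂ) : ℂ :=
  besselJ 0 z + Complex.I * besselY0 z

/-- The radial density `f(r; α) = (1/2π) ∫_0^∞ J_0(r t) t exp(-t^α) dt` of the spherically
contoured bivariate `α`-stable law with characteristic function `exp(-|t|^α)`.
(`J_0` is real on the real line; the real part only changes the type.) -/
noncomputable def radialDensity (r α : ℝ) : ℝ :=
  1 / (2 * Real.pi) *
    ∫ t in Set.Ioi (0 : ℝ), (besselJ 0 ((r * t : ℝ) : ℂ)).re * t * Real.exp (-t ^ α)

/-- `π_α = π / (2 max(α, 1))`. -/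
noncomputable def piAlpha (α : ℝ) : ℝ := Real.pi / (2 * max α 1)

/-- The entire function `M_m` that continues
`z ↦ (exp z - ∑_{k=0}^{m-1} z^k / k!) / z^m` (so `M_0 = exp`). -/
noncomputable def expRemainder (m : ℕ) (z : ℂ) : ℂ :=
  if z = 0 then 1 / (m.factorial : ℂ)
  else (Complex.exp z - ∑ k ∈ Finset.range m, z ^ k / (k.factorial : ℂ)) / z ^ m

/-- `2^(kα) {∏_{i=2}^{ℓ+1} (kα + i)} Γ((kα+2)/2)² sin(kαπ/2) / r^(kα+ℓ+2)`. -/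
noncomputable def tailTerm (ℓ k : ℕ) (r α : ℝ) : ℝ :=
  (2 : ℝ) ^ (k * α) * (∏ i ∈ Finset.Icc 2 (ℓ + 1), (k * α + i))
    * Real.Gamma ((k * α + 2) / 2) ^ 2 * Real.sin (k * α * Real.pi / 2)
    / r ^ (k * α + ℓ + 2)

/-- `exp(i(n+1)β₁) τ^((n+1)α) M_{n+1}(exp(iβ₁) τ^α)` with `β₁ = β₁(α) = π + αφ`,
as a function of `α` for fixed `φ` and `τ`. -/
noncomputable def remainderKernel (n : ℕ) (φ τ α : ℝ) : ℂ :=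
  Complex.exp (Complex.I * ((n + 1) * (Real.pi + α * φ)))
    * ((τ ^ ((n + 1) * α) : ℝ) : ℂ)
    * expRemainder (n + 1) (Complex.exp (Complex.I * (Real.pi + α * φ)) * ((τ ^ α : ℝ) : ℂ))

end BivariateStable

namespace BivariateStable

/-! On the positive axis `J_0` is the real part of `H_0`, so the density equals `(1/2π) Re ∫ H_0(rt)
t exp(-t^α) dt`. Off the real axis `H_0` decays exponentially in the upper half-plane, and
`exp(-t^α)` stays bounded on the ray of angle `φ` while `αφ ≤ π/2`. Cauchy's theorem therefore moves
the integral onto such a ray (`IsKernelFamily.rayIntegral_eq`, `radialDensity_eq`).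

On the ray the Hankel factor makes every power of `t` integrable, so with `w = -t^α` the function
`exp w` may be split into its Taylor polynomial and a remainder. A single power of `t` restricts the
angle only by `0 < φ < π`. Its integral can thus be rotated to the imaginary axis, where `H_0(ix) =
(2/(πi)) K_0(x)`, and the Mellin transform of `K_0` produces the Gamma factors and the sine
(`mellin_twoK`, `re_rayIntegral_powKernel`). Since `Re w ≤ 0` on the ray, the remainder is at most
`|w|^(n+1)/(n+1)!` (`norm_exp_sub_sum_le`), and the scaling `τ ↦ rτ` extracts the power of `r`.

Derivatives in `r` fall on `H_0`, derivatives in `α` on the kernel; both yield integrals of the same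
type with majorants uniform in the parameters. This gives smoothness and the differentiated
expansions (`IsKernelFamily.hasFDerivAt_rayIntegral`, `expansionError_eq`). Differentiation in `α`
needs the strict inequality `αφ < π/2`; the boundary angle `π_α`, for `α ≥ 1`, is reached by letting
the angle increase to it (`abs_expansionError_le`).

The decay of `H_0` comes from the Mehler–Sonine integral `(1/(πi)) ∫ exp(iz cosh t) dt`. To identify
it with the series definition, both are restricted to the positive imaginary axis, where they solve
the same Bessel equation and agree asymptotically at `0`. A Wronskian argument and the identity
theorem finish (`hankel0_eq_hankelInt`). -/

/-! ### Power series with coefficients bounded by `1/k!` -/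

/-- The sum of the power series with coefficients `a`. -/
noncomputable def seriesSum (a : ℕ → ℂ) (q : ℂ) : ℂ := ∑' k, a k * q ^ k

/-- The coefficients of the derived power series. -/
def derivCoeff (a : ℕ → ℂ) (k : ℕ) : ℂ := (k + 1) * a (k + 1)

section Series

variable {a : ℕ → ℂ}

/-- The bound `1/k!` reproduces itself, as `(k+1)/(k+1)! = 1/k!`, so one hypothesis serves the
series and all its derivatives. -/
lemma norm_derivCoeff_le (ha : ∀ k, ‖a k‖ ≤ 1 / (k.factorial : ℝ)) (k : ℕ) :
    ‖derivCoeff a k‖ ≤ 1 / (k.factorial : ℝ) := by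
  have h1 : ‖((k : ℂ) + 1)‖ = (k : ℝ) + 1 := by
    rw [← Nat.cast_succ, Complex.norm_natCast]; simp
  rw [derivCoeff, norm_mul, h1]
  calc ((k : ℝ) + 1) * ‖a (k + 1)‖ ≤ ((k : ℝ) + 1) * (1 / ((k + 1).factorial : ℝ)) := by
        gcongr; exact ha _
    _ = 1 / (k.factorial : ℝ) := by
        rw [Nat.factorial_succ]; push_cast
        have : (k.factorial : ℝ) ≠ 0 := by positivity
        field_simp

lemma summable_series (ha : ∀ k, ‖a k‖ ≤ 1 / (k.factorial : ℝ)) (q : ℂ) :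
    Summable fun k => a k * q ^ k := by
  refine Summable.of_norm_bounded (Real.summable_pow_div_factorial ‖q‖) fun k => ?_
  rw [norm_mul, norm_pow]
  calc ‖a k‖ * ‖q‖ ^ k ≤ 1 / (k.factorial : ℝ) * ‖q‖ ^ k := by gcongr; exact ha k
    _ = _ := by ring

lemma hasDerivAt_seriesSum (ha : ∀ k, ‖a k‖ ≤ 1 / (k.factorial : ℝ)) (q : ℂ) :
    HasDerivAt (seriesSum a) (seriesSum (derivCoeff a) q) q := by
  set R := ‖q‖ + 1
  have hR : 0 < R := by positivity
  have hu : Summable fun k : ℕ => (k : ℝ) / (k.factorial : ℝ) * R ^ (k - 1) := by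
    rw [← summable_nat_add_iff 1]
    refine (Real.summable_pow_div_factorial R).congr fun k => ?_
    rw [Nat.factorial_succ]; push_cast
    have : (k.factorial : ℝ) ≠ 0 := by positivity
    field_simp
  have key := hasDerivAt_tsum_of_isPreconnected (𝕜 := ℂ) (F := ℂ)
    (g := fun k z => a k * z ^ k) (g' := fun k z => a k * (k * z ^ (k - 1)))
    (t := Metric.ball 0 R) (y₀ := 0) (y := q) hu Metric.isOpen_ball
    (convex_ball (0 : ℂ) R).isPreconnected
    (fun k y _ => (hasDerivAt_pow k y).const_mul (a k)) ?_ (by simp [hR])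
    (summable_series ha 0) (by simp [R])
  · have e : (∑' k : ℕ, a k * (k * q ^ (k - 1))) = seriesSum (derivCoeff a) q := by
      have hs : Summable fun k : ℕ => a k * (k * q ^ (k - 1)) := by
        rw [← summable_nat_add_iff 1]
        refine (summable_series (norm_derivCoeff_le ha) q).congr fun k => ?_
        simp only [derivCoeff, Nat.add_sub_cancel]; push_cast; ring
      rw [hs.tsum_eq_zero_add, seriesSum]
      simp only [Nat.cast_zero, zero_mul, mul_zero, zero_add, derivCoeff]
      refine tsum_congr fun k => ?_
      rw [Nat.add_sub_cancel]; push_cast; ring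
    rw [e] at key
    exact key
  · intro k y hy
    rw [norm_mul, norm_mul, norm_pow, Complex.norm_natCast]
    have hy' : ‖y‖ ≤ R := by simpa using (Metric.mem_ball.1 hy).le
    calc ‖a k‖ * (k * ‖y‖ ^ (k - 1)) ≤ 1 / (k.factorial : ℝ) * (k * R ^ (k - 1)) := by
          gcongr; exact ha k
      _ = _ := by ring

lemma mul_seriesSum_derivCoeff (ha : ∀ k, ‖a k‖ ≤ 1 / (k.factorial : ℝ)) (q : ℂ) :
    HasSum (fun k : ℕ => k * a k * q ^ k) (q * seriesSum (derivCoeff a) q) := by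
  have h := ((summable_series (norm_derivCoeff_le ha) q).hasSum).mul_left q
  rw [← hasSum_nat_add_iff' 1]
  simp only [Finset.range_one, Finset.sum_singleton, Nat.cast_zero, zero_mul, sub_zero]
  refine h.congr_fun ?_ |> fun h => h
  intro k
  simp only [derivCoeff]; push_cast; ring

end Series

/-! ### The order-zero Bessel functions as series in `q = x²/4` -/

/-- Coefficients of `I_0(x) = ∑ q^k / (k!)²`, where `q = x² / 4`. -/
noncomputable def coeffI (k : ℕ) : ℂ := 1 / ((k.factorial : ℂ) ^ 2)

/-- Coefficients of `∑ h_k q^k / (k!)²`. -/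
noncomputable def coeffS (k : ℕ) : ℂ := ((harmonic k : ℚ) : ℂ) / ((k.factorial : ℂ) ^ 2)

lemma harmonic_le (k : ℕ) : harmonic k ≤ k := by
  induction k with
  | zero => simp
  | succ k ih =>
    rw [harmonic_succ]; push_cast
    have : ((k : ℚ) + 1)⁻¹ ≤ 1 := inv_le_one_of_one_le₀ (by simp)
    linarith

lemma harmonic_nonneg (k : ℕ) : 0 ≤ harmonic k := by
  rw [harmonic]; positivity

lemma norm_coeffI_le (k : ℕ) : ‖coeffI k‖ ≤ 1 / (k.factorial : ℝ) := by
  have h1 : (1 : ℝ) ≤ k.factorial := by exact_mod_cast Nat.one_le_iff_ne_zero.2 k.factorial_ne_zero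
  rw [coeffI, norm_div, norm_pow, norm_one, Complex.norm_natCast]
  apply one_div_le_one_div_of_le (by positivity)
  nlinarith

lemma norm_coeffS_le (k : ℕ) : ‖coeffS k‖ ≤ 1 / (k.factorial : ℝ) := by
  have h1 : (1 : ℝ) ≤ k.factorial := by exact_mod_cast Nat.one_le_iff_ne_zero.2 k.factorial_ne_zero
  have h2 : ‖((harmonic k : ℚ) : ℂ)‖ ≤ k.factorial := by
    have e : ((harmonic k : ℚ) : ℂ) = (((harmonic k : ℚ) : ℝ) : ℂ) := by simp
    rw [e, Complex.norm_real, Real.norm_eq_abs, abs_of_nonneg (by exact_mod_cast harmonic_nonneg k)]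
    calc ((harmonic k : ℚ) : ℝ) ≤ ((k : ℚ) : ℝ) := by exact_mod_cast harmonic_le k
      _ ≤ _ := by simpa using Nat.self_le_factorial k
  rw [coeffS, norm_div, norm_pow, Complex.norm_natCast, div_le_div_iff₀ (by positivity) (by positivity)]
  nlinarith

/-- `I_0(x)` as a function of `q = x² / 4`. -/
noncomputable def fI : ℂ → ℂ := seriesSum coeffI
/-- The derivative of `fI`. -/
noncomputable def fI' : ℂ → ℂ := seriesSum (derivCoeff coeffI)
/-- The harmonic part of `K_0(x)` as a function of `q = x² / 4`. -/
noncomputable def fS : ℂ → ℂ := seriesSum coeffS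
/-- The derivative of `fS`. -/
noncomputable def fS' : ℂ → ℂ := seriesSum (derivCoeff coeffS)

lemma hasDerivAt_fI (q : ℂ) : HasDerivAt fI (fI' q) q := hasDerivAt_seriesSum norm_coeffI_le q
lemma hasDerivAt_fS (q : ℂ) : HasDerivAt fS (fS' q) q := hasDerivAt_seriesSum norm_coeffS_le q

lemma derivCoeff_mul_nat (a : ℕ → ℂ) (k : ℕ) :
    (k : ℂ) * derivCoeff a k + derivCoeff a k = ((k : ℂ) + 1) ^ 2 * a (k + 1) := by
  simp only [derivCoeff]; ring

/-- In the variable `q = x²/4` the Bessel operator becomes `(q f')'`. It multiplies the shifted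
coefficient by `(k+1)²`, which cancels exactly against the squared factorials in `coeffI` and
`coeffS`. -/
lemma hasDerivAt_mul_derivSeries {a : ℕ → ℂ} (ha : ∀ k, ‖a k‖ ≤ 1 / (k.factorial : ℝ)) (q : ℂ) :
    HasDerivAt (fun q => q * seriesSum (derivCoeff a) q)
      (∑' k : ℕ, ((k : ℂ) + 1) ^ 2 * a (k + 1) * q ^ k) q := by
  have h := (hasDerivAt_id q).mul (hasDerivAt_seriesSum (norm_derivCoeff_le ha) q)
  have h1 := mul_seriesSum_derivCoeff (norm_derivCoeff_le ha) q
  have h2 := (h1.add (summable_series (norm_derivCoeff_le ha) q).hasSum).tsum_eq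
  have e : (∑' k : ℕ, ((k : ℂ) + 1) ^ 2 * a (k + 1) * q ^ k)
      = 1 * seriesSum (derivCoeff a) q
        + id q * seriesSum (derivCoeff (derivCoeff a)) q := by
    refine Eq.trans (tsum_congr fun k => ?_) (h2.trans ?_)
    · rw [← derivCoeff_mul_nat]; ring
    · rw [one_mul, id, add_comm]; rfl
  rw [e]; exact h

lemma hasDerivAt_mul_fI' (q : ℂ) : HasDerivAt (fun q => q * fI' q) (fI q) q := by
  have h := hasDerivAt_mul_derivSeries norm_coeffI_le q
  refine h.congr_deriv ?_
  rw [fI, seriesSum]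
  refine tsum_congr fun k => ?_
  have : (k.factorial : ℂ) ≠ 0 := by exact_mod_cast k.factorial_ne_zero
  have h' : (k : ℂ) + 1 ≠ 0 := by exact_mod_cast k.succ_ne_zero
  simp only [coeffI, Nat.factorial_succ]; push_cast
  field_simp

/-- From `h_{k+1} = h_k + 1/(k+1)`. The extra `fI'` is what the derivative of the logarithm
compensates in the series of `K_0`. -/
lemma hasDerivAt_mul_fS' (q : ℂ) : HasDerivAt (fun q => q * fS' q) (fS q + fI' q) q := by
  have h := hasDerivAt_mul_derivSeries norm_coeffS_le q
  refine h.congr_deriv ?_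
  rw [fS, fI', seriesSum, seriesSum, ← (summable_series norm_coeffS_le q).tsum_add
    (summable_series (norm_derivCoeff_le norm_coeffI_le) q)]
  refine tsum_congr fun k => ?_
  have : (k.factorial : ℂ) ≠ 0 := by exact_mod_cast k.factorial_ne_zero
  have h' : (k : ℂ) + 1 ≠ 0 := by exact_mod_cast k.succ_ne_zero
  simp only [coeffS, coeffI, derivCoeff, Nat.factorial_succ, harmonic_succ]; push_cast
  field_simp

lemma besselJ_zero_eq (z : ℂ) : besselJ 0 z = fI (-(z ^ 2) / 4) := by
  rw [besselJ, fI, seriesSum]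
  refine tsum_congr fun k => ?_
  simp only [coeffI, add_zero]
  rw [show -(z ^ 2) / 4 = (-1) * (z / 2) ^ 2 by ring, mul_pow, ← pow_mul]; ring

lemma besselY0_eq (z : ℂ) : besselY0 z = 2 / (Real.pi : ℂ) *
    ((Complex.log (z / 2) + (Real.eulerMascheroniConstant : ℂ)) * fI (-(z ^ 2) / 4)
      - fS (-(z ^ 2) / 4)) := by
  rw [besselY0, besselJ_zero_eq, sub_eq_add_neg, fS, seriesSum, ← tsum_neg]
  congr 2
  refine tsum_congr fun k => ?_
  simp only [coeffS]
  rw [show -(z ^ 2) / 4 = (-1) * (z / 2) ^ 2 by ring, mul_pow, ← pow_mul]; ring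

lemma differentiableAt_hankel0 {z : ℂ} (hz : z ∈ Complex.slitPlane) :
    DifferentiableAt ℂ hankel0 z := by
  have hI : Differentiable ℂ fI := fun q => (hasDerivAt_fI q).differentiableAt
  have hS : Differentiable ℂ fS := fun q => (hasDerivAt_fS q).differentiableAt
  have e : hankel0 = fun z => fI (-(z ^ 2) / 4) + Complex.I * (2 / (Real.pi : ℂ) *
    ((Complex.log (z / 2) + (Real.eulerMascheroniConstant : ℂ)) * fI (-(z ^ 2) / 4)
      - fS (-(z ^ 2) / 4))) := by
    funext z; rw [hankel0, besselJ_zero_eq, besselY0_eq]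
  have hq : DifferentiableAt ℂ (fun z : ℂ => -(z ^ 2) / 4) z := by fun_prop
  have h1 : DifferentiableAt ℂ (fun z : ℂ => fI (-(z ^ 2) / 4)) z := (hI _).comp z hq
  have h2 : DifferentiableAt ℂ (fun z : ℂ => fS (-(z ^ 2) / 4)) z := (hS _).comp z hq
  have h3 : DifferentiableAt ℂ (fun z : ℂ => Complex.log (z / 2)) z := by
    refine DifferentiableAt.clog (by fun_prop) ?_
    rw [Complex.mem_slitPlane_iff] at hz ⊢
    simpa using hz
  rw [e]; fun_prop

open MeasureTheory Set Filter Topology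

/-! ### The Mehler–Sonine integral in the upper half-plane -/

lemma one_add_sq_le_cosh (t : ℝ) : (1 + t ^ 2) / 4 ≤ Real.cosh t := by
  wlog ht : 0 ≤ t generalizing t
  · have := this (-t) (by linarith)
    simpa using this
  have h1 := Real.quadratic_le_exp_of_nonneg ht
  have h2 := Real.add_one_le_exp (-t)
  rw [Real.cosh_eq]
  nlinarith [sq_nonneg t]

/-- The integrand of the Mehler–Sonine representation of `H_0^{(ℓ)}`. -/
noncomputable def sonineKernel (l : ℕ) (z : ℂ) (t : ℝ) : ℂ :=
  (Complex.I * Real.cosh t) ^ l * Complex.exp (Complex.I * z * Real.cosh t)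

/-- The integral representation of `H_0^{(ℓ)}` in the upper half-plane. -/
noncomputable def hankelInt (l : ℕ) (z : ℂ) : ℂ :=
  1 / (Real.pi * Complex.I) * ∫ t : ℝ, sonineKernel l z t

/-- The constant in the bound for `H_0^{(ℓ)}`. -/
noncomputable def hankelConst (l : ℕ) : ℝ := 4 * ((l + 1).factorial : ℝ) * 2 ^ (l + 1)

lemma hankelConst_pos (l : ℕ) : 0 < hankelConst l := by unfold hankelConst; positivity

lemma norm_sonineKernel (l : ℕ) (z : ℂ) (t : ℝ) :
    ‖sonineKernel l z t‖ = Real.cosh t ^ l * Real.exp (-z.im * Real.cosh t) := by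
  have hc := Real.cosh_pos t
  rw [sonineKernel, norm_mul, norm_pow, norm_mul, Complex.norm_I, one_mul, Complex.norm_real,
    Real.norm_eq_abs, abs_of_pos hc, Complex.norm_exp]
  congr 2
  simp [mul_assoc, Complex.mul_re]

lemma norm_sonineKernel_le (l : ℕ) {y : ℝ} (hy : 0 < y) {z : ℂ} (hz : y ≤ z.im) (t : ℝ) :
    ‖sonineKernel l z t‖ ≤
      (hankelConst l * (y ^ (l + 1))⁻¹ * Real.exp (-y / 2)) * (1 + t ^ 2)⁻¹ := by
  have hc := Real.cosh_pos t
  have hc1 := Real.one_le_cosh t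
  rw [norm_sonineKernel]
  -- The exponential is split in two: one half absorbs the powers of `cosh t`, the other gives
  -- `exp(-y/2)` through `cosh t ≥ 1`.
  have h1 : Real.exp (-z.im * Real.cosh t) ≤
      Real.exp (-(y / 2 * Real.cosh t)) * Real.exp (-y / 2) := by
    rw [← Real.exp_add]; apply Real.exp_le_exp.2; nlinarith
  -- The exponent `l + 1` rather than `l` leaves one factor `1/cosh t`, which is integrable in `t`.
  have h2 : Real.exp (-(y / 2 * Real.cosh t)) ≤
      ((l + 1).factorial : ℝ) / (y / 2 * Real.cosh t) ^ (l + 1) := by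
    have h := Real.pow_div_factorial_le_exp (x := y / 2 * Real.cosh t) (by positivity) (l + 1)
    rw [Real.exp_neg, inv_eq_one_div, div_le_div_iff₀ (Real.exp_pos _) (by positivity), one_mul]
    rwa [div_le_iff₀ (by positivity), mul_comm (Real.exp _)] at h
  have h3 : (Real.cosh t)⁻¹ ≤ 4 * (1 + t ^ 2)⁻¹ := by
    have h := one_add_sq_le_cosh t
    rw [← div_eq_mul_inv, inv_eq_one_div, div_le_div_iff₀ hc (by positivity)]
    linarith
  calc Real.cosh t ^ l * Real.exp (-z.im * Real.cosh t)
      ≤ Real.cosh t ^ l * ((((l + 1).factorial : ℝ) / (y / 2 * Real.cosh t) ^ (l + 1))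
          * Real.exp (-y / 2)) := by
        gcongr
        exact h1.trans (by gcongr)
    _ = (((l + 1).factorial : ℝ) * 2 ^ (l + 1) * (y ^ (l + 1))⁻¹ * Real.exp (-y / 2))
          * (Real.cosh t)⁻¹ := by
        rw [mul_pow, div_pow, pow_succ (Real.cosh t)]
        field_simp
    _ ≤ (((l + 1).factorial : ℝ) * 2 ^ (l + 1) * (y ^ (l + 1))⁻¹ * Real.exp (-y / 2))
          * (4 * (1 + t ^ 2)⁻¹) := by gcongr
    _ = _ := by rw [hankelConst]; ring

lemma continuous_sonineKernel (l : ℕ) (z : ℂ) : Continuous (sonineKernel l z) := by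
  unfold sonineKernel
  have : Continuous fun t : ℝ => ((Real.cosh t : ℝ) : ℂ) :=
    Complex.continuous_ofReal.comp Real.continuous_cosh
  fun_prop

lemma integrable_sonineKernel (l : ℕ) {z : ℂ} (hz : 0 < z.im) :
    Integrable (sonineKernel l z) := by
  refine Integrable.mono' (integrable_inv_one_add_sq.const_mul _)
    (continuous_sonineKernel l z).aestronglyMeasurable
    (Eventually.of_forall (norm_sonineKernel_le l hz le_rfl))

/-- The value `π` of `∫ (1+t²)⁻¹` cancels the prefactor `1/π`, so the constant is exactly
`hankelConst l`. -/
lemma norm_hankelInt_le (l : ℕ) {y : ℝ} (hy : 0 < y) {z : ℂ} (hz : y ≤ z.im) :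
    ‖hankelInt l z‖ ≤ hankelConst l * (y ^ (l + 1))⁻¹ * Real.exp (-y / 2) := by
  have h := norm_integral_le_of_norm_le (integrable_inv_one_add_sq.const_mul _)
    (Eventually.of_forall (norm_sonineKernel_le l hy hz)) (μ := volume)
  rw [integral_const_mul, integral_univ_inv_one_add_sq] at h
  rw [hankelInt, norm_mul, norm_div, norm_mul, norm_one, Complex.norm_I, Complex.norm_real,
    Real.norm_eq_abs, abs_of_pos Real.pi_pos, mul_one, one_div, inv_mul_le_iff₀ Real.pi_pos,
    mul_comm Real.pi]
  exact h

lemma hasDerivAt_hankelInt (l : ℕ) {z : ℂ} (hz : 0 < z.im) :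
    HasDerivAt (hankelInt l) (hankelInt (l + 1) z) z := by
  have hs : {w : ℂ | z.im / 2 < w.im} ∈ 𝓝 z :=
    (isOpen_lt continuous_const Complex.continuous_im).mem_nhds (by simp; linarith)
  have h := (hasDerivAt_integral_of_dominated_loc_of_deriv_le (μ := volume)
    (F := fun w t => sonineKernel l w t) (F' := fun w t => sonineKernel (l + 1) w t) hs
    (Eventually.of_forall fun w => (continuous_sonineKernel l w).aestronglyMeasurable)
    (integrable_sonineKernel l hz)
    (continuous_sonineKernel (l + 1) z).aestronglyMeasurable
    (Eventually.of_forall fun t w hw =>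
      norm_sonineKernel_le (l + 1) (half_pos hz) (le_of_lt hw) t)
    (integrable_inv_one_add_sq.const_mul _)
    (Eventually.of_forall fun t w _ => ?_)).2
  · exact h.const_mul _
  · have h1 : HasDerivAt (fun w : ℂ => Complex.I * w * Real.cosh t)
        (Complex.I * Real.cosh t) w := by
      simpa using ((hasDerivAt_id w).const_mul Complex.I).mul_const ((Real.cosh t : ℝ) : ℂ)
    refine (h1.cexp.const_mul ((Complex.I * Real.cosh t) ^ l)).congr_deriv ?_
    simp only [sonineKernel, pow_succ]; ring

/-! ### Integrable majorants on the half-line -/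

/-- A gauge on `(0, ∞)` that dominates powers, logarithms and constants. -/
noncomputable def gauge (τ : ℝ) : ℝ := (1 + |Real.log τ|) * (1 + τ)

lemma one_le_gauge {τ : ℝ} (hτ : 0 < τ) : 1 ≤ gauge τ := by
  unfold gauge; nlinarith [abs_nonneg (Real.log τ)]

lemma one_add_le_gauge {τ : ℝ} (hτ : 0 < τ) : 1 + τ ≤ gauge τ := by
  unfold gauge; nlinarith [abs_nonneg (Real.log τ)]

lemma one_add_abs_log_le_gauge {τ : ℝ} (hτ : 0 < τ) : 1 + |Real.log τ| ≤ gauge τ := by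
  unfold gauge; nlinarith [abs_nonneg (Real.log τ)]

lemma continuousOn_gauge : ContinuousOn gauge (Ioi 0) := by
  unfold gauge
  have : ContinuousOn Real.log (Ioi 0) := Real.continuousOn_log.mono fun x hx => ne_of_gt hx
  fun_prop

lemma one_add_abs_log_le {ε τ : ℝ} (hε : 0 < ε) (hε1 : ε ≤ 1) (hτ : 0 < τ) :
    1 + |Real.log τ| ≤ (1 + 1 / ε) * (τ ^ (-ε) * (1 + τ) ^ 2) := by
  rcases le_total τ 1 with h | h
  · rw [abs_of_nonpos (Real.log_nonpos hτ.le h), ← Real.log_inv]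
    have h1 := Real.log_le_rpow_div (x := τ⁻¹) (by positivity) hε
    rw [Real.inv_rpow hτ.le, ← Real.rpow_neg hτ.le] at h1
    have h2 : 1 ≤ τ ^ (-ε) := Real.one_le_rpow_of_pos_of_le_one_of_nonpos hτ h (by linarith)
    have h3 : 1 ≤ (1 + τ) ^ 2 := by nlinarith
    calc 1 + Real.log τ⁻¹ ≤ τ ^ (-ε) + τ ^ (-ε) / ε := by linarith
      _ = (1 + 1 / ε) * (τ ^ (-ε) * 1) := by ring
      _ ≤ _ := by gcongr
  · rw [abs_of_nonneg (Real.log_nonneg h)]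
    have h1 := Real.log_le_sub_one_of_pos hτ
    have h2 : 1 ≤ τ ^ (-ε) * τ := by
      have : τ ^ (-ε) * τ = τ ^ (-ε + 1) := by rw [Real.rpow_add hτ, Real.rpow_one]
      rw [this]; exact Real.one_le_rpow h (by linarith)
    have h3 : 0 < τ ^ (-ε) := by positivity
    have h4 : 0 < 1 / ε := by positivity
    calc 1 + Real.log τ ≤ 1 * (1 * τ) := by linarith
      _ ≤ (1 + 1 / ε) * ((τ ^ (-ε) * τ) * τ) := by gcongr; linarith
      _ = (1 + 1 / ε) * (τ ^ (-ε) * τ ^ 2) := by ring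
      _ ≤ _ := by gcongr; linarith

lemma gauge_pow_le (p : ℕ) : ∃ C : ℝ, 0 < C ∧ ∃ m : ℕ, ∀ τ : ℝ, 0 < τ →
    gauge τ ^ p ≤ C * (τ ^ (-(1 / 2) : ℝ) * (1 + τ) ^ m) := by
  -- Chosen so that `ε p ≤ 1/2`: the `p`-th power of the logarithm then costs at most `τ^(-1/2)`,
  -- which is integrable at `0`.
  set ε : ℝ := 1 / (2 * (p + 1)) with hεd
  have hε : 0 < ε := by positivity
  have hε1 : ε ≤ 1 := by
    rw [hεd, div_le_one (by positivity)]; have : (0 : ℝ) ≤ p := by positivity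
    linarith
  have hεp : ε * p ≤ 1 / 2 := by
    rw [hεd, div_mul_eq_mul_div, one_mul, div_le_iff₀ (by positivity)]; linarith
  refine ⟨(1 + 1 / ε) ^ p, by positivity, 3 * p + 1, fun τ hτ => ?_⟩
  have h1 : τ ^ (-(ε * p)) ≤ τ ^ (-(1 / 2) : ℝ) * (1 + τ) := by
    rcases le_total τ 1 with h | h
    · calc τ ^ (-(ε * p)) ≤ τ ^ (-(1 / 2) : ℝ) :=
            Real.rpow_le_rpow_of_exponent_ge hτ h (by linarith)
        _ = τ ^ (-(1 / 2) : ℝ) * 1 := by ring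
        _ ≤ _ := by gcongr; linarith
    · have : τ ^ (-(1 / 2) : ℝ) * τ = τ ^ (-(1 / 2) + 1 : ℝ) := by
        rw [Real.rpow_add hτ, Real.rpow_one]
      calc τ ^ (-(ε * p)) ≤ 1 := Real.rpow_le_one_of_one_le_of_nonpos h
            (by have : 0 ≤ ε * p := by positivity
                linarith)
        _ ≤ τ ^ (-(1 / 2) : ℝ) * τ := by
            rw [this]; exact Real.one_le_rpow h (by norm_num)
        _ ≤ _ := by gcongr; linarith
  calc gauge τ ^ p ≤ ((1 + 1 / ε) * (τ ^ (-ε) * (1 + τ) ^ 2) * (1 + τ)) ^ p := by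
        apply pow_le_pow_left₀ (by have := one_le_gauge hτ; linarith)
        unfold gauge
        gcongr
        exact one_add_abs_log_le hε hε1 hτ
    _ = (1 + 1 / ε) ^ p * (τ ^ (-(ε * p)) * (1 + τ) ^ (3 * p)) := by
        rw [mul_pow, mul_pow, mul_pow, ← Real.rpow_natCast (τ ^ (-ε)), ← Real.rpow_mul hτ.le,
          neg_mul, pow_mul (1 + τ) 3 p, ← pow_mul, ← pow_mul]
        ring
    _ ≤ (1 + 1 / ε) ^ p * ((τ ^ (-(1 / 2) : ℝ) * (1 + τ)) * (1 + τ) ^ (3 * p)) := by gcongr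
    _ = _ := by ring

/-- Half of the exponential pays for the polynomial growth. What remains is a majorant whose shape
no longer depends on `p`. -/
lemma gauge_pow_mul_exp_le (p : ℕ) {c : ℝ} (hc : 0 < c) : ∃ C : ℝ, 0 < C ∧ ∀ τ : ℝ, 0 < τ →
    gauge τ ^ p * Real.exp (-c * τ) ≤ C * (τ ^ (-(1 / 2) : ℝ) * Real.exp (-(c / 2) * τ)) := by
  obtain ⟨C, hC, m, h⟩ := gauge_pow_le p
  refine ⟨C * (m.factorial * (2 / c) ^ m * Real.exp (c / 2)), by positivity, fun τ hτ => ?_⟩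
  have h2 : (1 + τ) ^ m ≤ m.factorial * (2 / c) ^ m * Real.exp (c / 2) * Real.exp (c / 2 * τ) := by
    have h3 := Real.pow_div_factorial_le_exp (x := c / 2 * (1 + τ)) (by positivity) m
    rw [div_le_iff₀ (by positivity), mul_pow] at h3
    have e : (c / 2) ^ m * (2 / c) ^ m = 1 := by
      rw [← mul_pow]; field_simp; simp
    calc (1 + τ) ^ m = ((c / 2) ^ m * (1 + τ) ^ m) * (2 / c) ^ m := by
          rw [mul_right_comm, e, one_mul]
      _ ≤ (Real.exp (c / 2 * (1 + τ)) * m.factorial) * (2 / c) ^ m := by gcongr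
      _ = _ := by rw [mul_add, Real.exp_add, mul_one]; ring
  calc gauge τ ^ p * Real.exp (-c * τ)
      ≤ C * (τ ^ (-(1 / 2) : ℝ) * (1 + τ) ^ m) * Real.exp (-c * τ) := by gcongr; exact h τ hτ
    _ ≤ C * (τ ^ (-(1 / 2) : ℝ) * (m.factorial * (2 / c) ^ m * Real.exp (c / 2)
          * Real.exp (c / 2 * τ))) * Real.exp (-c * τ) := by gcongr
    _ = C * (m.factorial * (2 / c) ^ m * Real.exp (c / 2)) * (τ ^ (-(1 / 2) : ℝ)
          * (Real.exp (c / 2 * τ) * Real.exp (-c * τ))) := by ring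
    _ = _ := by rw [← Real.exp_add]; ring_nf

lemma integrableOn_gauge_pow_mul_exp (p : ℕ) {c : ℝ} (hc : 0 < c) :
    IntegrableOn (fun τ => gauge τ ^ p * Real.exp (-c * τ)) (Ioi 0) := by
  obtain ⟨C, hC, h⟩ := gauge_pow_mul_exp_le p hc
  have h1 : IntegrableOn (fun τ : ℝ => τ ^ (-(1 / 2) : ℝ) * Real.exp (-(c / 2) * τ)) (Ioi 0) := by
    have := integrableOn_rpow_mul_exp_neg_mul_rpow (p := 1) (s := -(1 / 2)) (b := c / 2)
      (by norm_num) one_pos (by positivity)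
    simpa using this
  refine Integrable.mono' (h1.const_mul C) ?_ ?_
  · apply ContinuousOn.aestronglyMeasurable _ measurableSet_Ioi
    have := continuousOn_gauge
    fun_prop
  · filter_upwards [ae_restrict_mem measurableSet_Ioi] with τ hτ
    have := one_le_gauge hτ
    rw [Real.norm_of_nonneg (by positivity)]
    exact h τ hτ

/-! ### Euler's constant and the exponential integral near `0` -/

lemma integrableOn_log_mul_exp_neg :
    IntegrableOn (fun v : ℝ => Real.log v * Real.exp (-v)) (Ioi 0) := by
  refine Integrable.mono' (integrableOn_gauge_pow_mul_exp 1 one_pos) ?_ ?_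
  · apply ContinuousOn.aestronglyMeasurable _ measurableSet_Ioi
    have : ContinuousOn Real.log (Ioi 0) := Real.continuousOn_log.mono fun x hx => ne_of_gt hx
    fun_prop
  · filter_upwards [ae_restrict_mem measurableSet_Ioi] with τ hτ
    rw [norm_mul, Real.norm_eq_abs, Real.norm_eq_abs, Real.abs_exp, neg_one_mul, pow_one]
    gcongr
    have := one_add_abs_log_le_gauge hτ
    linarith

/-- Differentiation of the Gamma integral at `s = 1`, where `Γ'(1) = -γ`. -/
lemma integral_log_mul_exp_neg :
    ∫ v in Ioi (0 : ℝ), Real.log v * Real.exp (-v) = -Real.eulerMascheroniConstant := by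
  have h1 := Complex.hasDerivAt_GammaIntegral (s := 1) (by simp)
  have h2 : HasDerivAt Complex.GammaIntegral (-(Real.eulerMascheroniConstant : ℂ)) 1 := by
    refine Complex.hasDerivAt_Gamma_one.congr_of_eventuallyEq ?_
    have : IsOpen {s : ℂ | 0 < s.re} := isOpen_lt continuous_const Complex.continuous_re
    filter_upwards [this.mem_nhds (by simp : (1 : ℂ) ∈ {s : ℂ | 0 < s.re})] with s hs
    exact (Complex.Gamma_eq_integral hs).symm
  have h3 := h1.unique h2
  have h4 : (∫ t : ℝ in Ioi 0, (t : ℂ) ^ ((1 : ℂ) - 1) * (Real.log t * Real.exp (-t)))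
      = ((∫ v in Ioi (0 : ℝ), Real.log v * Real.exp (-v) : ℝ) : ℂ) := by
    rw [← integral_complex_ofReal]
    refine integral_congr_ae (Eventually.of_forall fun t => ?_)
    simp
  rw [h4] at h3
  exact_mod_cast h3

/-- `∫_0^∞ exp(-a e^t) dt`, an exponential integral. -/
noncomputable def expInt (a : ℝ) : ℝ := ∫ t in Ioi (0 : ℝ), Real.exp (-(a * Real.exp t))

lemma exp_neg_mul_exp_le {a : ℝ} (ha : 0 < a) (t : ℝ) :
    Real.exp (-(a * Real.exp t)) ≤ a⁻¹ * Real.exp (-t) := by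
  have h := Real.add_one_le_exp (a * Real.exp t)
  have h0 : 0 < a * Real.exp t := by positivity
  rw [Real.exp_neg, Real.exp_neg t, ← mul_inv]
  exact inv_anti₀ h0 (by linarith)

lemma integrableOn_exp_neg_mul_exp {a : ℝ} (ha : 0 < a) :
    IntegrableOn (fun t => Real.exp (-(a * Real.exp t))) (Ioi 0) := by
  refine Integrable.mono' ((integrableOn_exp_neg_Ioi 0).const_mul a⁻¹)
    (Continuous.aestronglyMeasurable (by fun_prop)) (Eventually.of_forall fun t => ?_)
  rw [Real.norm_of_nonneg (by positivity)]
  exact exp_neg_mul_exp_le ha t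

/-- Integration by parts, with primitive `(t + log a) exp(-a e^t)`, followed by the substitution `v
= a e^t`. The logarithmic singularity becomes explicit and the remaining integral converges as `a →
0`. -/
lemma expInt_eq {a : ℝ} (ha : 0 < a) :
    expInt a = -Real.log a * Real.exp (-a) + ∫ v in Ioi a, Real.log v * Real.exp (-v) := by
  have hI : ∫ v in Ioi a, Real.log v * Real.exp (-v)
      = ∫ t in Ioi (0 : ℝ), (t + Real.log a) * (a * Real.exp t * Real.exp (-(a * Real.exp t))) := by
    have h1 := integral_comp_mul_left_Ioi' (fun v => Real.log v * Real.exp (-v)) 1 ha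
    have h2 := integral_comp_exp_Ioi (fun y => a * (Real.log (a * y) * Real.exp (-(a * y)))) 0
    rw [mul_one] at h1
    rw [Real.exp_zero] at h2
    rw [← h1, ← integral_smul]
    simp only [smul_eq_mul] at h2 ⊢
    rw [← h2]
    refine integral_congr_ae (Eventually.of_forall fun t => ?_)
    simp only
    rw [Real.log_mul ha.ne' (Real.exp_pos t).ne', Real.log_exp]
    ring
  have hint : IntegrableOn (fun t : ℝ =>
      (t + Real.log a) * (a * Real.exp t * Real.exp (-(a * Real.exp t)))) (Ioi 0) := by
    have h1 : IntegrableOn (fun v : ℝ => Real.log v * Real.exp (-v)) (Ioi (a * 1)) :=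
      integrableOn_log_mul_exp_neg.mono_set (Ioi_subset_Ioi (by linarith))
    have h2 := (integrableOn_Ioi_comp_mul_left_iff (fun v : ℝ => Real.log v * Real.exp (-v)) 1 ha).2 h1
    have h3 := (integrableOn_comp_exp_Ioi (fun y => a * (Real.log (a * y) * Real.exp (-(a * y)))) 0).2
      (by rw [Real.exp_zero]; exact h2.const_mul a)
    refine h3.congr (Eventually.of_forall fun t => ?_)
    simp only [smul_eq_mul]
    rw [Real.log_mul ha.ne' (Real.exp_pos t).ne', Real.log_exp]
    ring
  have hd : ∀ t ∈ Ici (0 : ℝ), HasDerivAt (fun t => (t + Real.log a) * Real.exp (-(a * Real.exp t)))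
      (Real.exp (-(a * Real.exp t))
        - (t + Real.log a) * (a * Real.exp t * Real.exp (-(a * Real.exp t)))) t := by
    intro t _
    have h1 := ((hasDerivAt_id t).add_const (Real.log a)).mul
      (((Real.hasDerivAt_exp t).const_mul a).neg.exp)
    refine h1.congr_deriv ?_
    simp; ring
  have hlim : Tendsto (fun t => (t + Real.log a) * Real.exp (-(a * Real.exp t))) atTop (𝓝 0) := by
    have h1 : Tendsto (fun t : ℝ => a⁻¹ * (t ^ 1 * Real.exp (-t))
        + |Real.log a| * (a⁻¹ * Real.exp (-t))) atTop (𝓝 0) := by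
      have h2 := (Real.tendsto_pow_mul_exp_neg_atTop_nhds_zero 1).const_mul a⁻¹
      have h3 := ((Real.tendsto_exp_neg_atTop_nhds_zero).const_mul a⁻¹).const_mul |Real.log a|
      simpa using h2.add h3
    refine squeeze_zero_norm' ?_ h1
    filter_upwards [eventually_ge_atTop 0] with t ht
    rw [norm_mul, Real.norm_eq_abs, Real.norm_eq_abs, Real.abs_exp]
    calc |t + Real.log a| * Real.exp (-(a * Real.exp t))
        ≤ (t + |Real.log a|) * (a⁻¹ * Real.exp (-t)) := by
          gcongr
          · exact (abs_add_le _ _).trans (by rw [abs_of_nonneg ht])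
          · exact exp_neg_mul_exp_le ha t
      _ = _ := by ring
  have key := integral_Ioi_of_hasDerivAt_of_tendsto' hd
    ((integrableOn_exp_neg_mul_exp ha).sub hint) hlim
  rw [integral_sub (integrableOn_exp_neg_mul_exp ha) hint] at key
  simp only [zero_add, Real.exp_zero, mul_one] at key
  rw [hI, expInt]
  linarith

lemma tendsto_expInt_add_log :
    Tendsto (fun a => expInt a + Real.log a) (𝓝[>] 0) (𝓝 (-Real.eulerMascheroniConstant)) := by
  have h1 : Tendsto (fun a => ∫ v in Ioi a, Real.log v * Real.exp (-v)) (𝓝[>] 0)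
      (𝓝 (-Real.eulerMascheroniConstant)) := by
    have hint := integrableOn_log_mul_exp_neg
    -- The indicator makes the integrand integrable on every interval, so that its primitive is
    -- continuous at `0`.
    have h2 : Tendsto (fun a : ℝ => ∫ v in (0 : ℝ)..a,
        (Ioi (0 : ℝ)).indicator (fun v => Real.log v * Real.exp (-v)) v) (𝓝[>] 0) (𝓝 0) := by
      have := (intervalIntegral.continuous_primitive (μ := volume) (f :=
        (Ioi (0 : ℝ)).indicator (fun v => Real.log v * Real.exp (-v)))
        (fun a b => ((integrable_indicator_iff measurableSet_Ioi).2 hint).intervalIntegrable) 0).tendsto 0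
      rw [intervalIntegral.integral_same] at this
      exact this.mono_left nhdsWithin_le_nhds
    have h3 := h2.const_sub (-Real.eulerMascheroniConstant)
    rw [sub_zero] at h3
    refine h3.congr' ?_
    filter_upwards [self_mem_nhdsWithin] with a ha
    have ha' : (0 : ℝ) < a := ha
    have h4 : ∫ v in Ioc 0 a, (Ioi (0 : ℝ)).indicator (fun v => Real.log v * Real.exp (-v)) v
        = ∫ v in Ioc 0 a, Real.log v * Real.exp (-v) := by
      refine setIntegral_congr_fun measurableSet_Ioc fun v hv => ?_
      exact indicator_of_mem (Ioc_subset_Ioi_self hv) _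
    rw [intervalIntegral.integral_of_le ha'.le, h4, ← integral_log_mul_exp_neg,
      ← Ioc_union_Ioi_eq_Ioi ha'.le, setIntegral_union Ioc_disjoint_Ioi_same measurableSet_Ioi
      (hint.mono_set Ioc_subset_Ioi_self) (hint.mono_set (Ioi_subset_Ioi ha'.le))]
    ring
  have h2 : Tendsto (fun a => Real.log a * (1 - Real.exp (-a))) (𝓝[>] 0) (𝓝 0) := by
    have h3 : Tendsto (fun a : ℝ => |Real.log a * a|) (𝓝[>] 0) (𝓝 0) := by
      have := (tendsto_log_mul_rpow_nhdsGT_zero one_pos).abs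
      simpa using this
    refine squeeze_zero_norm' ?_ h3
    filter_upwards [self_mem_nhdsWithin] with a ha
    have ha' : (0 : ℝ) < a := ha
    rw [norm_mul, Real.norm_eq_abs, Real.norm_eq_abs, abs_mul]
    have h4 := Real.add_one_le_exp (-a)
    have h5 : Real.exp (-a) ≤ 1 := Real.exp_le_one_iff.2 (by linarith)
    gcongr ?_ * ?_
    rw [abs_of_nonneg (by linarith), abs_of_pos ha']; linarith
  have h3 := h2.add h1
  rw [zero_add] at h3
  refine h3.congr' ?_
  filter_upwards [self_mem_nhdsWithin] with a ha
  rw [expInt_eq ha]; ring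

/-! ### Bessel's equation for the integral and its behaviour at `0` -/

lemma sinh_norm_le_cosh (t : ℝ) : |Real.sinh t| ≤ Real.cosh t := by
  rw [abs_le]
  have h1 := Real.exp_pos t
  have h2 := Real.exp_pos (-t)
  rw [Real.sinh_eq, Real.cosh_eq]
  constructor <;> linarith

/-- The combination of kernels is the `t`-derivative of `i sinh t exp(iz cosh t)`, whose integral
over the line vanishes. -/
lemma hankelInt_ode {z : ℂ} (hz : 0 < z.im) :
    z * hankelInt 2 z + hankelInt 1 z + z * hankelInt 0 z = 0 := by
  have h0 := integrable_sonineKernel 0 hz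
  have h1 := integrable_sonineKernel 1 hz
  have h2 := integrable_sonineKernel 2 hz
  set g : ℝ → ℂ := fun t => Complex.I * Real.sinh t * Complex.exp (Complex.I * z * Real.cosh t)
  have hg : Integrable g := by
    refine h1.norm.mono' ?_ (Eventually.of_forall fun t => ?_)
    · have c1 : Continuous fun t : ℝ => ((Real.cosh t : ℝ) : ℂ) :=
        Complex.continuous_ofReal.comp Real.continuous_cosh
      have c2 : Continuous fun t : ℝ => ((Real.sinh t : ℝ) : ℂ) :=
        Complex.continuous_ofReal.comp Real.continuous_sinh
      exact Continuous.aestronglyMeasurable (by fun_prop)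
    · simp only [g, sonineKernel, norm_mul, pow_one, Complex.norm_real, Real.norm_eq_abs,
        Complex.norm_I, one_mul]
      have := (sinh_norm_le_cosh t).trans (le_abs_self _)
      gcongr
  have hd : ∀ t, HasDerivAt g
      (z * sonineKernel 2 z t + sonineKernel 1 z t + z * sonineKernel 0 z t) t := by
    intro t
    have e1 : HasDerivAt (fun t : ℝ => ((Real.cosh t : ℝ) : ℂ)) ((Real.sinh t : ℝ) : ℂ) t :=
      (Real.hasDerivAt_cosh t).ofReal_comp
    have e2 : HasDerivAt (fun t : ℝ => ((Real.sinh t : ℝ) : ℂ)) ((Real.cosh t : ℝ) : ℂ) t :=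
      (Real.hasDerivAt_sinh t).ofReal_comp
    refine ((e2.const_mul Complex.I).mul ((e1.const_mul (Complex.I * z)).cexp)).congr_deriv ?_
    have e3 : ((Real.cosh t : ℝ) : ℂ) ^ 2 = ((Real.sinh t : ℝ) : ℂ) ^ 2 + 1 := by
      exact_mod_cast Real.cosh_sq t
    simp only [sonineKernel, mul_pow, e3, Complex.I_sq, pow_one, pow_zero]
    linear_combination (z * ((Real.sinh t : ℝ) : ℂ) ^ 2
      * Complex.exp (Complex.I * z * (Real.cosh t : ℝ))) * Complex.I_sq
  have h21 : Integrable fun t => z * sonineKernel 2 z t + sonineKernel 1 z t :=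
    (h2.const_mul z).add h1
  have h := integral_eq_zero_of_hasDerivAt_of_integrable hd (h21.add (h0.const_mul z)) hg
  rw [integral_add h21 (h0.const_mul z),
    integral_add (h2.const_mul z) h1, integral_const_mul, integral_const_mul] at h
  simp only [hankelInt]
  linear_combination (1 / (Real.pi * Complex.I)) * h

/-- `2 K_0(x)`. -/
noncomputable def twoK (x : ℝ) : ℝ := ∫ t : ℝ, Real.exp (-(x * Real.cosh t))

lemma sonineKernel_I_mul (l : ℕ) (x t : ℝ) : sonineKernel l (Complex.I * x) t
    = Complex.I ^ l * ((Real.cosh t ^ l * Real.exp (-(x * Real.cosh t)) : ℝ) : ℂ) := by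
  rw [sonineKernel, ← mul_assoc, Complex.I_mul_I]; push_cast; ring_nf

lemma hankelInt_zero_I_mul (x : ℝ) :
    hankelInt 0 (Complex.I * x) = 1 / (Real.pi * Complex.I) * twoK x := by
  rw [hankelInt, twoK, ← integral_complex_ofReal]
  simp only [sonineKernel_I_mul, pow_zero, one_mul]

lemma hankelInt_one_I_mul (x : ℝ) :
    hankelInt 1 (Complex.I * x)
      = 1 / Real.pi * ((∫ t : ℝ, Real.cosh t * Real.exp (-(x * Real.cosh t)) : ℝ) : ℂ) := by
  rw [hankelInt, ← integral_complex_ofReal]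
  simp only [sonineKernel_I_mul, pow_one]
  rw [integral_const_mul, ← mul_assoc]
  congr 1
  field_simp

lemma integrable_cosh_pow_mul_exp (l : ℕ) {x : ℝ} (hx : 0 < x) :
    Integrable fun t : ℝ => Real.cosh t ^ l * Real.exp (-(x * Real.cosh t)) := by
  have h := (integrable_sonineKernel l (z := Complex.I * x) (by simpa using hx)).norm
  refine h.congr (Eventually.of_forall fun t => ?_)
  simp only [norm_sonineKernel]
  simp

lemma cosh_sub_sinh_abs (t : ℝ) : Real.cosh t - Real.sinh |t| = Real.exp (-|t|) := by
  rw [← Real.cosh_abs t, Real.cosh_eq, Real.sinh_eq]; ring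

lemma integral_sinh_mul_exp {x : ℝ} (hx : 0 < x) :
    IntegrableOn (fun t : ℝ => x * Real.sinh t * Real.exp (-(x * Real.cosh t))) (Ioi 0) ∧
    ∫ t in Ioi (0 : ℝ), x * Real.sinh t * Real.exp (-(x * Real.cosh t)) = Real.exp (-x) := by
  have hd : ∀ t ∈ Ici (0 : ℝ), HasDerivAt (fun t => -Real.exp (-(x * Real.cosh t)))
      (x * Real.sinh t * Real.exp (-(x * Real.cosh t))) t := by
    intro t _
    refine (((Real.hasDerivAt_cosh t).const_mul x).neg.exp).neg.congr_deriv ?_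
    simp only [Pi.neg_apply]; ring
  have hlim : Tendsto (fun t => -Real.exp (-(x * Real.cosh t))) atTop (𝓝 0) := by
    rw [← neg_zero]
    refine (Real.tendsto_exp_neg_atTop_nhds_zero.comp (Tendsto.const_mul_atTop hx ?_)).neg
    refine tendsto_atTop_mono (fun t => one_add_sq_le_cosh t) (Tendsto.atTop_div_const four_pos ?_)
    exact tendsto_atTop_add_const_left _ _ (tendsto_pow_atTop two_ne_zero)
  have hpos : ∀ t ∈ Ioi (0 : ℝ), 0 ≤ x * Real.sinh t * Real.exp (-(x * Real.cosh t)) := by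
    intro t ht
    have := Real.sinh_pos_iff.2 ht
    positivity
  refine ⟨integrableOn_Ioi_deriv_of_nonneg' hd hpos hlim, ?_⟩
  rw [integral_Ioi_of_hasDerivAt_of_nonneg' hd hpos hlim]; simp

/-- With `sinh` in place of `cosh` the integral over `t > 0` is elementary. The replacement costs
`exp(-t)`, of integral `1`, on each half-line. -/
lemma twoK_one_bounds {x : ℝ} (hx : 0 < x) :
    |x * (∫ t : ℝ, Real.cosh t * Real.exp (-(x * Real.cosh t))) - 2 * Real.exp (-x)| ≤ 2 * x := by
  have h1 : (∫ t : ℝ, Real.cosh t * Real.exp (-(x * Real.cosh t)))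
      = 2 * ∫ t in Ioi (0 : ℝ), Real.cosh t * Real.exp (-(x * Real.cosh t)) := by
    rw [← integral_comp_abs (f := fun t => Real.cosh t * Real.exp (-(x * Real.cosh t)))]
    simp only [Real.cosh_abs]
  obtain ⟨hi, he⟩ := integral_sinh_mul_exp hx
  have hc : IntegrableOn (fun t : ℝ => Real.cosh t * Real.exp (-(x * Real.cosh t))) (Ioi 0) := by
    have := (integrable_cosh_pow_mul_exp 1 hx).integrableOn (s := Ioi 0)
    simpa using this
  have h2 : x * (∫ t : ℝ, Real.cosh t * Real.exp (-(x * Real.cosh t))) - 2 * Real.exp (-x)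
      = 2 * ∫ t in Ioi (0 : ℝ), x * (Real.exp (-t) * Real.exp (-(x * Real.cosh t))) := by
    rw [h1, ← he, ← mul_assoc, mul_comm x 2, mul_assoc, ← mul_sub, ← integral_const_mul,
      ← integral_sub (hc.const_mul x) hi]
    congr 1
    refine setIntegral_congr_fun measurableSet_Ioi fun t ht => ?_
    have := cosh_sub_sinh_abs t
    rw [abs_of_pos ht] at this
    rw [← this]; ring
  rw [h2, abs_mul, abs_two, integral_const_mul, abs_mul, abs_of_pos hx]
  gcongr
  have h3 := norm_integral_le_of_norm_le (μ := volume.restrict (Ioi (0 : ℝ)))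
    (f := fun t => Real.exp (-t) * Real.exp (-(x * Real.cosh t)))
    (integrableOn_exp_neg_Ioi 0) (Eventually.of_forall fun t => ?_)
  · rw [integral_exp_neg_Ioi_zero, Real.norm_eq_abs] at h3
    nlinarith
  · rw [norm_mul, Real.norm_eq_abs, Real.norm_eq_abs, Real.abs_exp, Real.abs_exp]
    have := Real.cosh_pos t
    have h4 : Real.exp (-(x * Real.cosh t)) ≤ 1 := Real.exp_le_one_iff.2 (by nlinarith)
    have h5 := Real.exp_pos (-t)
    nlinarith

/-- On `t > 0` one has `x cosh t = (x/2)e^t + (x/2)e^(-t)`, and dropping the second summand changes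
the integrand by at most `(x/2)e^(-t)`. This transfers the logarithmic asymptotics of `expInt` to
`K_0`. -/
lemma twoK_bounds {x : ℝ} (hx : 0 < x) : |twoK x / 2 - expInt (x / 2)| ≤ x / 2 := by
  have h1 : twoK x = 2 * ∫ t in Ioi (0 : ℝ), Real.exp (-(x * Real.cosh t)) := by
    rw [← integral_comp_abs (f := fun t => Real.exp (-(x * Real.cosh t)))]
    simp only [Real.cosh_abs, twoK]
  have hc : IntegrableOn (fun t : ℝ => Real.exp (-(x * Real.cosh t))) (Ioi 0) := by
    have := (integrable_cosh_pow_mul_exp 0 hx).integrableOn (s := Ioi 0)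
    simpa using this
  rw [h1, expInt, mul_div_cancel_left₀ _ two_ne_zero,
    ← integral_sub hc (integrableOn_exp_neg_mul_exp (half_pos hx))]
  have h3 := norm_integral_le_of_norm_le (μ := volume.restrict (Ioi (0 : ℝ)))
    (f := fun t => Real.exp (-(x * Real.cosh t)) - Real.exp (-(x / 2 * Real.exp t)))
    ((integrableOn_exp_neg_Ioi 0).const_mul (x / 2)) (Eventually.of_forall fun t => ?_)
  · rw [integral_const_mul, integral_exp_neg_Ioi_zero, mul_one] at h3
    exact h3
  · have e1 : Real.exp (-(x * Real.cosh t))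
        = Real.exp (-(x / 2 * Real.exp t)) * Real.exp (-(x / 2 * Real.exp (-t))) := by
      rw [← Real.exp_add, Real.cosh_eq]; ring_nf
    have h4 := Real.add_one_le_exp (-(x / 2 * Real.exp (-t)))
    have h5 : Real.exp (-(x / 2 * Real.exp t)) ≤ 1 :=
      Real.exp_le_one_iff.2 (by have := Real.exp_pos t; nlinarith)
    have h6 : Real.exp (-(x / 2 * Real.exp (-t))) ≤ 1 :=
      Real.exp_le_one_iff.2 (by have := Real.exp_pos (-t); nlinarith)
    have h7 := Real.exp_pos (-(x / 2 * Real.exp t))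
    rw [e1, Real.norm_eq_abs, abs_of_nonpos (by nlinarith)]
    nlinarith

lemma tendsto_twoK :
    Tendsto (fun x : ℝ => twoK x / 2 + Real.log (x / 2) + Real.eulerMascheroniConstant)
      (𝓝[>] 0) (𝓝 0) := by
  have hx2 : Tendsto (fun x : ℝ => x / 2) (𝓝[>] 0) (𝓝[>] 0) := by
    refine tendsto_nhdsWithin_iff.2 ⟨?_, ?_⟩
    · have : Tendsto (fun x : ℝ => x / 2) (𝓝 0) (𝓝 (0 / 2)) := (continuous_id.div_const 2).tendsto 0
      rw [zero_div] at this
      exact this.mono_left nhdsWithin_le_nhds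
    · filter_upwards [self_mem_nhdsWithin] with x hx
      exact half_pos (mem_Ioi.1 hx)
  have h1 := tendsto_expInt_add_log.comp hx2
  have h2 : Tendsto (fun x : ℝ => twoK x / 2 - expInt (x / 2)) (𝓝[>] 0) (𝓝 0) := by
    refine squeeze_zero_norm' ?_ (hx2.mono_right nhdsWithin_le_nhds)
    filter_upwards [self_mem_nhdsWithin] with x hx
    exact twoK_bounds hx
  have h3 := (h2.add h1).add_const Real.eulerMascheroniConstant
  simp only [zero_add, neg_add_cancel] at h3
  refine h3.congr fun x => ?_
  simp only [Function.comp]; ring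

lemma tendsto_twoK_one :
    Tendsto (fun x : ℝ => x * (∫ t : ℝ, Real.cosh t * Real.exp (-(x * Real.cosh t))))
      (𝓝[>] 0) (𝓝 2) := by
  have h1 : Tendsto (fun x : ℝ => 2 * x) (𝓝[>] 0) (𝓝 0) := by
    have : Tendsto (fun x : ℝ => 2 * x) (𝓝 0) (𝓝 (2 * 0)) := (continuous_const_mul 2).tendsto 0
    rw [mul_zero] at this
    exact this.mono_left nhdsWithin_le_nhds
  have h2 : Tendsto (fun x : ℝ => x * (∫ t : ℝ, Real.cosh t * Real.exp (-(x * Real.cosh t)))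
      - 2 * Real.exp (-x)) (𝓝[>] 0) (𝓝 0) := by
    refine squeeze_zero_norm' ?_ h1
    filter_upwards [self_mem_nhdsWithin] with x hx
    exact twoK_one_bounds hx
  have h3 : Tendsto (fun x : ℝ => 2 * Real.exp (-x)) (𝓝[>] 0) (𝓝 2) := by
    have : Tendsto (fun x : ℝ => 2 * Real.exp (-x)) (𝓝 0) (𝓝 (2 * Real.exp (-0))) :=
      (Continuous.tendsto (by fun_prop) 0)
    simp only [neg_zero, Real.exp_zero, mul_one] at this
    exact this.mono_left nhdsWithin_le_nhds
  simpa using h2.add h3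

/-! ### Identification of the series of `H_0` with the integral -/

lemma eq_of_hasDerivAt_zero {f : ℝ → ℂ} {c : ℂ} (hf : ∀ x, 0 < x → HasDerivAt f 0 x)
    (hl : Tendsto f (𝓝[>] 0) (𝓝 c)) {x : ℝ} (hx : 0 < x) : f x = c := by
  have h1 : ∀ y ∈ Ioi (0 : ℝ), f y = f x := fun y hy =>
    isOpen_Ioi.is_const_of_deriv_eq_zero isPreconnected_Ioi
      (fun w hw => (hf w hw).differentiableAt.differentiableWithinAt)
      (fun w hw => (hf w hw).deriv) hy hx
  refine tendsto_nhds_unique (tendsto_const_nhds.congr' ?_) hl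
  filter_upwards [self_mem_nhdsWithin] with y hy
  exact (h1 y hy).symm

/-- The modified Bessel equation is written as a first-order system with `E = x D'`, `b = x a'`. The
Wronskian `E a - D b` is constant and tends to `0`, hence vanishes. It is the numerator of `(D/a)'`,
so `D/a` is constant too, with limit `0`. -/
lemma besselSystem_unique {D E a b : ℝ → ℂ}
    (hD : ∀ x : ℝ, 0 < x → HasDerivAt D (E x / x) x)
    (hE : ∀ x : ℝ, 0 < x → HasDerivAt E (x * D x) x)
    (ha : ∀ x : ℝ, 0 < x → HasDerivAt a (b x / x) x)
    (hb : ∀ x : ℝ, 0 < x → HasDerivAt b (x * a x) x)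
    (lD : Tendsto D (𝓝[>] 0) (𝓝 0)) (lE : Tendsto E (𝓝[>] 0) (𝓝 0))
    {a₀ b₀ : ℂ} (la : Tendsto a (𝓝[>] 0) (𝓝 a₀)) (lb : Tendsto b (𝓝[>] 0) (𝓝 b₀))
    (ha₀ : a₀ ≠ 0) (ha' : ∀ x : ℝ, 0 < x → a x ≠ 0) {x : ℝ} (hx : 0 < x) : D x = 0 := by
  have hw : ∀ x : ℝ, 0 < x → E x * a x - D x * b x = 0 := by
    intro x hx
    refine eq_of_hasDerivAt_zero (f := fun x => E x * a x - D x * b x) (fun y hy => ?_) ?_ hx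
    · refine (((hE y hy).mul (ha y hy)).sub ((hD y hy).mul (hb y hy))).congr_deriv ?_
      have : (y : ℂ) ≠ 0 := by exact_mod_cast hy.ne'
      field_simp; ring
    · simpa using (lE.mul la).sub (lD.mul lb)
  have hq : D x / a x = 0 := by
    refine eq_of_hasDerivAt_zero (f := fun x => D x / a x) (fun y hy => ?_) ?_ hx
    · refine ((hD y hy).div (ha y hy) (ha' y hy)).congr_deriv ?_
      have h1 : (y : ℂ) ≠ 0 := by exact_mod_cast hy.ne'
      have h2 := ha' y hy
      have h3 := hw y hy
      field_simp
      linear_combination h3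
    · have h := lD.div la ha₀
      rwa [zero_div] at h
  exact (div_eq_zero_iff.1 hq).resolve_right (ha' x hx)

lemma fI_zero : fI 0 = 1 := by
  rw [fI, seriesSum, tsum_eq_single 0]
  · simp [coeffI]
  · intro k hk; simp [hk]

lemma fS_zero : fS 0 = 0 := by
  rw [fS, seriesSum, tsum_eq_single 0]
  · simp [coeffS]
  · intro k hk; simp [hk]

lemma fI_ne_zero {q : ℝ} (hq : 0 ≤ q) : fI q ≠ 0 := by
  have hs : Summable fun k : ℕ => 1 / ((k.factorial : ℝ) ^ 2) * q ^ k := by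
    have := (summable_series norm_coeffI_le (q : ℂ))
    rw [← Complex.summable_ofReal]
    refine this.congr fun k => ?_
    simp [coeffI]
  have h1 : fI q = ((∑' k : ℕ, 1 / ((k.factorial : ℝ) ^ 2) * q ^ k : ℝ) : ℂ) := by
    rw [fI, seriesSum, Complex.ofReal_tsum]
    refine tsum_congr fun k => ?_
    simp [coeffI]
  have h2 : 1 ≤ ∑' k : ℕ, 1 / ((k.factorial : ℝ) ^ 2) * q ^ k := by
    have := hs.le_tsum 0 (fun k _ => by positivity)
    simpa using this
  rw [h1]
  exact Complex.ofReal_ne_zero.2 (lt_of_lt_of_le one_pos h2).ne'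

lemma neg_sq_I_mul (x : ℝ) : -((Complex.I * x) ^ 2) / 4 = ((x ^ 2 / 4 : ℝ) : ℂ) := by
  rw [mul_pow, Complex.I_sq]; push_cast; ring

lemma log_I_mul {x : ℝ} (hx : 0 < x) :
    Complex.log (Complex.I * x / 2) = (Real.log (x / 2) : ℂ) + Complex.I * (Real.pi / 2) := by
  have h1 : Complex.I * x / 2 = ((x / 2 : ℝ) : ℂ) * Complex.I := by push_cast; ring
  rw [h1, Complex.log_ofReal_mul (half_pos hx) Complex.I_ne_zero, Complex.log_I]
  ring

/-- `-K_0(x)` by its series. -/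
noncomputable def negKSeries (x : ℝ) : ℂ :=
  ((Real.log (x / 2) : ℂ) + Real.eulerMascheroniConstant) * fI ((x ^ 2 / 4 : ℝ) : ℂ)
    - fS ((x ^ 2 / 4 : ℝ) : ℂ)

/-- `-x K_0'(x)` by its series. -/
noncomputable def negKSeriesDeriv (x : ℝ) : ℂ :=
  fI ((x ^ 2 / 4 : ℝ) : ℂ)
    + ((Real.log (x / 2) : ℂ) + Real.eulerMascheroniConstant)
      * (2 * (((x ^ 2 / 4 : ℝ) : ℂ) * fI' ((x ^ 2 / 4 : ℝ) : ℂ)))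
    - 2 * (((x ^ 2 / 4 : ℝ) : ℂ) * fS' ((x ^ 2 / 4 : ℝ) : ℂ))

/-- The term `iπ/2` in `log(ix/2)`, multiplied by `i · 2/π`, contributes `-I_0(x)` and cancels
`J_0(ix) = I_0(x)`. -/
lemma hankel0_I_mul {x : ℝ} (hx : 0 < x) :
    hankel0 (Complex.I * x) = Complex.I * (2 / Real.pi) * negKSeries x := by
  rw [hankel0, besselJ_zero_eq, besselY0_eq, neg_sq_I_mul, log_I_mul hx, negKSeries]
  have : (Real.pi : ℂ) ≠ 0 := by exact_mod_cast Real.pi_ne_zero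
  field_simp
  linear_combination (Real.pi * fI ((x ^ 2 / 4 : ℝ) : ℂ)) * Complex.I_sq

lemma hasDerivAt_sq_div_four (x : ℝ) :
    HasDerivAt (fun x : ℝ => ((x ^ 2 / 4 : ℝ) : ℂ)) ((x / 2 : ℝ) : ℂ) x := by
  have h : HasDerivAt (fun x : ℝ => x ^ 2 / 4) (x / 2) x := by
    refine ((hasDerivAt_pow 2 x).div_const 4).congr_deriv ?_
    simp; ring
  exact h.ofReal_comp

lemma hasDerivAt_comp_sq {f : ℂ → ℂ} {f' : ℂ} {x : ℝ}
    (hf : HasDerivAt f f' ((x ^ 2 / 4 : ℝ) : ℂ)) :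
    HasDerivAt (fun x : ℝ => f ((x ^ 2 / 4 : ℝ) : ℂ)) (f' * ((x / 2 : ℝ) : ℂ)) x :=
  hf.comp x (hasDerivAt_sq_div_four x)

lemma hasDerivAt_log_half {x : ℝ} (hx : 0 < x) :
    HasDerivAt (fun x : ℝ => ((Real.log (x / 2) : ℝ) : ℂ) + Real.eulerMascheroniConstant)
      (1 / (x : ℂ)) x := by
  have h : HasDerivAt (fun x : ℝ => Real.log (x / 2)) (1 / x) x := by
    refine (((hasDerivAt_id x).div_const 2).log (by simp; positivity)).congr_deriv ?_
    simp; field_simp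
  have := (h.ofReal_comp).add_const (Real.eulerMascheroniConstant : ℂ)
  simpa using this

lemma hasDerivAt_negKSeries {x : ℝ} (hx : 0 < x) :
    HasDerivAt negKSeries (negKSeriesDeriv x / x) x := by
  refine (((hasDerivAt_log_half hx).mul (hasDerivAt_comp_sq (hasDerivAt_fI _))).sub
    (hasDerivAt_comp_sq (hasDerivAt_fS _))).congr_deriv ?_
  have : (x : ℂ) ≠ 0 := by exact_mod_cast hx.ne'
  rw [negKSeriesDeriv]; push_cast
  field_simp; ring

lemma hasDerivAt_negKSeriesDeriv {x : ℝ} (hx : 0 < x) :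
    HasDerivAt negKSeriesDeriv (x * negKSeries x) x := by
  refine (((hasDerivAt_comp_sq (hasDerivAt_fI _)).add ((hasDerivAt_log_half hx).mul
    ((hasDerivAt_comp_sq (hasDerivAt_mul_fI' _)).const_mul 2))).sub
    ((hasDerivAt_comp_sq (hasDerivAt_mul_fS' _)).const_mul 2)).congr_deriv ?_
  have : (x : ℂ) ≠ 0 := by exact_mod_cast hx.ne'
  rw [negKSeries]; push_cast
  field_simp; ring

/-- The increment of `f` at `x²/4` is `O(x)`, and `x log x → 0`. -/
lemma tendsto_log_mul_comp_sq {f : ℂ → ℂ} {f' : ℂ} (hf : HasDerivAt f f' 0) :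
    Tendsto (fun x : ℝ => ((Real.log (x / 2) : ℂ) + Real.eulerMascheroniConstant)
      * (f ((x ^ 2 / 4 : ℝ) : ℂ) - f 0)) (𝓝[>] 0) (𝓝 0) := by
  have hf' : HasDerivAt f f' (((0 : ℝ) ^ 2 / 4 : ℝ) : ℂ) := by simpa using hf
  have h1 := (hasDerivAt_comp_sq hf').tendsto_slope_zero_right
  simp only [zero_add, zero_div, Complex.ofReal_zero, mul_zero, ne_eq, OfNat.ofNat_ne_zero,
    not_false_eq_true, zero_pow] at h1
  have hx : Tendsto (fun x : ℝ => x) (𝓝[>] 0) (𝓝 0) := tendsto_id.mono_left nhdsWithin_le_nhds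
  have h2 : Tendsto (fun x : ℝ => (Real.log (x / 2) + Real.eulerMascheroniConstant) * x)
      (𝓝[>] 0) (𝓝 0) := by
    have h3 := tendsto_log_mul_rpow_nhdsGT_zero one_pos
    have h4 := h3.add (hx.const_mul (-Real.log 2 + Real.eulerMascheroniConstant))
    rw [mul_zero, zero_add] at h4
    refine h4.congr' ?_
    filter_upwards [self_mem_nhdsWithin] with x hx
    rw [Real.log_div (ne_of_gt hx) two_ne_zero, Real.rpow_one]; ring
  have h3 := ((Complex.continuous_ofReal.tendsto 0).comp h2).mul h1
  simp only [Complex.ofReal_zero, zero_mul] at h3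
  refine h3.congr' ?_
  filter_upwards [self_mem_nhdsWithin] with x hx
  have : (x : ℂ) ≠ 0 := by exact_mod_cast (ne_of_gt hx)
  simp only [Function.comp, Complex.real_smul]; push_cast
  field_simp

lemma tendsto_comp_sq {f : ℂ → ℂ} (hf : ContinuousAt f 0) :
    Tendsto (fun x : ℝ => f ((x ^ 2 / 4 : ℝ) : ℂ)) (𝓝[>] 0) (𝓝 (f 0)) := by
  have h1 : Tendsto (fun x : ℝ => ((x ^ 2 / 4 : ℝ) : ℂ)) (𝓝[>] 0) (𝓝 0) := by
    have := (hasDerivAt_sq_div_four 0).continuousAt.tendsto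
    simp only [ne_eq, OfNat.ofNat_ne_zero, not_false_eq_true, zero_pow, zero_div,
      Complex.ofReal_zero] at this
    exact this.mono_left nhdsWithin_le_nhds
  exact hf.tendsto.comp h1

lemma hankel0_eq_hankelInt_I_mul {x : ℝ} (hx : 0 < x) :
    hankel0 (Complex.I * x) = hankelInt 0 (Complex.I * x) := by
  have hpi : (Real.pi : ℂ) ≠ 0 := by exact_mod_cast Real.pi_ne_zero
  -- The normalisations make `A` the integral form of `-K_0` and `B = x A'` that of `-x K_0'`,
  -- matching `negKSeries` and `negKSeriesDeriv`.
  set A : ℝ → ℂ := fun x => hankelInt 0 (Complex.I * x) * (Real.pi / (2 * Complex.I)) with hA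
  set B : ℝ → ℂ := fun x => x * hankelInt 1 (Complex.I * x) * (Real.pi / 2) with hB
  have him : ∀ x : ℝ, 0 < x → 0 < (Complex.I * (x : ℂ)).im := fun x hx => by simpa using hx
  have hc : ∀ (l : ℕ) (x : ℝ), 0 < x → HasDerivAt (fun x : ℝ => hankelInt l (Complex.I * x))
      (hankelInt (l + 1) (Complex.I * x) * Complex.I) x := by
    intro l x hx
    have h1 : HasDerivAt (fun x : ℝ => Complex.I * (x : ℂ)) Complex.I x := by
      simpa using ((hasDerivAt_id x).ofReal_comp).const_mul Complex.I
    exact HasDerivAt.comp (h₂ := hankelInt l) x (hasDerivAt_hankelInt l (him x hx)) h1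
  have dA : ∀ x : ℝ, 0 < x → HasDerivAt A (B x / x) x := by
    intro x hx
    have : (x : ℂ) ≠ 0 := by exact_mod_cast hx.ne'
    refine ((hc 0 x hx).mul_const _).congr_deriv ?_
    simp only [hB, zero_add]
    field_simp [Complex.I_ne_zero]
  have dB : ∀ x : ℝ, 0 < x → HasDerivAt B (x * A x) x := by
    intro x hx
    have h1 : HasDerivAt (fun x : ℝ => (x : ℂ)) 1 x := by
      simpa using (hasDerivAt_id x).ofReal_comp
    refine ((h1.mul (hc 1 x hx)).mul_const _).congr_deriv ?_
    have h2 := hankelInt_ode (him x hx)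
    simp only [hA, one_add_one_eq_two]
    field_simp [Complex.I_ne_zero]
    linear_combination Complex.I * h2 - (x : ℂ) * hankelInt 0 (Complex.I * x) * Complex.I_sq
  have lA : Tendsto (fun x => negKSeries x - A x) (𝓝[>] 0) (𝓝 0) := by
    have h1 := (Complex.continuous_ofReal.tendsto 0).comp tendsto_twoK
    have h2 := tendsto_log_mul_comp_sq (hasDerivAt_fI 0)
    have h3 := tendsto_comp_sq (hasDerivAt_fS 0).continuousAt
    rw [fS_zero] at h3
    rw [fI_zero] at h2
    have h4 := (h1.add h2).sub h3
    simp only [Complex.ofReal_zero, add_zero, sub_zero] at h4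
    refine h4.congr' ?_
    filter_upwards [self_mem_nhdsWithin] with x hx
    simp only [Function.comp, hA, hankelInt_zero_I_mul, negKSeries]
    push_cast
    field_simp [Complex.I_ne_zero]
    rw [Complex.I_sq]; ring
  have lB : Tendsto (fun x => negKSeriesDeriv x - B x) (𝓝[>] 0) (𝓝 0) := by
    have h1 := (Complex.continuous_ofReal.tendsto 2).comp tendsto_twoK_one
    have h2 := tendsto_log_mul_comp_sq (hasDerivAt_mul_fI' 0)
    have h3 := tendsto_comp_sq (hasDerivAt_mul_fS' 0).continuousAt
    have h4 := tendsto_comp_sq (hasDerivAt_fI 0).continuousAt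
    rw [zero_mul] at h3 h2
    rw [fI_zero] at h4
    have h5 := (((h2.const_mul 2).sub (h3.const_mul 2)).add h4).sub (h1.div_const 2)
    have e : (2 * 0 - 2 * 0 + 1 - ((2 : ℝ) : ℂ) / 2) = 0 := by norm_num
    rw [e] at h5
    refine h5.congr' ?_
    filter_upwards [self_mem_nhdsWithin] with x hx
    simp only [Function.comp, hB, hankelInt_one_I_mul, negKSeriesDeriv]
    push_cast
    field_simp
    ring
  -- The comparison solution is `I_0`, which is regular at `0` and has no zero on the positive axis.
  have key := besselSystem_unique (D := fun x => negKSeries x - A x)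
    (E := fun x => negKSeriesDeriv x - B x)
    (a := fun x => fI ((x ^ 2 / 4 : ℝ) : ℂ))
    (b := fun x => 2 * (((x ^ 2 / 4 : ℝ) : ℂ) * fI' ((x ^ 2 / 4 : ℝ) : ℂ)))
    (fun x hx => ((hasDerivAt_negKSeries hx).sub (dA x hx)).congr_deriv (by ring))
    (fun x hx => ((hasDerivAt_negKSeriesDeriv hx).sub (dB x hx)).congr_deriv (by ring))
    (fun x hx => (hasDerivAt_comp_sq (hasDerivAt_fI _)).congr_deriv (by
      have : (x : ℂ) ≠ 0 := by exact_mod_cast hx.ne'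
      push_cast; field_simp; ring))
    (fun x hx => ((hasDerivAt_comp_sq (hasDerivAt_mul_fI' _)).const_mul 2).congr_deriv (by
      push_cast; ring))
    lA lB (tendsto_comp_sq (hasDerivAt_fI 0).continuousAt)
    ((tendsto_comp_sq (hasDerivAt_mul_fI' 0).continuousAt).const_mul 2)
    (by rw [fI_zero]; exact one_ne_zero) (fun x _ => fI_ne_zero (by positivity)) hx
  rw [hankel0_I_mul hx, sub_eq_zero.1 key]
  simp only [hA]
  field_simp [Complex.I_ne_zero]

/-- The open upper half-plane. -/
def upperHalf : Set ℂ := {z | 0 < z.im}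

lemma isOpen_upperHalf : IsOpen upperHalf := isOpen_lt continuous_const Complex.continuous_im

lemma convex_upperHalf : Convex ℝ upperHalf := convex_halfSpace_im_gt 0

/-- Both sides are holomorphic in the upper half-plane and agree on the imaginary axis, in
particular at points accumulating at `i`. -/
lemma hankel0_eq_hankelInt {z : ℂ} (hz : 0 < z.im) : hankel0 z = hankelInt 0 z := by
  have h1 : AnalyticOnNhd ℂ hankel0 upperHalf := DifferentiableOn.analyticOnNhd
    (fun w hw => (differentiableAt_hankel0
      (Complex.mem_slitPlane_iff.2 (Or.inr (ne_of_gt hw)))).differentiableWithinAt) isOpen_upperHalf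
  have h2 : AnalyticOnNhd ℂ (hankelInt 0) upperHalf := DifferentiableOn.analyticOnNhd
    (fun w hw => (hasDerivAt_hankelInt 0 hw).differentiableAt.differentiableWithinAt)
    isOpen_upperHalf
  have hI : Complex.I ∈ upperHalf := by simp [upperHalf]
  refine h1.eqOn_of_preconnected_of_frequently_eq h2 convex_upperHalf.isPreconnected hI ?_ hz
  have ht : Tendsto (fun x : ℝ => Complex.I * x) (𝓝[>] 1) (𝓝[≠] Complex.I) := by
    refine tendsto_nhdsWithin_iff.2 ⟨?_, ?_⟩
    · have : Tendsto (fun x : ℝ => Complex.I * x) (𝓝 1) (𝓝 (Complex.I * (1 : ℝ))) :=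
        Continuous.tendsto (by fun_prop) 1
      rw [Complex.ofReal_one, mul_one] at this
      exact this.mono_left nhdsWithin_le_nhds
    · filter_upwards [self_mem_nhdsWithin] with x hx h
      have h3 := congrArg Complex.im h
      simp at h3
      exact (ne_of_gt hx) h3
  refine ht.frequently (Eventually.frequently ?_)
  filter_upwards [self_mem_nhdsWithin] with x hx
  exact hankel0_eq_hankelInt_I_mul (lt_trans one_pos hx)

lemma iteratedDeriv_hankel0 (l : ℕ) {z : ℂ} (hz : 0 < z.im) :
    iteratedDeriv l hankel0 z = hankelInt l z := by
  induction l generalizing z with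
  | zero => rw [iteratedDeriv_zero, hankel0_eq_hankelInt hz]
  | succ l ih =>
    rw [iteratedDeriv_succ]
    have h : iteratedDeriv l hankel0 =ᶠ[𝓝 z] hankelInt l := by
      filter_upwards [isOpen_upperHalf.mem_nhds hz] with w hw using ih hw
    rw [h.deriv_eq, (hasDerivAt_hankelInt l hz).deriv]

/-! ### A bound for `H_0` uniform up to the real axis -/

lemma integral_cosh_div_sinh_sq :
    IntegrableOn (fun t : ℝ => Real.cosh t / Real.sinh t ^ 2) (Ioi 1) ∧
    ∫ t in Ioi (1 : ℝ), Real.cosh t / Real.sinh t ^ 2 = (Real.sinh 1)⁻¹ := by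
  have hd : ∀ t ∈ Ici (1 : ℝ), HasDerivAt (fun t => -(Real.sinh t)⁻¹)
      (Real.cosh t / Real.sinh t ^ 2) t := by
    intro t ht
    have : Real.sinh t ≠ 0 := (Real.sinh_pos_iff.2 (lt_of_lt_of_le one_pos ht)).ne'
    refine ((Real.hasDerivAt_sinh t).inv this).neg.congr_deriv ?_
    ring
  have hlim : Tendsto (fun t => -(Real.sinh t)⁻¹) atTop (𝓝 0) := by
    rw [← neg_zero]
    refine (tendsto_inv_atTop_zero.comp ?_).neg
    refine tendsto_atTop_mono' _ ?_ tendsto_id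
    filter_upwards [eventually_ge_atTop 0] with t ht
    exact Real.self_le_sinh_iff.2 ht
  have hpos : ∀ t ∈ Ioi (1 : ℝ), 0 ≤ Real.cosh t / Real.sinh t ^ 2 := by
    intro t _
    have := Real.cosh_pos t
    positivity
  refine ⟨integrableOn_Ioi_deriv_of_nonneg' hd hpos hlim, ?_⟩
  rw [integral_Ioi_of_hasDerivAt_of_nonneg' hd hpos hlim]; simp

lemma norm_exp_I_mul_cosh_le {z : ℂ} (hz : 0 ≤ z.im) (t : ℝ) :
    ‖Complex.exp (Complex.I * z * Real.cosh t)‖ ≤ 1 := by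
  have h := norm_sonineKernel 0 z t
  rw [sonineKernel, pow_zero, one_mul, pow_zero, one_mul] at h
  rw [h]
  have := Real.cosh_pos t
  exact Real.exp_le_one_iff.2 (by nlinarith)

/-- Integration by parts against `1/(iz sinh t)` exploits the oscillation, so the bound depends on
`|z|` alone and survives `Im z → 0`. The earlier exponential bound does not. -/
lemma norm_integral_sonine_tail_le {z : ℂ} (hz : 0 < z.im) :
    ‖∫ t in Ioi (1 : ℝ), sonineKernel 0 z t‖ ≤ 2 / ‖z‖ := by
  have hz0 : z ≠ 0 := by rintro rfl; simp at hz
  have hs : ∀ t ∈ Ici (1 : ℝ), (Real.sinh t : ℂ) ≠ 0 := fun t ht =>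
    Complex.ofReal_ne_zero.2 (Real.sinh_pos_iff.2 (lt_of_lt_of_le one_pos ht)).ne'
  obtain ⟨hci, hce⟩ := integral_cosh_div_sinh_sq
  set E : ℝ → ℂ := fun t => Complex.exp (Complex.I * z * Real.cosh t) with hE
  set G : ℝ → ℂ := fun t => E t / (Complex.I * z * Real.sinh t) with hG
  set R : ℝ → ℂ := fun t => E t * Real.cosh t / (Complex.I * z * (Real.sinh t) ^ 2) with hR
  have c1 : Continuous fun t : ℝ => ((Real.cosh t : ℝ) : ℂ) :=
    Complex.continuous_ofReal.comp Real.continuous_cosh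
  have c2 : Continuous fun t : ℝ => ((Real.sinh t : ℝ) : ℂ) :=
    Complex.continuous_ofReal.comp Real.continuous_sinh
  have hRb : ∀ t, ‖R t‖ ≤ ‖z‖⁻¹ * (Real.cosh t / Real.sinh t ^ 2) := by
    intro t
    have hc := Real.cosh_pos t
    simp only [hR, norm_div, norm_mul, norm_pow, Complex.norm_I, Complex.norm_real,
      Real.norm_eq_abs, sq_abs, abs_of_pos hc, one_mul]
    have h1 := norm_exp_I_mul_cosh_le hz.le t
    calc ‖E t‖ * Real.cosh t / (‖z‖ * Real.sinh t ^ 2)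
        ≤ 1 * Real.cosh t / (‖z‖ * Real.sinh t ^ 2) := by gcongr
      _ = _ := by rw [one_mul, div_mul_eq_div_div_swap, div_eq_inv_mul]
  have hRi : IntegrableOn R (Ioi 1) := by
    refine (hci.const_mul ‖z‖⁻¹).mono' ?_ (Eventually.of_forall hRb)
    refine ContinuousOn.aestronglyMeasurable ?_ measurableSet_Ioi
    refine ContinuousOn.div (by fun_prop) (by fun_prop) fun t ht => ?_
    exact mul_ne_zero (mul_ne_zero Complex.I_ne_zero hz0)
      (pow_ne_zero _ (hs t (mem_Ici_of_Ioi ht)))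
  have hKi : IntegrableOn (sonineKernel 0 z) (Ioi 1) := (integrable_sonineKernel 0 hz).integrableOn
  have hd : ∀ t ∈ Ici (1 : ℝ), HasDerivAt G (sonineKernel 0 z t - R t) t := by
    intro t ht
    have e1 : HasDerivAt (fun t : ℝ => ((Real.cosh t : ℝ) : ℂ)) ((Real.sinh t : ℝ) : ℂ) t :=
      (Real.hasDerivAt_cosh t).ofReal_comp
    have e2 : HasDerivAt (fun t : ℝ => ((Real.sinh t : ℝ) : ℂ)) ((Real.cosh t : ℝ) : ℂ) t :=
      (Real.hasDerivAt_sinh t).ofReal_comp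
    have h3 := hs t ht
    refine (((e1.const_mul (Complex.I * z)).cexp).div (e2.const_mul (Complex.I * z))
      (mul_ne_zero (mul_ne_zero Complex.I_ne_zero hz0) h3)).congr_deriv ?_
    simp only [sonineKernel, hR, hE, pow_zero, one_mul]
    have := Complex.I_ne_zero
    field_simp
  have hGb : ∀ t, ‖G t‖ ≤ ‖z‖⁻¹ * |Real.sinh t|⁻¹ := by
    intro t
    simp only [hG, norm_div, norm_mul, Complex.norm_I, Complex.norm_real,
      Real.norm_eq_abs, one_mul]
    have h1 := norm_exp_I_mul_cosh_le hz.le t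
    rw [← mul_inv, ← one_div]
    gcongr
  have hlim : Tendsto G atTop (𝓝 0) := by
    have h : Tendsto (fun t => ‖z‖⁻¹ * |Real.sinh t|⁻¹) atTop (𝓝 0) := by
      rw [← mul_zero ‖z‖⁻¹]
      refine Tendsto.const_mul _ (tendsto_inv_atTop_zero.comp ?_)
      refine tendsto_atTop_mono' _ ?_ tendsto_id
      filter_upwards [eventually_ge_atTop 0] with t ht
      exact (Real.self_le_sinh_iff.2 ht).trans (le_abs_self _)
    exact squeeze_zero_norm hGb h
  have key := integral_Ioi_of_hasDerivAt_of_tendsto' hd (hKi.sub hRi) hlim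
  rw [integral_sub hKi hRi, zero_sub] at key
  have key' : ∫ t in Ioi (1 : ℝ), sonineKernel 0 z t = -G 1 + ∫ t in Ioi (1 : ℝ), R t := by
    linear_combination key
  have hs1 : (Real.sinh 1)⁻¹ ≤ 1 := inv_le_one_of_one_le₀ (Real.self_le_sinh_iff.2 zero_le_one)
  have h1 := norm_integral_le_of_norm_le (hci.const_mul ‖z‖⁻¹) (Eventually.of_forall hRb)
  rw [integral_const_mul, hce] at h1
  have h2 := hGb 1
  rw [abs_of_pos (Real.sinh_pos_iff.2 one_pos)] at h2
  have h3 : ‖z‖⁻¹ * (Real.sinh 1)⁻¹ ≤ ‖z‖⁻¹ * 1 := by gcongr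
  calc _ = ‖-G 1 + ∫ t in Ioi (1 : ℝ), R t‖ := by rw [key']
    _ ≤ ‖-G 1‖ + ‖∫ t in Ioi (1 : ℝ), R t‖ := norm_add_le _ _
    _ ≤ ‖z‖⁻¹ + ‖z‖⁻¹ := by rw [norm_neg]; linarith
    _ = _ := by ring

/-- The kernel has norm at most `1`, which handles `|t| ≤ 1`; the tails are oscillatory. This is the
domination needed when the ray is lowered onto the real axis. -/
lemma norm_hankelInt_zero_le {z : ℂ} (hz : 0 < z.im) :
    ‖hankelInt 0 z‖ ≤ 2 + 4 / ‖z‖ := by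
  have hi := integrable_sonineKernel 0 hz
  have h1 : ∫ t in Iic (0 : ℝ), sonineKernel 0 z t = ∫ t in Ioi (0 : ℝ), sonineKernel 0 z t := by
    rw [← neg_zero, ← integral_comp_neg_Iic, neg_zero]
    simp only [sonineKernel, Real.cosh_neg]
  have h2 : ∫ t : ℝ, sonineKernel 0 z t = 2 * ∫ t in Ioi (0 : ℝ), sonineKernel 0 z t := by
    rw [← intervalIntegral.integral_Iic_add_Ioi hi.integrableOn hi.integrableOn (b := 0), h1]; ring
  have h3 : ∫ t in Ioi (0 : ℝ), sonineKernel 0 z t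
      = (∫ t in Ioc (0 : ℝ) 1, sonineKernel 0 z t) + ∫ t in Ioi (1 : ℝ), sonineKernel 0 z t := by
    rw [← Ioc_union_Ioi_eq_Ioi (zero_le_one' ℝ), setIntegral_union Ioc_disjoint_Ioi_same
      measurableSet_Ioi hi.integrableOn hi.integrableOn]
  have h4 : ‖∫ t in Ioc (0 : ℝ) 1, sonineKernel 0 z t‖ ≤ 1 := by
    have := norm_setIntegral_le_of_norm_le_const (μ := volume) (s := Ioc (0 : ℝ) 1) (C := 1)
      (f := sonineKernel 0 z) (by simp) (fun t _ => by
        rw [sonineKernel, pow_zero, one_mul]; exact norm_exp_I_mul_cosh_le hz.le t)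
    simpa using this
  have h5 := norm_integral_sonine_tail_le hz
  have h6 : ‖∫ t : ℝ, sonineKernel 0 z t‖ ≤ 2 * (1 + 2 / ‖z‖) := by
    rw [h2, h3, norm_mul, Complex.norm_ofNat]
    gcongr
    exact (norm_add_le _ _).trans (add_le_add h4 h5)
  have h7 : (Real.pi)⁻¹ ≤ 1 := inv_le_one_of_one_le₀ (by linarith [Real.pi_gt_three])
  rw [hankelInt, norm_mul, norm_div, norm_mul, norm_one, Complex.norm_I, Complex.norm_real,
    Real.norm_eq_abs, abs_of_pos Real.pi_pos, mul_one, one_div]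
  calc (Real.pi)⁻¹ * _ ≤ 1 * (2 * (1 + 2 / ‖z‖)) := by gcongr
    _ = _ := by ring

lemma re_hankel0_ofReal {x : ℝ} (hx : 0 < x) : (hankel0 x).re = (besselJ 0 x).re := by
  have h1 : fI (-((x : ℂ) ^ 2) / 4) = ((∑' k : ℕ, 1 / ((k.factorial : ℝ) ^ 2)
      * (-(x ^ 2) / 4) ^ k : ℝ) : ℂ) := by
    rw [fI, seriesSum, Complex.ofReal_tsum]
    refine tsum_congr fun k => ?_
    simp [coeffI]
  have h2 : fS (-((x : ℂ) ^ 2) / 4) = ((∑' k : ℕ, ((harmonic k : ℚ) : ℝ) / ((k.factorial : ℝ) ^ 2)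
      * (-(x ^ 2) / 4) ^ k : ℝ) : ℂ) := by
    rw [fS, seriesSum, Complex.ofReal_tsum]
    refine tsum_congr fun k => ?_
    simp [coeffS]
  have h3 : Complex.log ((x : ℂ) / 2) = ((Real.log (x / 2) : ℝ) : ℂ) := by
    rw [Complex.ofReal_log (half_pos hx).le]; push_cast; rfl
  rw [hankel0, Complex.add_re, add_eq_left, besselY0_eq, h1, h2, h3, Complex.I_mul_re, neg_eq_zero]
  norm_cast

/-! ### Rotation of rays by Cauchy's theorem -/

/-- Cauchy's theorem on the rectangles `[-T, T] × [a, b]`. The decay `1/(1+u²)` removes the vertical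
sides in the limit. -/
lemma integral_strip_eq {g : ℂ → ℂ} {a b C : ℝ} (hab : a ≤ b)
    (hg : DifferentiableOn ℂ g {z | z.im ∈ Icc a b})
    (hC : ∀ u : ℝ, ∀ φ ∈ Icc a b, ‖g (u + φ * Complex.I)‖ ≤ C * (1 + u ^ 2)⁻¹) :
    ∫ u : ℝ, g (u + a * Complex.I) = ∫ u : ℝ, g (u + b * Complex.I) := by
  have hint : ∀ φ ∈ Icc a b, Integrable fun u : ℝ => g (u + φ * Complex.I) := by
    intro φ hφ
    refine (integrable_inv_one_add_sq.const_mul C).mono' ?_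
      (Eventually.of_forall fun u => hC u φ hφ)
    refine Continuous.aestronglyMeasurable ?_
    exact hg.continuousOn.comp_continuous (by fun_prop) fun u => by simpa using hφ
  have hC0 : 0 ≤ C := by
    have := (norm_nonneg _).trans (hC 0 a ⟨le_rfl, hab⟩)
    simpa using this
  have hinv : Tendsto (fun T : ℝ => (1 + T ^ 2)⁻¹) atTop (𝓝 0) := by
    refine tendsto_inv_atTop_zero.comp ?_
    exact tendsto_atTop_add_const_left _ _ (tendsto_pow_atTop two_ne_zero)
  have hside : ∀ σ : ℝ, σ ^ 2 = 1 → Tendsto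
      (fun T : ℝ => ∫ y in a..b, g ((σ * T : ℝ) + y * Complex.I)) atTop (𝓝 0) := by
    intro σ hσ
    have h0 : Tendsto (fun T : ℝ => C * (1 + T ^ 2)⁻¹ * |b - a|) atTop (𝓝 0) := by
      simpa using (hinv.const_mul C).mul_const |b - a|
    refine squeeze_zero_norm (fun T => ?_) h0
    refine intervalIntegral.norm_integral_le_of_norm_le_const fun y hy => ?_
    rw [uIoc_of_le hab] at hy
    have := hC (σ * T) y (Ioc_subset_Icc_self hy)
    rwa [mul_pow, hσ, one_mul] at this
  have hlim : ∀ φ ∈ Icc a b, Tendsto (fun T : ℝ => ∫ x in (-T)..T, g (x + φ * Complex.I)) atTop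
      (𝓝 (∫ u : ℝ, g (u + φ * Complex.I))) := fun φ hφ =>
    intervalIntegral_tendsto_integral (hint φ hφ) tendsto_neg_atTop_atBot tendsto_id
  have hrect : ∀ T : ℝ, (∫ x in (-T)..T, g (x + a * Complex.I)) - (∫ x in (-T)..T, g (x + b * Complex.I))
      + Complex.I * (∫ y in a..b, g ((1 * T : ℝ) + y * Complex.I))
      - Complex.I * (∫ y in a..b, g ((-1 * T : ℝ) + y * Complex.I)) = 0 := by
    intro T
    have h := Complex.integral_boundary_rect_eq_zero_of_differentiableOn g
      ((-T : ℝ) + a * Complex.I) ((T : ℝ) + b * Complex.I) ?_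
    · simpa using h
    · refine hg.mono fun z hz => ?_
      have := (Complex.mem_reProdIm.1 hz).2
      simpa [uIcc_of_le hab] using this
  have h := (((hlim a ⟨le_rfl, hab⟩).sub (hlim b ⟨hab, le_rfl⟩)).add
    ((hside 1 (by norm_num)).const_mul Complex.I)).sub ((hside (-1) (by norm_num)).const_mul Complex.I)
  simp only [hrect, mul_zero, add_zero, sub_zero] at h
  exact (sub_eq_zero.1 (tendsto_nhds_unique h tendsto_const_nhds))

lemma integral_Ioi_eq_integral_exp (f : ℝ → ℂ) :
    ∫ τ in Ioi (0 : ℝ), f τ = ∫ u : ℝ, (Real.exp u : ℂ) * f (Real.exp u) := by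
  have h := integral_image_eq_integral_abs_deriv_smul (s := univ) (f := Real.exp) (f' := Real.exp)
    MeasurableSet.univ (fun x _ => (Real.hasDerivAt_exp x).hasDerivWithinAt)
    Real.exp_injective.injOn f
  rw [image_univ, Real.range_exp, setIntegral_univ] at h
  rw [h]
  simp only [Real.abs_exp, Complex.real_smul]

/-- The logarithm `log τ + iφ` of `e^{iφ} τ`. -/
noncomputable def rayLog (φ τ : ℝ) : ℂ := Real.log τ + φ * Complex.I

lemma exp_rayLog (φ : ℝ) {τ : ℝ} (hτ : 0 < τ) :
    Complex.exp (rayLog φ τ) = Complex.exp (Complex.I * φ) * τ := by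
  rw [rayLog, Complex.exp_add, ← Complex.ofReal_exp, Real.exp_log hτ, mul_comm (φ : ℂ), mul_comm]

/-- In the variable `log z` rays are horizontal lines and a sector is a strip, so powers become
entire and no branch cut intervenes. -/
lemma integral_ray_eq {h : ℂ → ℂ} {a b C c : ℝ} (hab : a ≤ b) (hc : 0 < c)
    (hh : DifferentiableOn ℂ h {z | z.im ∈ Icc a b})
    (hC : ∀ τ : ℝ, 0 < τ → ∀ φ ∈ Icc a b,
      ‖h (rayLog φ τ)‖ ≤ C * (τ ^ (-(1 / 2) : ℝ) * Real.exp (-c * τ))) :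
    Complex.exp (Complex.I * a) * ∫ τ in Ioi (0 : ℝ), h (rayLog a τ)
      = Complex.exp (Complex.I * b) * ∫ τ in Ioi (0 : ℝ), h (rayLog b τ) := by
  have hC0 : 0 ≤ C := by
    have := (norm_nonneg _).trans (hC 1 one_pos a ⟨le_rfl, hab⟩)
    rw [Real.one_rpow, one_mul] at this
    exact nonneg_of_mul_nonneg_left this (Real.exp_pos _)
  have key := integral_strip_eq (g := fun z => Complex.exp z * h z) (C := C * (8 * (1 + 1 / c))) hab
    (Complex.differentiable_exp.differentiableOn.mul hh) ?_
  · have e : ∀ φ : ℝ, ∫ u : ℝ, Complex.exp (u + φ * Complex.I) * h (u + φ * Complex.I)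
        = Complex.exp (Complex.I * φ) * ∫ τ in Ioi (0 : ℝ), h (rayLog φ τ) := by
      intro φ
      rw [integral_Ioi_eq_integral_exp, ← integral_const_mul]
      refine integral_congr_ae (Eventually.of_forall fun u => ?_)
      simp only [rayLog, Real.log_exp, Complex.exp_add, Complex.ofReal_exp]
      rw [mul_comm (φ : ℂ)]; ring
    rw [← e, ← e]; exact key
  · intro u φ hφ
    have h1 := hC (Real.exp u) (Real.exp_pos u) φ hφ
    rw [rayLog, Real.log_exp] at h1
    have h2 : ‖Complex.exp (u + φ * Complex.I)‖ = Real.exp u := by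
      rw [Complex.norm_exp]; simp
    -- From `exp v ≥ 1 + v + v²/2` at `v = |u|/2`, where the last term is `u²/8`.
    have h4 : Real.exp (-|u| / 2) ≤ 8 * (1 + u ^ 2)⁻¹ := by
      have h5 := Real.quadratic_le_exp_of_nonneg (x := |u| / 2) (by positivity)
      rw [neg_div, Real.exp_neg, ← div_eq_mul_inv, inv_eq_one_div,
        div_le_div_iff₀ (Real.exp_pos _) (by positivity)]
      nlinarith [sq_abs u, abs_nonneg u]
    -- For `u ≤ 0` the Jacobian against `τ^(-1/2)` leaves `e^(u/2)`; for `u ≥ 0` the bound `exp(-cτ)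
    -- ≤ 1/(cτ)` turns this into `e^(-u/2)/c`.
    have h3 : Real.exp u * (Real.exp u ^ (-(1 / 2) : ℝ) * Real.exp (-c * Real.exp u))
        ≤ (1 + 1 / c) * Real.exp (-|u| / 2) := by
      rw [← Real.exp_mul, ← mul_assoc, ← Real.exp_add]
      have h6 : 0 < 1 / c := by positivity
      rcases le_total u 0 with hu | hu
      · rw [abs_of_nonpos hu]
        have h7 : Real.exp (-c * Real.exp u) ≤ 1 :=
          Real.exp_le_one_iff.2 (by have := Real.exp_pos u; nlinarith)
        calc _ ≤ Real.exp (u + u * -(1 / 2)) * 1 := by gcongr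
          _ = 1 * Real.exp (- -u / 2) := by rw [mul_one, one_mul]; ring_nf
          _ ≤ _ := by gcongr; linarith
      · rw [abs_of_nonneg hu]
        have h7 : Real.exp (-c * Real.exp u) ≤ c⁻¹ * Real.exp (-u) := by
          rw [neg_mul]; exact exp_neg_mul_exp_le hc u
        calc _ ≤ Real.exp (u + u * -(1 / 2)) * (c⁻¹ * Real.exp (-u)) := by gcongr
          _ = c⁻¹ * (Real.exp (u + u * -(1 / 2)) * Real.exp (-u)) := by ring
          _ = 1 / c * Real.exp (-u / 2) := by rw [← Real.exp_add, one_div]; ring_nf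
          _ ≤ _ := by gcongr; linarith
    rw [norm_mul, h2]
    calc Real.exp u * ‖h (u + φ * Complex.I)‖
        ≤ Real.exp u * (C * (Real.exp u ^ (-(1 / 2) : ℝ) * Real.exp (-c * Real.exp u))) := by gcongr
      _ = C * (Real.exp u * (Real.exp u ^ (-(1 / 2) : ℝ) * Real.exp (-c * Real.exp u))) := by ring
      _ ≤ C * ((1 + 1 / c) * (8 * (1 + u ^ 2)⁻¹)) := by
          have h6 : 0 < 1 / c := by positivity
          exact mul_le_mul_of_nonneg_left (h3.trans (by gcongr)) hC0
      _ = _ := by ring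

/-! ### Kernels in the logarithmic variable and their derivatives in the exponent -/

/-- The admissible parameters `(a, φ, τ)`: the exponent `a ∈ (0, N]`, the angle `φ ∈ [0, π]` with
`a φ ≤ B`, and the modulus `τ > 0`. -/
def paramDom (B : ℝ) (N : ℕ) : Set (ℝ × ℝ × ℝ) :=
  {x | 0 < x.1 ∧ x.1 ≤ N ∧ 0 ≤ x.2.1 ∧ x.2.1 ≤ Real.pi ∧ x.1 * x.2.1 ≤ B ∧ 0 < x.2.2}

/-- `f` is bounded by a power of the gauge on `D`. -/
def GaugeBdd (D : Set (ℝ × ℝ × ℝ)) (f : ℝ × ℝ × ℝ → ℂ) : Prop :=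
  ∃ C : ℝ, 0 ≤ C ∧ ∃ p : ℕ, ∀ x ∈ D, ‖f x‖ ≤ C * gauge x.2.2 ^ p

section GaugeBdd

variable {B : ℝ} {N : ℕ} {f g : ℝ × ℝ × ℝ → ℂ}

lemma GaugeBdd.const (c : ℂ) : GaugeBdd (paramDom B N) fun _ => c :=
  ⟨‖c‖, norm_nonneg _, 0, fun x _ => by simp⟩

lemma GaugeBdd.mul (hf : GaugeBdd (paramDom B N) f) (hg : GaugeBdd (paramDom B N) g) :
    GaugeBdd (paramDom B N) fun x => f x * g x := by
  obtain ⟨C, hC, p, h⟩ := hf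
  obtain ⟨C', hC', q, h'⟩ := hg
  refine ⟨C * C', by positivity, p + q, fun x hx => ?_⟩
  have h1 := one_le_gauge hx.2.2.2.2.2
  rw [norm_mul, pow_add]
  calc _ ≤ (C * gauge x.2.2 ^ p) * (C' * gauge x.2.2 ^ q) := by gcongr; exacts [h x hx, h' x hx]
    _ = _ := by ring

lemma GaugeBdd.add (hf : GaugeBdd (paramDom B N) f) (hg : GaugeBdd (paramDom B N) g) :
    GaugeBdd (paramDom B N) fun x => f x + g x := by
  obtain ⟨C, hC, p, h⟩ := hf
  obtain ⟨C', hC', q, h'⟩ := hg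
  refine ⟨C + C', by positivity, p + q, fun x hx => ?_⟩
  have h1 := one_le_gauge hx.2.2.2.2.2
  have h2 : gauge x.2.2 ^ p ≤ gauge x.2.2 ^ (p + q) := pow_le_pow_right₀ h1 (by omega)
  have h3 : gauge x.2.2 ^ q ≤ gauge x.2.2 ^ (p + q) := pow_le_pow_right₀ h1 (by omega)
  calc _ ≤ ‖f x‖ + ‖g x‖ := norm_add_le _ _
    _ ≤ C * gauge x.2.2 ^ p + C' * gauge x.2.2 ^ q := add_le_add (h x hx) (h' x hx)
    _ ≤ C * gauge x.2.2 ^ (p + q) + C' * gauge x.2.2 ^ (p + q) := by gcongr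
    _ = _ := by ring

lemma GaugeBdd.pow (hf : GaugeBdd (paramDom B N) f) (k : ℕ) :
    GaugeBdd (paramDom B N) fun x => f x ^ k := by
  induction k with
  | zero => simpa using GaugeBdd.const 1
  | succ k ih => simpa [pow_succ] using ih.mul hf

lemma GaugeBdd.polynomial (hf : GaugeBdd (paramDom B N) f) (P : Polynomial ℂ) :
    GaugeBdd (paramDom B N) fun x => P.eval (f x) := by
  induction P using Polynomial.induction_on' with
  | add P Q hP hQ => simpa using hP.add hQ
  | monomial k c => simpa using (GaugeBdd.const c).mul (hf.pow k)

end GaugeBdd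

lemma gaugeBdd_rayLog (B : ℝ) (N : ℕ) :
    GaugeBdd (paramDom B N) fun x => rayLog x.2.1 x.2.2 := by
  refine ⟨4, by norm_num, 1, fun x hx => ?_⟩
  obtain ⟨-, -, h1, h2, -, h3⟩ := hx
  have h4 := one_add_abs_log_le_gauge h3
  have h5 := one_le_gauge h3
  calc ‖rayLog x.2.1 x.2.2‖ ≤ |Real.log x.2.2| + |x.2.1| := by
        refine (norm_add_le _ _).trans ?_
        rw [norm_mul, Complex.norm_I, Complex.norm_real, Complex.norm_real, mul_one]; rfl
    _ ≤ 4 * gauge x.2.2 ^ 1 := by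
        rw [abs_of_nonneg h1, pow_one]
        have := Real.pi_le_four
        have := abs_nonneg (Real.log x.2.2)
        linarith

/-- `-(e^λ)^a`. -/
noncomputable def negPow (a : ℝ) (z : ℂ) : ℂ := -Complex.exp (a * z)

lemma norm_negPow_rayLog (a φ : ℝ) {τ : ℝ} (hτ : 0 < τ) :
    ‖negPow a (rayLog φ τ)‖ = τ ^ a := by
  rw [negPow, norm_neg, Complex.norm_exp, Real.rpow_def_of_pos hτ]
  simp [rayLog, mul_comm]

lemma re_negPow_rayLog (a φ : ℝ) {τ : ℝ} (hτ : 0 < τ) :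
    (negPow a (rayLog φ τ)).re = -(τ ^ a * Real.cos (a * φ)) := by
  rw [negPow, Complex.neg_re, Complex.exp_re, Real.rpow_def_of_pos hτ]
  simp [rayLog, mul_comm]

lemma re_negPow_rayLog_nonpos {a φ τ : ℝ} (ha : 0 ≤ a) (hφ : 0 ≤ φ) (h : a * φ ≤ Real.pi / 2)
    (hτ : 0 < τ) : (negPow a (rayLog φ τ)).re ≤ 0 := by
  rw [re_negPow_rayLog a φ hτ, neg_nonpos]
  have h1 : 0 ≤ a * φ := by positivity
  have := Real.cos_nonneg_of_mem_Icc ⟨by linarith [Real.pi_pos], h⟩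
  positivity

lemma gaugeBdd_negPow (B : ℝ) (N : ℕ) :
    GaugeBdd (paramDom B N) fun x => negPow x.1 (rayLog x.2.1 x.2.2) := by
  refine ⟨1, zero_le_one, N, fun x hx => ?_⟩
  obtain ⟨h1, h2, -, -, -, h3⟩ := hx
  rw [norm_negPow_rayLog _ _ h3, one_mul, ← Real.rpow_natCast]
  have h4 := one_add_le_gauge h3
  have h5 := one_le_gauge h3
  calc x.2.2 ^ x.1 ≤ gauge x.2.2 ^ x.1 := Real.rpow_le_rpow h3.le (by linarith) h1.le
    _ ≤ _ := Real.rpow_le_rpow_of_exponent_le h5 h2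

/-- A family `V j a λ`, `j` counting the derivatives with respect to `a`, that is holomorphic in
`λ` and bounded by powers of the gauge. -/
structure IsKernelFamily (B : ℝ) (V : ℕ → ℝ → ℂ → ℂ) : Prop where
  hasDerivAt : ∀ (j : ℕ) (a : ℝ) (z : ℂ), HasDerivAt (fun a => V j a z) (V (j + 1) a z) a
  differentiable : ∀ (j : ℕ) (a : ℝ), Differentiable ℂ (V j a)
  bdd : ∀ (j N : ℕ), GaugeBdd (paramDom B N) fun x => V j x.1 (rayLog x.2.1 x.2.2)

lemma IsKernelFamily.sub {B : ℝ} {V W : ℕ → ℝ → ℂ → ℂ} (hV : IsKernelFamily B V)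
    (hW : IsKernelFamily B W) : IsKernelFamily B fun j a z => V j a z - W j a z where
  hasDerivAt j a z := (hV.hasDerivAt j a z).sub (hW.hasDerivAt j a z)
  differentiable j a := (hV.differentiable j a).sub (hW.differentiable j a)
  bdd j N := by
    have := (hV.bdd j N).add ((GaugeBdd.const (-1)).mul (hW.bdd j N))
    simpa [sub_eq_add_neg] using this

lemma IsKernelFamily.sum {B : ℝ} {ι : Type*} {V : ι → ℕ → ℝ → ℂ → ℂ} (s : Finset ι)
    (hV : ∀ i ∈ s, IsKernelFamily B (V i)) :
    IsKernelFamily B fun j a z => ∑ i ∈ s, V i j a z where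
  hasDerivAt j a z := HasDerivAt.fun_sum fun i hi => (hV i hi).hasDerivAt j a z
  differentiable j a := Differentiable.fun_sum fun i hi => (hV i hi).differentiable j a
  bdd j N := by
    classical
    induction s using Finset.induction_on with
    | empty => simpa using GaugeBdd.const 0
    | insert i s hi ih =>
      simp only [Finset.sum_insert hi]
      exact ((hV i (Finset.mem_insert_self i s)).bdd j N).add
        (ih fun k hk => hV k (Finset.mem_insert_of_mem hk))

/-- The Touchard polynomials. -/
noncomputable def touchard : ℕ → Polynomial ℂ
  | 0 => 1
  | j + 1 => Polynomial.X * (touchard j + Polynomial.derivative (touchard j))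

/-- The derivatives of `exp(-(e^λ)^a)` with respect to `a`. -/
noncomputable def expKernel (j : ℕ) (a : ℝ) (z : ℂ) : ℂ :=
  z ^ j * (touchard j).eval (negPow a z) * Complex.exp (negPow a z)

/-- The derivatives of `(-(e^λ)^a)^k / k!` with respect to `a`. -/
noncomputable def powKernel (k j : ℕ) (a : ℝ) (z : ℂ) : ℂ :=
  (k * z) ^ j * negPow a z ^ k / (k.factorial : ℂ)

lemma hasDerivAt_negPow (a : ℝ) (z : ℂ) :
    HasDerivAt (fun a : ℝ => negPow a z) (z * negPow a z) a := by
  have h1 : HasDerivAt (fun a : ℝ => (a : ℂ) * z) z a := by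
    simpa using ((hasDerivAt_id a).ofReal_comp).mul_const z
  refine h1.cexp.neg.congr_deriv ?_
  rw [negPow]; ring

lemma differentiable_negPow (a : ℝ) : Differentiable ℂ (negPow a) := by
  unfold negPow; fun_prop

lemma isKernelFamily_powKernel (B : ℝ) (k : ℕ) : IsKernelFamily B (powKernel k) where
  hasDerivAt j a z := by
    have h := (((hasDerivAt_negPow a z).fun_pow k).const_mul ((k * z) ^ j)).div_const (k.factorial : ℂ)
    refine h.congr_deriv ?_
    rcases k with _ | k
    · simp [powKernel]
    · simp only [powKernel, Nat.add_sub_cancel]; ring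
  differentiable j a := by
    have := differentiable_negPow a
    unfold powKernel; fun_prop
  bdd j N := by
    have h := ((((GaugeBdd.const (k : ℂ)).mul (gaugeBdd_rayLog B N)).pow j).mul
      ((gaugeBdd_negPow B N).pow k)).mul (GaugeBdd.const ((k.factorial : ℂ)⁻¹))
    simpa [powKernel, div_eq_mul_inv] using h

/-- With `w = -(e^z)^a` one has `∂w/∂a = z w`, so differentiating `z^j T(w) e^w` replaces `T` by `w
(T + T')`, the Touchard recursion. The condition `aφ ≤ π/2` keeps `Re w ≤ 0`, whence `|e^w| ≤ 1`. -/
lemma isKernelFamily_expKernel {B : ℝ} (hB : B ≤ Real.pi / 2) : IsKernelFamily B expKernel where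
  hasDerivAt j a z := by
    have h1 := hasDerivAt_negPow a z
    have h2 : HasDerivAt (fun a : ℝ => (touchard j).eval (negPow a z))
        ((Polynomial.derivative (touchard j)).eval (negPow a z) * (z * negPow a z)) a :=
      HasDerivAt.comp (h₂ := fun w => (touchard j).eval w) a ((touchard j).hasDerivAt _) h1
    refine ((h2.const_mul (z ^ j)).mul h1.cexp).congr_deriv ?_
    simp only [expKernel, touchard, Polynomial.eval_mul, Polynomial.eval_add, Polynomial.eval_X]
    ring
  differentiable j a := by
    have h1 := differentiable_negPow a
    have h2 : Differentiable ℂ fun z => (touchard j).eval (negPow a z) :=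
      (touchard j).differentiable.comp h1
    unfold expKernel; fun_prop
  bdd j N := by
    refine (((gaugeBdd_rayLog B N).pow j).mul
      ((gaugeBdd_negPow B N).polynomial (touchard j))).mul ?_
    refine ⟨1, zero_le_one, 0, fun x hx => ?_⟩
    obtain ⟨h1, -, h2, -, h3, h4⟩ := hx
    rw [Complex.norm_exp, pow_zero, mul_one]
    exact Real.exp_le_one_iff.2 (re_negPow_rayLog_nonpos h1.le h2 (h3.trans hB) h4)

/-- The derivatives of the Taylor remainder of `exp` at `-(e^λ)^a` with respect to `a`. -/
noncomputable def remKernel (n j : ℕ) (a : ℝ) (z : ℂ) : ℂ :=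
  expKernel j a z - ∑ k ∈ Finset.range (n + 1), powKernel k j a z

lemma isKernelFamily_remKernel {B : ℝ} (hB : B ≤ Real.pi / 2) (n : ℕ) :
    IsKernelFamily B (remKernel n) :=
  (isKernelFamily_expKernel hB).sub
    (IsKernelFamily.sum _ fun k _ => isKernelFamily_powKernel B k)

lemma continuous_remKernel (n j : ℕ) (a τ : ℝ) :
    Continuous fun φ : ℝ => remKernel n j a (rayLog φ τ) := by
  have h := ((isKernelFamily_remKernel le_rfl n).differentiable j a).continuous
  have h2 : Continuous fun φ : ℝ => rayLog φ τ := by unfold rayLog; fun_prop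
  exact h.comp h2

/-- The phase `π` in `β₁` is the minus sign of `w = -(e^(iφ)τ)^a`. The kernel is therefore `w^(n+1)
M_{n+1}(w)`, the Taylor remainder of `exp`; as `w ≠ 0`, the value of `M_{n+1}` at `0` plays no role.
-/
lemma remainderKernel_eq (n : ℕ) (φ a : ℝ) {τ : ℝ} (hτ : 0 < τ) :
    remainderKernel n φ τ a = remKernel n 0 a (rayLog φ τ) := by
  have hw : Complex.exp (Complex.I * (Real.pi + a * φ)) * ((τ ^ a : ℝ) : ℂ)
      = negPow a (rayLog φ τ) := by
    rw [negPow, rayLog, mul_add, mul_add, Complex.exp_add, Complex.exp_add,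
      mul_comm Complex.I (Real.pi : ℂ), Complex.exp_pi_mul_I, Real.rpow_def_of_pos hτ]
    push_cast
    rw [mul_comm (Real.log τ : ℂ), mul_comm Complex.I, mul_assoc (a : ℂ)]; ring
  have hw0 : negPow a (rayLog φ τ) ≠ 0 := by rw [negPow]; exact neg_ne_zero.2 (Complex.exp_ne_zero _)
  have hpow : Complex.exp (Complex.I * ((n + 1) * (Real.pi + a * φ)))
      * ((τ ^ ((n + 1) * a) : ℝ) : ℂ) = negPow a (rayLog φ τ) ^ (n + 1) := by
    rw [← hw, mul_pow, ← Complex.exp_nat_mul, ← Complex.ofReal_pow, ← Real.rpow_natCast,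
      ← Real.rpow_mul hτ.le, mul_comm a]
    push_cast
    ring_nf
  rw [remainderKernel, hpow, hw, expRemainder, if_neg hw0,
    mul_div_cancel₀ _ (pow_ne_zero _ hw0), remKernel]
  simp [expKernel, powKernel, touchard]

lemma iteratedDeriv_remainderKernel (n j : ℕ) (φ a : ℝ) {τ : ℝ} (hτ : 0 < τ) :
    iteratedDeriv j (fun a : ℝ => remainderKernel n φ τ a) a = remKernel n j a (rayLog φ τ) := by
  have h : ∀ j : ℕ, iteratedDeriv j (fun a : ℝ => remainderKernel n φ τ a)
      = fun a => remKernel n j a (rayLog φ τ) := by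
    intro j
    induction j with
    | zero => rw [iteratedDeriv_zero]; funext a; exact remainderKernel_eq n φ a hτ
    | succ j ih =>
      rw [iteratedDeriv_succ, ih]
      funext a
      exact ((isKernelFamily_remKernel le_rfl n).hasDerivAt j a _).deriv
  rw [h j]

/-! ### Ray integrals: differentiation, smoothness, independence of the angle -/

/-- The factor of the integrand that depends on `r`. -/
noncomputable def rayKernel (φ : ℝ) (l : ℕ) (r τ : ℝ) : ℂ :=
  Complex.exp (Complex.I * φ) ^ (l + 2) * hankelInt l (Complex.exp (Complex.I * φ) * r * τ)
    * (τ : ℂ) ^ (l + 1)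

lemma im_ray (φ r τ : ℝ) : (Complex.exp (Complex.I * φ) * r * τ).im = r * τ * Real.sin φ := by
  rw [mul_comm Complex.I, mul_assoc, ← Complex.ofReal_mul, Complex.im_mul_ofReal,
    Complex.exp_ofReal_mul_I_im, mul_comm]

lemma norm_exp_I_mul (φ : ℝ) : ‖Complex.exp (Complex.I * φ)‖ = 1 := by
  rw [mul_comm, Complex.norm_exp_ofReal_mul_I]

lemma norm_hankelInt_ray_le (l : ℕ) {c r φ τ : ℝ} (hc : 0 < c) (hr : c ≤ r * Real.sin φ)
    (hτ : 0 < τ) : ‖hankelInt l (Complex.exp (Complex.I * φ) * r * τ)‖ * τ ^ (l + 1)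
      ≤ hankelConst l * (c ^ (l + 1))⁻¹ * Real.exp (-(c / 2) * τ) := by
  have h := norm_hankelInt_le l (y := c * τ) (by positivity)
    (z := Complex.exp (Complex.I * φ) * r * τ) (by rw [im_ray]; nlinarith)
  calc _ ≤ (hankelConst l * ((c * τ) ^ (l + 1))⁻¹ * Real.exp (-(c * τ) / 2)) * τ ^ (l + 1) := by
        gcongr
    _ = _ := by
        rw [mul_pow]
        have e : -(c * τ) / 2 = -(c / 2) * τ := by ring
        rw [e]
        field_simp

lemma norm_rayKernel_eq (φ : ℝ) (l : ℕ) (r : ℝ) {τ : ℝ} (hτ : 0 < τ) : ‖rayKernel φ l r τ‖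
    = ‖hankelInt l (Complex.exp (Complex.I * φ) * r * τ)‖ * τ ^ (l + 1) := by
  rw [rayKernel, norm_mul, norm_mul, norm_pow, norm_pow, norm_exp_I_mul, one_pow, one_mul,
    Complex.norm_real, Real.norm_of_nonneg hτ.le]

/-- The substitution `t = e^(iφ)τ` in `t dt` gives `e^(2iφ) τ dτ`, and each derivative in `r` adds a
factor `e^(iφ)τ`; hence the exponents `l + 2` and `l + 1`. -/
lemma hasDerivAt_rayKernel (φ : ℝ) (l : ℕ) {r τ : ℝ} (hr : 0 < r * τ * Real.sin φ) :
    HasDerivAt (fun r => rayKernel φ l r τ) (rayKernel φ (l + 1) r τ) r := by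
  have h1 : HasDerivAt (fun r : ℝ => Complex.exp (Complex.I * φ) * r * τ)
      (Complex.exp (Complex.I * φ) * τ) r := by
    simpa using (((hasDerivAt_id r).ofReal_comp).const_mul (Complex.exp (Complex.I * φ))).mul_const
      (τ : ℂ)
  have h2 : HasDerivAt (fun r : ℝ => hankelInt l (Complex.exp (Complex.I * φ) * r * τ)) _ r :=
    HasDerivAt.comp (h₂ := hankelInt l) r (hasDerivAt_hankelInt l (by rw [im_ray]; exact hr)) h1
  refine ((h2.const_mul (Complex.exp (Complex.I * φ) ^ (l + 2))).mul_const
    ((τ : ℂ) ^ (l + 1))).congr_deriv ?_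
  rw [rayKernel]; ring

lemma continuousOn_hankelInt (l : ℕ) : ContinuousOn (hankelInt l) upperHalf :=
  fun _ hz => (hasDerivAt_hankelInt l hz).continuousAt.continuousWithinAt

lemma continuousOn_rayKernel (l : ℕ) {φ r : ℝ} (hr : 0 < r) (hφ : 0 < Real.sin φ) :
    ContinuousOn (rayKernel φ l r) (Ioi 0) := by
  have h : ContinuousOn (fun τ : ℝ => hankelInt l (Complex.exp (Complex.I * φ) * r * τ)) (Ioi 0) := by
    refine (continuousOn_hankelInt l).comp (by fun_prop) fun τ hτ => ?_
    have : 0 < τ := hτ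
    change 0 < Complex.im _
    rw [im_ray]; positivity
  unfold rayKernel; fun_prop

lemma continuousOn_rayLog (φ : ℝ) : ContinuousOn (rayLog φ) (Ioi 0) := by
  have : ContinuousOn (fun τ : ℝ => (Real.log τ : ℂ)) (Ioi 0) :=
    Complex.continuous_ofReal.comp_continuousOn
      (Real.continuousOn_log.mono fun x hx => ne_of_gt hx)
  unfold rayLog; fun_prop

/-- The integrand along the ray of angle `φ`. -/
noncomputable def rayIntegrand (V : ℕ → ℝ → ℂ → ℂ) (φ : ℝ) (l j : ℕ) (r a τ : ℝ) : ℂ :=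
  rayKernel φ l r τ * V j a (rayLog φ τ)

/-- The integral along the ray of angle `φ`. -/
noncomputable def rayIntegral (V : ℕ → ℝ → ℂ → ℂ) (φ : ℝ) (l j : ℕ) (r a : ℝ) : ℂ :=
  ∫ τ in Ioi (0 : ℝ), rayIntegrand V φ l j r a τ

section Family

variable {B : ℝ} {V : ℕ → ℝ → ℂ → ℂ}

lemma IsKernelFamily.continuousOn_rayIntegrand (hV : IsKernelFamily B V) (l j : ℕ) {φ r : ℝ}
    (hr : 0 < r) (hφ : 0 < Real.sin φ) (a : ℝ) :
    ContinuousOn (rayIntegrand V φ l j r a) (Ioi 0) :=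
  (continuousOn_rayKernel l hr hφ).mul
    ((hV.differentiable j a).continuous.comp_continuousOn (continuousOn_rayLog φ))

/-- The majorant depends on the parameters only through the lower bound `c` for `r sin φ` and the
upper bound `N` for `a`. The same estimate thus serves differentiation, rotation and limits in the
angle. -/
lemma IsKernelFamily.norm_rayIntegrand_le (hV : IsKernelFamily B V) (l j N : ℕ) {c : ℝ}
    (hc : 0 < c) : ∃ C : ℝ, 0 ≤ C ∧ ∃ p : ℕ, ∀ φ r a τ : ℝ, c ≤ r * Real.sin φ → 0 < a → a ≤ N →
      0 ≤ φ → φ ≤ Real.pi → a * φ ≤ B → 0 < τ →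
      ‖rayIntegrand V φ l j r a τ‖ ≤ C * (gauge τ ^ p * Real.exp (-(c / 2) * τ)) := by
  obtain ⟨C, hC, p, h⟩ := hV.bdd j N
  have := hankelConst_pos l
  refine ⟨hankelConst l * (c ^ (l + 1))⁻¹ * C, by positivity, p,
    fun φ r a τ hr h1 h2 h3 h4 h5 hτ => ?_⟩
  rw [rayIntegrand, norm_mul, norm_rayKernel_eq φ l r hτ]
  have hg := one_le_gauge hτ
  calc _ ≤ (hankelConst l * (c ^ (l + 1))⁻¹ * Real.exp (-(c / 2) * τ)) * (C * gauge τ ^ p) := by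
        refine mul_le_mul (norm_hankelInt_ray_le l hc hr hτ)
          (h (a, φ, τ) ⟨h1, h2, h3, h4, h5, hτ⟩) (norm_nonneg _) (by positivity)
    _ = _ := by ring

lemma IsKernelFamily.integrableOn_rayIntegrand (hV : IsKernelFamily B V) (l j : ℕ) {φ r a : ℝ}
    (hr : 0 < r) (ha : 0 < a) (hφ0 : 0 < φ) (hφ1 : φ < Real.pi) (hB : a * φ ≤ B) :
    IntegrableOn (rayIntegrand V φ l j r a) (Ioi 0) := by
  have hs := Real.sin_pos_of_pos_of_lt_pi hφ0 hφ1
  obtain ⟨N, hN⟩ := exists_nat_ge a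
  have hc : 0 < r * Real.sin φ := by positivity
  obtain ⟨C, hC, p, h⟩ := hV.norm_rayIntegrand_le l j N hc
  refine ((integrableOn_gauge_pow_mul_exp p (half_pos hc)).const_mul C).mono'
    ((hV.continuousOn_rayIntegrand l j hr hs a).aestronglyMeasurable measurableSet_Ioi) ?_
  filter_upwards [ae_restrict_mem measurableSet_Ioi] with τ hτ
  exact h φ r a τ le_rfl ha hN hφ0.le hφ1.le hB hτ

lemma IsKernelFamily.hasFDerivAt_rayIntegral (hV : IsKernelFamily B V) (l j : ℕ) {φ r a : ℝ}
    (hr : 0 < r) (ha : 0 < a) (hφ0 : 0 < φ) (hφ1 : φ < Real.pi) (hB : a * φ < B) :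
    HasFDerivAt (fun p : ℝ × ℝ => rayIntegral V φ l j p.1 p.2)
      ((ContinuousLinearMap.fst ℝ ℝ ℝ).smulRight (rayIntegral V φ (l + 1) j r a)
        + (ContinuousLinearMap.snd ℝ ℝ ℝ).smulRight (rayIntegral V φ l (j + 1) r a)) (r, a) := by
  have hs := Real.sin_pos_of_pos_of_lt_pi hφ0 hφ1
  obtain ⟨N, hN⟩ := exists_nat_ge (a + 1)
  have hc : 0 < r / 2 * Real.sin φ := by positivity
  obtain ⟨C₁, hC₁, p₁, h₁⟩ := hV.norm_rayIntegrand_le (l + 1) j N hc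
  obtain ⟨C₂, hC₂, p₂, h₂⟩ := hV.norm_rayIntegrand_le l (j + 1) N hc
  -- The bound `r/2` keeps `r sin φ` away from `0`. The strict inequality on `aφ` makes `U` a
  -- neighbourhood on which the kernel bounds persist.
  set U : Set (ℝ × ℝ) := {q | r / 2 < q.1 ∧ 0 < q.2 ∧ q.2 < a + 1 ∧ q.2 * φ < B} with hU
  have hUo : IsOpen U := by
    refine (isOpen_lt continuous_const continuous_fst).inter
      ((isOpen_lt continuous_const continuous_snd).inter
      ((isOpen_lt continuous_snd continuous_const).inter
      (isOpen_lt (continuous_snd.mul continuous_const) continuous_const)))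
  have hUm : (r, a) ∈ U := ⟨by simp only; linarith, ha, by simp only; linarith, hB⟩
  set F' : ℝ × ℝ → ℝ → (ℝ × ℝ) →L[ℝ] ℂ := fun q τ =>
    (ContinuousLinearMap.fst ℝ ℝ ℝ).smulRight (rayIntegrand V φ (l + 1) j q.1 q.2 τ)
      + (ContinuousLinearMap.snd ℝ ℝ ℝ).smulRight (rayIntegrand V φ l (j + 1) q.1 q.2 τ) with hF'
  have i₁ := hV.integrableOn_rayIntegrand (l + 1) j hr ha hφ0 hφ1 hB.le
  have i₂ := hV.integrableOn_rayIntegrand l (j + 1) hr ha hφ0 hφ1 hB.le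
  have e₁ : ∀ (L : (ℝ × ℝ) →L[ℝ] ℝ) (f : ℝ → ℂ), IntegrableOn f (Ioi 0) →
      IntegrableOn (fun τ => L.smulRight (f τ)) (Ioi 0) ∧
      ∫ τ in Ioi (0 : ℝ), L.smulRight (f τ) = L.smulRight (∫ τ in Ioi (0 : ℝ), f τ) := by
    intro L f hf
    exact ⟨(ContinuousLinearMap.smulRightL ℝ (ℝ × ℝ) ℂ L).integrable_comp hf,
      (ContinuousLinearMap.smulRightL ℝ (ℝ × ℝ) ℂ L).integral_comp_comm hf⟩
  have hmeas : ∀ q ∈ U, AEStronglyMeasurable (fun τ => rayIntegrand V φ l j q.1 q.2 τ)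
      (volume.restrict (Ioi (0 : ℝ))) := fun q hq =>
    (hV.continuousOn_rayIntegrand l j (by have := hq.1; linarith) hs q.2).aestronglyMeasurable
      measurableSet_Ioi
  have hFm : AEStronglyMeasurable (F' (r, a)) (volume.restrict (Ioi (0 : ℝ))) :=
    ((e₁ (ContinuousLinearMap.fst ℝ ℝ ℝ) _ i₁).1.aestronglyMeasurable).add
      (e₁ (ContinuousLinearMap.snd ℝ ℝ ℝ) _ i₂).1.aestronglyMeasurable
  have key := hasFDerivAt_integral_of_dominated_of_fderiv_le (𝕜 := ℝ)
    (μ := volume.restrict (Ioi (0 : ℝ)))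
    (F := fun q τ => rayIntegrand V φ l j q.1 q.2 τ) (F' := F') (x₀ := (r, a)) (s := U)
    (bound := fun τ => C₁ * (gauge τ ^ p₁ * Real.exp (-(r / 2 * Real.sin φ / 2) * τ))
      + C₂ * (gauge τ ^ p₂ * Real.exp (-(r / 2 * Real.sin φ / 2) * τ)))
    (hUo.mem_nhds hUm)
    (by filter_upwards [hUo.mem_nhds hUm] with q hq using hmeas q hq)
    (hV.integrableOn_rayIntegrand l j hr ha hφ0 hφ1 hB.le)
    hFm
    ?_ ?_ ?_
  · refine key.congr_fderiv ?_
    have := integral_add (e₁ (ContinuousLinearMap.fst ℝ ℝ ℝ) _ i₁).1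
      (e₁ (ContinuousLinearMap.snd ℝ ℝ ℝ) _ i₂).1
    rw [(e₁ _ _ i₁).2, (e₁ _ _ i₂).2] at this
    exact this
  · filter_upwards [ae_restrict_mem measurableSet_Ioi] with τ hτ q hq
    have hq' : r / 2 * Real.sin φ ≤ q.1 * Real.sin φ :=
      mul_le_mul_of_nonneg_right hq.1.le hs.le
    have hqN : q.2 ≤ N := hq.2.2.1.le.trans hN
    refine (norm_add_le _ _).trans (add_le_add ?_ ?_)
    · rw [ContinuousLinearMap.norm_smulRight_apply]
      calc _ ≤ 1 * ‖rayIntegrand V φ (l + 1) j q.1 q.2 τ‖ := by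
            gcongr; exact ContinuousLinearMap.norm_fst_le ℝ ℝ ℝ
        _ ≤ _ := by
            rw [one_mul]
            exact h₁ φ q.1 q.2 τ hq' hq.2.1 hqN hφ0.le hφ1.le hq.2.2.2.le hτ
    · rw [ContinuousLinearMap.norm_smulRight_apply]
      calc _ ≤ 1 * ‖rayIntegrand V φ l (j + 1) q.1 q.2 τ‖ := by
            gcongr; exact ContinuousLinearMap.norm_snd_le ℝ ℝ ℝ
        _ ≤ _ := by
            rw [one_mul]
            exact h₂ φ q.1 q.2 τ hq' hq.2.1 hqN hφ0.le hφ1.le hq.2.2.2.le hτ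
  · exact ((integrableOn_gauge_pow_mul_exp p₁ (half_pos hc)).const_mul C₁).add
      ((integrableOn_gauge_pow_mul_exp p₂ (half_pos hc)).const_mul C₂)
  · filter_upwards [ae_restrict_mem measurableSet_Ioi] with τ hτ q hq
    have hτ' : 0 < τ := hτ
    have hq1 : 0 < q.1 := by have := hq.1; linarith
    have d1 := (hasDerivAt_rayKernel φ l (r := q.1) (τ := τ) (by positivity)).hasFDerivAt.comp q
      (hasFDerivAt_fst (𝕜 := ℝ) (E := ℝ) (F := ℝ) (p := q))
    have d2 := (hV.hasDerivAt j q.2 (rayLog φ τ)).hasFDerivAt.comp q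
      (hasFDerivAt_snd (𝕜 := ℝ) (E := ℝ) (F := ℝ) (p := q))
    refine (d1.mul d2).congr_fderiv ?_
    ext <;> simp [hF', rayIntegrand, mul_comm]

end Family

/-- The open set of parameters `(r, a)` on which the ray integral is smooth. -/
def rayDom (B φ : ℝ) : Set (ℝ × ℝ) := {q | 0 < q.1 ∧ 0 < q.2 ∧ q.2 * φ < B}

lemma isOpen_rayDom (B φ : ℝ) : IsOpen (rayDom B φ) :=
  (isOpen_lt continuous_const continuous_fst).inter
    ((isOpen_lt continuous_const continuous_snd).inter (isOpen_lt (continuous_snd.mul continuous_const) continuous_const))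

/-- Both partial derivatives are again ray integrals, with `l` or `j` raised by one, so induction on
the order closes. -/
lemma IsKernelFamily.contDiffOn_rayIntegral {B φ : ℝ} {V : ℕ → ℝ → ℂ → ℂ}
    (hV : IsKernelFamily B V) (hφ0 : 0 < φ) (hφ1 : φ < Real.pi) (n l j : ℕ) :
    ContDiffOn ℝ n (fun p : ℝ × ℝ => rayIntegral V φ l j p.1 p.2) (rayDom B φ) := by
  induction n generalizing l j with
  | zero =>
    rw [Nat.cast_zero, contDiffOn_zero]
    exact fun q hq => (hV.hasFDerivAt_rayIntegral l j hq.1 hq.2.1 hφ0 hφ1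
      hq.2.2).continuousAt.continuousWithinAt
  | succ n ih =>
    push_cast
    rw [contDiffOn_succ_iff_fderiv_of_isOpen (isOpen_rayDom B φ)]
    have hd : ∀ q ∈ rayDom B φ, _ := fun q hq =>
      hV.hasFDerivAt_rayIntegral l j hq.1 hq.2.1 hφ0 hφ1 hq.2.2
    refine ⟨fun q hq => (hd q hq).differentiableAt.differentiableWithinAt, by simp, ?_⟩
    have h1 : ContDiffOn ℝ n (fun q : ℝ × ℝ =>
        (ContinuousLinearMap.fst ℝ ℝ ℝ).smulRight (rayIntegral V φ (l + 1) j q.1 q.2)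
        + (ContinuousLinearMap.snd ℝ ℝ ℝ).smulRight (rayIntegral V φ l (j + 1) q.1 q.2))
        (rayDom B φ) :=
      ((ContinuousLinearMap.smulRightL ℝ (ℝ × ℝ) ℂ
        (ContinuousLinearMap.fst ℝ ℝ ℝ)).contDiff.comp_contDiffOn (ih (l + 1) j)).add
      ((ContinuousLinearMap.smulRightL ℝ (ℝ × ℝ) ℂ
        (ContinuousLinearMap.snd ℝ ℝ ℝ)).contDiff.comp_contDiffOn (ih l (j + 1)))
    exact h1.congr fun q hq => (hd q hq).fderiv

lemma IsKernelFamily.hasDerivAt_rayIntegral_left {B φ : ℝ} {V : ℕ → ℝ → ℂ → ℂ}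
    (hV : IsKernelFamily B V) (hφ0 : 0 < φ) (hφ1 : φ < Real.pi) (l j : ℕ) {r a : ℝ}
    (h : (r, a) ∈ rayDom B φ) :
    HasDerivAt (fun r => (rayIntegral V φ l j r a).re) (rayIntegral V φ (l + 1) j r a).re r := by
  have h1 := hV.hasFDerivAt_rayIntegral l j h.1 h.2.1 hφ0 hφ1 h.2.2
  have h2 : HasDerivAt (fun r : ℝ => (r, a)) (1, 0) r := (hasDerivAt_id r).prodMk (hasDerivAt_const r a)
  have h3 := h1.comp_hasDerivAt r h2
  have h4 := Complex.reCLM.hasFDerivAt.comp_hasDerivAt r h3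
  simpa [Function.comp_def] using h4

lemma IsKernelFamily.hasDerivAt_rayIntegral_right {B φ : ℝ} {V : ℕ → ℝ → ℂ → ℂ}
    (hV : IsKernelFamily B V) (hφ0 : 0 < φ) (hφ1 : φ < Real.pi) (l j : ℕ) {r a : ℝ}
    (h : (r, a) ∈ rayDom B φ) :
    HasDerivAt (fun a => (rayIntegral V φ l j r a).re) (rayIntegral V φ l (j + 1) r a).re a := by
  have h1 := hV.hasFDerivAt_rayIntegral l j h.1 h.2.1 hφ0 hφ1 h.2.2
  have h2 : HasDerivAt (fun a : ℝ => (r, a)) (0, 1) a := (hasDerivAt_const a r).prodMk (hasDerivAt_id a)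
  have h3 := h1.comp_hasDerivAt a h2
  have h4 := Complex.reCLM.hasFDerivAt.comp_hasDerivAt a h3
  simpa [Function.comp_def] using h4

section IteratedDeriv

variable {U : Set (ℝ × ℝ)} {Q : ℕ → ℕ → ℝ → ℝ → ℝ} {f : ℝ → ℝ → ℝ}

lemma iteratedDeriv_left_of_family (hU : IsOpen U)
    (hl : ∀ l j r a, (r, a) ∈ U → HasDerivAt (fun r => Q l j r a) (Q (l + 1) j r a) r)
    (j : ℕ) (hf : ∀ r a, (r, a) ∈ U → f r a = Q 0 j r a) (l : ℕ) {r a : ℝ} (h : (r, a) ∈ U) :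
    iteratedDeriv l (fun r => f r a) r = Q l j r a := by
  induction l generalizing r with
  | zero => rw [iteratedDeriv_zero]; exact hf r a h
  | succ l ih =>
    rw [iteratedDeriv_succ]
    have hev : iteratedDeriv l (fun r => f r a) =ᶠ[𝓝 r] fun r => Q l j r a := by
      have : ∀ᶠ s in 𝓝 r, (s, a) ∈ U :=
        (Continuous.continuousAt (by fun_prop : Continuous fun s : ℝ => (s, a))).eventually
          (hU.mem_nhds h)
      filter_upwards [this] with s hs using ih hs
    rw [hev.deriv_eq, (hl l j r a h).deriv]

lemma iteratedDeriv_right_of_family (hU : IsOpen U)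
    (hr : ∀ l j r a, (r, a) ∈ U → HasDerivAt (fun a => Q l j r a) (Q l (j + 1) r a) a)
    (l : ℕ) (hf : ∀ r a, (r, a) ∈ U → f r a = Q l 0 r a) (j : ℕ) {r a : ℝ} (h : (r, a) ∈ U) :
    iteratedDeriv j (fun a => f r a) a = Q l j r a := by
  induction j generalizing a with
  | zero => rw [iteratedDeriv_zero]; exact hf r a h
  | succ j ih =>
    rw [iteratedDeriv_succ]
    have hev : iteratedDeriv j (fun a => f r a) =ᶠ[𝓝 a] fun a => Q l j r a := by
      have : ∀ᶠ s in 𝓝 a, (r, s) ∈ U :=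
        (Continuous.continuousAt (by fun_prop : Continuous fun s : ℝ => (r, s))).eventually
          (hU.mem_nhds h)
      filter_upwards [this] with s hs using ih hs
    rw [hev.deriv_eq, (hr l j r a h).deriv]

end IteratedDeriv

lemma sin_ge_min {a b φ : ℝ} (ha : 0 ≤ a) (hb : b ≤ Real.pi) (hφ : φ ∈ Icc a b) :
    min (Real.sin a) (Real.sin b) ≤ Real.sin φ :=
  strictConcaveOn_sin_Icc.concaveOn.min_le_of_mem_Icc ⟨ha, hφ.1.trans (hφ.2.trans hb)⟩
    ⟨ha.trans (hφ.1.trans hφ.2), hb⟩ hφ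

lemma IsKernelFamily.rayIntegral_eq_of_le {B : ℝ} {V : ℕ → ℝ → ℂ → ℂ} (hV : IsKernelFamily B V)
    {φ₁ φ₂ r a : ℝ} (hr : 0 < r) (ha : 0 < a) (h0 : 0 < φ₁) (h12 : φ₁ ≤ φ₂) (h2 : φ₂ < Real.pi)
    (hB : a * φ₂ ≤ B) : rayIntegral V φ₁ 0 0 r a = rayIntegral V φ₂ 0 0 r a := by
  -- One of the two factors `e^(iφ)` belongs to `h`; the other is the direction of the ray.
  set h : ℂ → ℂ := fun z => hankelInt 0 (r * Complex.exp z) * Complex.exp z * V 0 a z with hh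
  have e : ∀ φ τ : ℝ, 0 < τ →
      rayIntegrand V φ 0 0 r a τ = Complex.exp (Complex.I * φ) * h (rayLog φ τ) := by
    intro φ τ hτ
    simp only [rayIntegrand, rayKernel, hh, exp_rayLog φ hτ]
    rw [show (r : ℂ) * (Complex.exp (Complex.I * φ) * τ) = Complex.exp (Complex.I * φ) * r * τ by ring]
    ring
  have e2 : ∀ φ : ℝ, rayIntegral V φ 0 0 r a
      = Complex.exp (Complex.I * φ) * ∫ τ in Ioi (0 : ℝ), h (rayLog φ τ) := by
    intro φ
    rw [rayIntegral, ← integral_const_mul]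
    exact setIntegral_congr_fun measurableSet_Ioi fun τ hτ => e φ τ hτ
  set m := min (Real.sin φ₁) (Real.sin φ₂)
  have hm : 0 < m := lt_min (Real.sin_pos_of_pos_of_lt_pi h0 (h12.trans_lt h2))
    (Real.sin_pos_of_pos_of_lt_pi (h0.trans_le h12) h2)
  obtain ⟨N, hN⟩ := exists_nat_ge a
  have hc : 0 < r * m := by positivity
  obtain ⟨C, hC, p, hb⟩ := hV.norm_rayIntegrand_le 0 0 N hc
  obtain ⟨C', hC', hb'⟩ := gauge_pow_mul_exp_le p (half_pos hc)
  rw [e2, e2]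
  refine integral_ray_eq (C := C * C') (c := r * m / 2 / 2) h12 (by positivity) ?_ ?_
  · intro z hz
    have him : 0 < ((r : ℂ) * Complex.exp z).im := by
      rw [Complex.im_ofReal_mul, Complex.exp_im]
      have := Real.sin_pos_of_pos_of_lt_pi (h0.trans_le hz.1) (hz.2.trans_lt h2)
      positivity
    have d1 : DifferentiableAt ℂ (fun z => hankelInt 0 (r * Complex.exp z)) z :=
      DifferentiableAt.comp (g := hankelInt 0) z (hasDerivAt_hankelInt 0 him).differentiableAt (by fun_prop)
    have d2 := (hV.differentiable 0 a).differentiableAt (x := z)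
    exact ((d1.mul (by fun_prop)).mul d2).differentiableWithinAt
  · intro τ hτ φ hφ
    have h3 := hb φ r a τ (by gcongr; exact sin_ge_min h0.le h2.le hφ) ha hN (h0.le.trans hφ.1)
      (hφ.2.trans h2.le) (le_trans (by have := hφ.2; gcongr) hB) hτ
    rw [e φ τ hτ, norm_mul, norm_exp_I_mul, one_mul] at h3
    calc _ ≤ C * (gauge τ ^ p * Real.exp (-(r * m / 2) * τ)) := h3
      _ ≤ C * (C' * (τ ^ (-(1 / 2) : ℝ) * Real.exp (-(r * m / 2 / 2) * τ))) := by
          exact mul_le_mul_of_nonneg_left (hb' τ hτ) hC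
      _ = _ := by ring

lemma IsKernelFamily.rayIntegral_eq {B : ℝ} {V : ℕ → ℝ → ℂ → ℂ} (hV : IsKernelFamily B V)
    {φ₁ φ₂ r a : ℝ} (hr : 0 < r) (ha : 0 < a) (h1 : 0 < φ₁) (h1' : φ₁ < Real.pi) (h2 : 0 < φ₂)
    (h2' : φ₂ < Real.pi) (hB₁ : a * φ₁ ≤ B) (hB₂ : a * φ₂ ≤ B) :
    rayIntegral V φ₁ 0 0 r a = rayIntegral V φ₂ 0 0 r a := by
  rcases le_total φ₁ φ₂ with h | h
  · exact hV.rayIntegral_eq_of_le hr ha h1 h h2' hB₂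
  · exact (hV.rayIntegral_eq_of_le hr ha h2 h h1' hB₁).symm

/-! ### The density as a ray integral -/

lemma expKernel_zero (a : ℝ) (z : ℂ) : expKernel 0 a z = Complex.exp (negPow a z) := by
  simp [expKernel, touchard]

lemma norm_expKernel_zero (a φ : ℝ) {τ : ℝ} (hτ : 0 < τ) :
    ‖expKernel 0 a (rayLog φ τ)‖ = Real.exp (-(τ ^ a * Real.cos (a * φ))) := by
  rw [expKernel_zero, Complex.norm_exp, re_negPow_rayLog a φ hτ]

lemma integrableOn_realAxis_bound {r a : ℝ} (ha : 0 < a) :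
    IntegrableOn (fun τ : ℝ => (2 + 4 / (r * τ)) * τ * Real.exp (-(τ ^ a * (1 / 2)))) (Ioi 0) := by
  have h1 := integrableOn_rpow_mul_exp_neg_mul_rpow (p := a) (s := 1) (b := 1 / 2)
    (by norm_num) ha (by norm_num)
  have h2 := integrableOn_rpow_mul_exp_neg_mul_rpow (p := a) (s := 0) (b := 1 / 2)
    (by norm_num) ha (by norm_num)
  refine IntegrableOn.congr_fun ((h1.const_mul 2).add (h2.const_mul (4 / r))) (fun τ hτ => ?_) measurableSet_Ioi
  have hτ' : τ ≠ 0 := ne_of_gt hτ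
  simp only [Pi.add_apply, Real.rpow_one, Real.rpow_zero]
  rw [show -(1 / 2) * τ ^ a = -(τ ^ a * (1 / 2)) by ring]
  rcases eq_or_ne r 0 with rfl | hr
  · simp; ring
  · field_simp

/-- The ray integral does not depend on the angle, so it equals its limit as the angle tends to `0`,
computed by dominated convergence. -/
lemma rayIntegral_expKernel_eq {φ r a : ℝ} (hr : 0 < r) (ha : 0 < a) (h0 : 0 < φ)
    (h1 : φ < Real.pi) (hB : a * φ ≤ Real.pi / 2) :
    rayIntegral expKernel φ 0 0 r a
      = ∫ τ in Ioi (0 : ℝ), hankel0 ((r * τ : ℝ) : ℂ) * τ * ((Real.exp (-τ ^ a) : ℝ) : ℂ) := by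
  -- Near the real axis the decay of `H_0` is lost. Angles with `aψ ≤ π/3` give `cos(aψ) ≥ 1/2`, so
  -- that `exp(-τ^a/2)` takes over.
  set δ := min φ (Real.pi / (3 * a)) with hδd
  have hδ : 0 < δ := lt_min h0 (by have := Real.pi_pos; positivity)
  have hδ1 : δ ≤ φ := min_le_left _ _
  have hδ2 : a * δ ≤ Real.pi / 3 := by
    calc a * δ ≤ a * (Real.pi / (3 * a)) := by gcongr; exact min_le_right _ _
      _ = Real.pi / 3 := by field_simp
  have hconst : ∀ᶠ ψ in 𝓝[>] (0 : ℝ), rayIntegral expKernel ψ 0 0 r a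
      = rayIntegral expKernel φ 0 0 r a := by
    filter_upwards [Ioo_mem_nhdsGT hδ] with ψ hψ
    exact (isKernelFamily_expKernel le_rfl).rayIntegral_eq_of_le hr ha hψ.1 (hψ.2.le.trans hδ1) h1 hB
  refine tendsto_nhds_unique (tendsto_const_nhds.congr' (hconst.mono fun ψ h => h.symm)) ?_
  refine tendsto_integral_filter_of_dominated_convergence
    (fun τ : ℝ => (2 + 4 / (r * τ)) * τ * Real.exp (-(τ ^ a * (1 / 2)))) ?_ ?_
    (integrableOn_realAxis_bound ha) ?_
  · filter_upwards [Ioo_mem_nhdsGT hδ] with ψ hψ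
    exact ((isKernelFamily_expKernel le_rfl).continuousOn_rayIntegrand 0 0 hr
      (Real.sin_pos_of_pos_of_lt_pi hψ.1 (hψ.2.trans_le (hδ1.trans h1.le))) a).aestronglyMeasurable
      measurableSet_Ioi
  · filter_upwards [Ioo_mem_nhdsGT hδ] with ψ hψ
    filter_upwards [ae_restrict_mem measurableSet_Ioi] with τ hτ
    have hτ' : 0 < τ := hτ
    have hs := Real.sin_pos_of_pos_of_lt_pi hψ.1 (hψ.2.trans_le (hδ1.trans h1.le))
    have hn : ‖Complex.exp (Complex.I * ψ) * r * τ‖ = r * τ := by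
      rw [norm_mul, norm_mul, norm_exp_I_mul, Complex.norm_real, Complex.norm_real,
        Real.norm_of_nonneg hr.le, Real.norm_of_nonneg hτ'.le, one_mul]
    have hH := norm_hankelInt_zero_le (z := Complex.exp (Complex.I * ψ) * r * τ)
      (by rw [im_ray]; positivity)
    rw [hn] at hH
    have hcos : 1 / 2 ≤ Real.cos (a * ψ) := by
      rw [← Real.cos_pi_div_three]
      have h3 : a * ψ ≤ a * δ := by have := hψ.2.le; gcongr
      exact Real.cos_le_cos_of_nonneg_of_le_pi (by have := hψ.1; positivity)
        (by linarith [Real.pi_pos]) (h3.trans hδ2)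
    rw [rayIntegrand, norm_mul, norm_rayKernel_eq _ _ _ hτ', norm_expKernel_zero a ψ hτ', zero_add,
      pow_one]
    gcongr
  · filter_upwards [ae_restrict_mem measurableSet_Ioi] with τ hτ
    have hτ' : 0 < τ := hτ
    have hz : Tendsto (fun ψ : ℝ => Complex.exp (Complex.I * ψ) * r * τ) (𝓝 0)
        (𝓝 ((r * τ : ℝ) : ℂ)) := by
      have : Continuous fun ψ : ℝ => Complex.exp (Complex.I * ψ) * r * τ := by fun_prop
      simpa using this.tendsto 0
    have hexp : Tendsto (fun ψ : ℝ => Complex.exp (Complex.I * ψ) ^ 2) (𝓝 0) (𝓝 1) := by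
      have : Continuous fun ψ : ℝ => Complex.exp (Complex.I * ψ) ^ 2 := by fun_prop
      simpa using this.tendsto 0
    have hsl : ((r * τ : ℝ) : ℂ) ∈ Complex.slitPlane :=
      Complex.ofReal_mem_slitPlane.2 (by positivity)
    have hH := (differentiableAt_hankel0 hsl).continuousAt.tendsto.comp hz
    have hE : Tendsto (fun ψ : ℝ => expKernel 0 a (rayLog ψ τ)) (𝓝 0)
        (𝓝 ((Real.exp (-τ ^ a) : ℝ) : ℂ)) := by
      have h3 : Continuous fun ψ : ℝ => expKernel 0 a (rayLog ψ τ) := by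
        have h := ((isKernelFamily_expKernel le_rfl).differentiable 0 a).continuous
        have h2 : Continuous fun φ : ℝ => rayLog φ τ := by unfold rayLog; fun_prop
        exact h.comp h2
      have h4 := h3.tendsto 0
      have h5 : expKernel 0 a (rayLog 0 τ) = ((Real.exp (-τ ^ a) : ℝ) : ℂ) := by
        rw [expKernel_zero, negPow, rayLog, Real.rpow_def_of_pos hτ', mul_comm (Real.log τ)]
        push_cast; simp
      rwa [h5] at h4
    have h := ((hexp.mul hH).mul_const (τ : ℂ)).mul hE
    rw [one_mul] at h
    refine (h.mono_left nhdsWithin_le_nhds).congr' ?_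
    filter_upwards [Ioo_mem_nhdsGT hδ] with ψ hψ
    have hs := Real.sin_pos_of_pos_of_lt_pi hψ.1 (hψ.2.trans_le (hδ1.trans h1.le))
    rw [rayIntegrand, rayKernel, Function.comp,
      hankel0_eq_hankelInt (z := Complex.exp (Complex.I * ψ) * r * τ) (by rw [im_ray]; positivity)]
    simp

lemma radialDensity_eq {φ r a : ℝ} (hr : 0 < r) (ha : 0 < a) (h0 : 0 < φ)
    (h1 : φ < Real.pi) (hB : a * φ ≤ Real.pi / 2) :
    radialDensity r a = 1 / (2 * Real.pi) * (rayIntegral expKernel φ 0 0 r a).re := by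
  set F : ℝ → ℂ := fun τ => hankel0 ((r * τ : ℝ) : ℂ) * τ * ((Real.exp (-τ ^ a) : ℝ) : ℂ) with hF
  rw [rayIntegral_expKernel_eq hr ha h0 h1 hB, radialDensity]
  congr 1
  -- The bound is known only for `Im z > 0` and passes to the axis by continuity of `hankel0` there.
  have hzlim : ∀ τ : ℝ, 0 < τ → ‖hankel0 ((r * τ : ℝ) : ℂ)‖ ≤ 2 + 4 / (r * τ) := by
    intro τ hτ
    have hsl : ((r * τ : ℝ) : ℂ) ∈ Complex.slitPlane :=
      Complex.ofReal_mem_slitPlane.2 (by positivity)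
    have hz : Tendsto (fun y : ℝ => ((r * τ : ℝ) : ℂ) + y * Complex.I) (𝓝[>] 0)
        (𝓝 ((r * τ : ℝ) : ℂ)) := by
      have : Continuous fun y : ℝ => ((r * τ : ℝ) : ℂ) + y * Complex.I := by fun_prop
      have h := this.tendsto 0
      simp only [Complex.ofReal_zero, zero_mul, add_zero] at h
      exact h.mono_left nhdsWithin_le_nhds
    refine le_of_tendsto ((differentiableAt_hankel0 hsl).continuousAt.tendsto.comp hz).norm ?_
    filter_upwards [self_mem_nhdsWithin] with y hy
    have him : 0 < (((r * τ : ℝ) : ℂ) + y * Complex.I).im := by simpa using hy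
    rw [Function.comp, hankel0_eq_hankelInt him]
    refine (norm_hankelInt_zero_le him).trans ?_
    gcongr
    refine le_trans ?_ (Complex.abs_re_le_norm _)
    have h3 : (((r * τ : ℝ) : ℂ) + y * Complex.I).re = r * τ := by simp
    rw [h3]; exact le_abs_self _
  have hint : IntegrableOn F (Ioi 0) := by
    refine (integrableOn_realAxis_bound (r := r) ha).mono' ?_ ?_
    · refine ContinuousOn.aestronglyMeasurable ?_ measurableSet_Ioi
      have c1 : ContinuousOn (fun τ : ℝ => hankel0 ((r * τ : ℝ) : ℂ)) (Ioi 0) := by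
        intro τ hτ
        have hτ' : 0 < τ := hτ
        have hsl : ((r * τ : ℝ) : ℂ) ∈ Complex.slitPlane :=
          Complex.ofReal_mem_slitPlane.2 (by positivity)
        exact (ContinuousAt.comp (f := fun τ : ℝ => ((r * τ : ℝ) : ℂ))
          (differentiableAt_hankel0 hsl).continuousAt (by fun_prop)).continuousWithinAt
      have c2 : ContinuousOn (fun τ : ℝ => τ ^ a) (Ioi 0) := fun τ hτ =>
        (Real.continuousAt_rpow_const τ a (Or.inl (ne_of_gt hτ))).continuousWithinAt
      fun_prop
    · filter_upwards [ae_restrict_mem measurableSet_Ioi] with τ hτ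
      have hτ' : 0 < τ := hτ
      rw [norm_mul, norm_mul, Complex.norm_real, Complex.norm_real, Real.norm_of_nonneg hτ'.le,
        Real.norm_eq_abs, Real.abs_exp]
      gcongr
      · exact hzlim τ hτ'
      · have : 0 ≤ τ ^ a := by positivity
        linarith
  have h2 : (∫ τ in Ioi (0 : ℝ), F τ).re = ∫ τ in Ioi (0 : ℝ), (F τ).re :=
    (integral_re (𝕜 := ℂ) hint).symm
  rw [h2]
  refine setIntegral_congr_fun measurableSet_Ioi fun τ hτ => ?_
  have hτ' : 0 < τ := hτ
  simp only [hF]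
  rw [Complex.re_mul_ofReal, Complex.re_mul_ofReal, re_hankel0_ofReal (by positivity)]

/-! ### The Mellin transform of `K_0` -/

lemma sigmoid_mul_eq (v : ℝ) :
    Real.sigmoid v * (1 - Real.sigmoid v) = ((2 * Real.cosh (v / 2)) ^ 2)⁻¹ := by
  have h1 : (2 * Real.cosh (v / 2)) ^ 2 = (1 + Real.exp (-v)) * (1 + Real.exp v) := by
    have e1 : Real.exp v = Real.exp (v / 2) ^ 2 := by rw [← Real.exp_nat_mul]; ring_nf
    have e2 : Real.exp (-v) = Real.exp (-(v / 2)) ^ 2 := by rw [← Real.exp_nat_mul]; ring_nf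
    have e3 : Real.exp (v / 2) * Real.exp (-(v / 2)) = 1 := by rw [← Real.exp_add]; simp
    rw [Real.cosh_eq, e1, e2]
    linear_combination (-(Real.exp (v / 2) * Real.exp (-(v / 2))) + 1) * e3
  rw [← Real.sigmoid_neg, h1, mul_inv, Real.sigmoid_def, Real.sigmoid_def, neg_neg]

/-- The Beta integral `B(s/2, s/2)` under `x = sigmoid v`, for which both `dx/dv` and `x(1-x)` equal
`(2 cosh(v/2))^(-2)`. -/
lemma integral_cosh_rpow {s : ℝ} (hs : 0 < s) :
    Integrable (fun t : ℝ => Real.cosh t ^ (-s)) ∧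
    ∫ t : ℝ, Real.cosh t ^ (-s) = 2 ^ (s - 1) * Real.Gamma (s / 2) ^ 2 / Real.Gamma s := by
  set F : ℝ → ℂ := fun x => (x : ℂ) ^ (((s / 2 : ℝ) : ℂ) - 1)
    * (1 - (x : ℂ)) ^ (((s / 2 : ℝ) : ℂ) - 1) with hF
  have hre : 0 < (((s / 2 : ℝ) : ℂ)).re := by simpa using hs
  have hconv : IntegrableOn F (Ioo 0 1) := by
    have h := Complex.betaIntegral_convergent hre hre
    rw [intervalIntegrable_iff_integrableOn_Ioo_of_le zero_le_one] at h
    exact h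
  have hval : ∫ x in Ioo (0 : ℝ) 1, F x
      = ((Real.Gamma (s / 2) ^ 2 / Real.Gamma s : ℝ) : ℂ) := by
    have h := Complex.betaIntegral_eq_Gamma_mul_div _ _ hre hre
    rw [Complex.betaIntegral, intervalIntegral.integral_of_le zero_le_one,
      integral_Ioc_eq_integral_Ioo] at h
    rw [hF, h, ← Complex.ofReal_add, Complex.Gamma_ofReal, Complex.Gamma_ofReal]
    push_cast
    rw [show s / 2 + s / 2 = s by ring]; ring
  have hpt : ∀ v : ℝ, |Real.sigmoid v * (1 - Real.sigmoid v)| • F (Real.sigmoid v)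
      = (((2 * Real.cosh (v / 2)) ^ (-s) : ℝ) : ℂ) := by
    intro v
    have h0 := Real.sigmoid_pos v
    have h1 : 0 < 1 - Real.sigmoid v := by linarith [Real.sigmoid_lt_one v]
    have hc : 0 < 2 * Real.cosh (v / 2) := by have := Real.cosh_pos (v / 2); positivity
    have h2 : F (Real.sigmoid v)
        = (((Real.sigmoid v * (1 - Real.sigmoid v)) ^ (s / 2 - 1) : ℝ) : ℂ) := by
      rw [Real.mul_rpow h0.le h1.le]
      push_cast [Complex.ofReal_cpow h0.le, Complex.ofReal_cpow h1.le]
      simp only [hF]; push_cast; rfl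
    rw [h2, abs_of_pos (by positivity), Complex.real_smul, ← Complex.ofReal_mul]
    congr 1
    rw [← Real.rpow_one_add' (by positivity) (by linarith), sigmoid_mul_eq,
      Real.inv_rpow (by positivity), ← Real.rpow_natCast, ← Real.rpow_mul hc.le, ← Real.rpow_neg hc.le]
    congr 1
    push_cast; ring
  have hd : ∀ x ∈ (univ : Set ℝ), HasDerivWithinAt Real.sigmoid
      (Real.sigmoid x * (1 - Real.sigmoid x)) univ x := fun x _ =>
    (Real.hasDerivAt_sigmoid x).hasDerivWithinAt
  have hI := integrableOn_image_iff_integrableOn_abs_deriv_smul MeasurableSet.univ hd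
    Real.sigmoid_injective.injOn F
  have hE := integral_image_eq_integral_abs_deriv_smul MeasurableSet.univ hd
    Real.sigmoid_injective.injOn F
  rw [image_univ, Real.range_sigmoid] at hI hE
  simp only [hpt, integrableOn_univ, setIntegral_univ] at hI hE
  have hI' : Integrable fun v : ℝ => (2 * Real.cosh (v / 2)) ^ (-s) := by
    have := (hI.1 hconv).re
    simpa using this
  have hE' : ∫ v : ℝ, (2 * Real.cosh (v / 2)) ^ (-s) = Real.Gamma (s / 2) ^ 2 / Real.Gamma s := by
    rw [hval, integral_complex_ofReal] at hE
    exact_mod_cast hE.symm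
  have hsc : ∀ t : ℝ, (2 * Real.cosh (2 * t / 2)) ^ (-s) = 2 ^ (-s) * Real.cosh t ^ (-s) := by
    intro t
    rw [mul_div_cancel_left₀ _ two_ne_zero, Real.mul_rpow zero_le_two (Real.cosh_pos t).le]
  have h2 : (2 : ℝ) ^ s * 2 ^ (-s) = 1 := by rw [← Real.rpow_add two_pos]; simp
  constructor
  · have h := (hI'.comp_mul_left' (R := 2) two_ne_zero).const_mul (2 ^ s)
    refine h.congr (Eventually.of_forall fun t => ?_)
    simp only [hsc]
    rw [← mul_assoc, h2, one_mul]
  · have h := Measure.integral_comp_mul_left (fun v : ℝ => (2 * Real.cosh (v / 2)) ^ (-s)) 2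
    simp only [hsc] at h
    rw [hE', integral_const_mul, smul_eq_mul, abs_of_pos (by norm_num)] at h
    have h3 : (2 : ℝ) ^ (s - 1) = 2 ^ s * 2⁻¹ := by
      rw [Real.rpow_sub two_pos, Real.rpow_one]; ring
    rw [h3]
    linear_combination (2 : ℝ) ^ s * h - (∫ t : ℝ, Real.cosh t ^ (-s)) * h2

/-- Tonelli: the inner `τ`-integral is `Γ(s) (r cosh t)^(-s)`, and this `Γ(s)` cancels the
denominator of the Beta integral. -/
lemma mellin_twoK {s r : ℝ} (hs : 0 < s) (hr : 0 < r) :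
    ∫ τ in Ioi (0 : ℝ), twoK (r * τ) * τ ^ (s - 1)
      = 2 ^ (s - 1) * Real.Gamma (s / 2) ^ 2 * r ^ (-s) := by
  set G : ℝ → ℝ → ℝ := fun τ t => Real.exp (-(r * τ * Real.cosh t)) * τ ^ (s - 1) with hG
  have hcp : ∀ t, 0 < r * Real.cosh t := fun t => by have := Real.cosh_pos t; positivity
  obtain ⟨hci, hce⟩ := integral_cosh_rpow hs
  have hsec : ∀ t, ∫ τ in Ioi (0 : ℝ), G τ t = r ^ (-s) * Real.Gamma s * Real.cosh t ^ (-s) := by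
    intro t
    have h := Real.integral_rpow_mul_exp_neg_mul_Ioi hs (hcp t)
    have e : ∀ τ, G τ t = τ ^ (s - 1) * Real.exp (-(r * Real.cosh t * τ)) := fun τ => by
      simp only [hG]; rw [mul_comm, mul_right_comm]
    simp only [e, h]
    rw [one_div, Real.inv_rpow (hcp t).le, ← Real.rpow_neg (hcp t).le,
      Real.mul_rpow hr.le (Real.cosh_pos t).le]
    ring
  have hseci : ∀ t, IntegrableOn (fun τ => G τ t) (Ioi 0) := by
    intro t
    have h := integrableOn_rpow_mul_exp_neg_mul_rpow (p := 1) (s := s - 1) (b := r * Real.cosh t)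
      (by linarith) one_pos (hcp t)
    refine h.congr_fun (fun τ _ => ?_) measurableSet_Ioi
    simp only [hG, Real.rpow_one]
    rw [mul_comm]; congr 2; ring
  have hmeas : AEStronglyMeasurable (Function.uncurry G)
      ((volume.restrict (Ioi (0 : ℝ))).prod volume) := by
    refine Measurable.aestronglyMeasurable ?_
    have := Real.measurable_cosh
    simp only [hG, Function.uncurry_def]
    fun_prop
  have hnorm : ∀ t, ∫ τ in Ioi (0 : ℝ), ‖G τ t‖ = ∫ τ in Ioi (0 : ℝ), G τ t := by
    intro t
    refine setIntegral_congr_fun measurableSet_Ioi fun τ hτ => ?_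
    have hτ' : 0 < τ := hτ
    exact Real.norm_of_nonneg (by positivity)
  have hint : Integrable (Function.uncurry G) ((volume.restrict (Ioi (0 : ℝ))).prod volume) := by
    rw [integrable_prod_iff' hmeas]
    refine ⟨Eventually.of_forall hseci, ?_⟩
    simp only [Function.uncurry_apply_pair, hnorm, hsec]
    exact hci.const_mul _
  have hswap := integral_integral_swap hint
  simp only [hsec] at hswap
  rw [integral_const_mul, hce] at hswap
  have h1 : ∫ τ in Ioi (0 : ℝ), twoK (r * τ) * τ ^ (s - 1)
      = ∫ τ in Ioi (0 : ℝ), ∫ t : ℝ, G τ t := by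
    refine integral_congr_ae (Eventually.of_forall fun τ => ?_)
    simp only [hG, twoK]
    rw [integral_mul_const]
  rw [h1, hswap]
  have := (Real.Gamma_pos_of_pos hs).ne'
  field_simp

/-! ### Closed form of the terms of the expansion -/

lemma re_I_mul_exp_div (θ : ℝ) :
    (Complex.exp (θ * Complex.I) / Complex.I).re = Real.sin θ := by
  rw [Complex.div_I, Complex.neg_re, Complex.mul_I_re, neg_neg, Complex.exp_ofReal_mul_I_im]

lemma powKernel_zero_rayLog (k : ℕ) (a φ : ℝ) {τ : ℝ} (hτ : 0 < τ) :
    powKernel k 0 a (rayLog φ τ)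
      = (-1) ^ k / (k.factorial : ℂ) * (((τ ^ (k * a) : ℝ) : ℂ)
        * Complex.exp ((k * a * φ : ℝ) * Complex.I)) := by
  have h1 : Complex.exp (a * rayLog φ τ) ^ k
      = ((τ ^ (k * a) : ℝ) : ℂ) * Complex.exp ((k * a * φ : ℝ) * Complex.I) := by
    rw [← Complex.exp_nat_mul, Real.rpow_def_of_pos hτ, Complex.ofReal_exp, ← Complex.exp_add, rayLog]
    congr 1
    push_cast; ring
  rw [powKernel, pow_zero, one_mul, negPow, neg_pow, h1]; ring

lemma re_rayIntegral_powKernel (k : ℕ) {φ r a : ℝ} (hr : 0 < r) (ha : 0 < a) (h0 : 0 < φ)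
    (h1 : φ < Real.pi) :
    (rayIntegral (powKernel k) φ 0 0 r a).re
      = 2 / Real.pi * ((-1) ^ (k + 1) / (k.factorial : ℝ)) * tailTerm 0 k r a := by
  have hpi := Real.pi_pos
  -- Power kernels are bounded at every angle, so `B` may be as large as the rotation to `π/2`
  -- requires.
  set B := max (a * φ) (a * (Real.pi / 2))
  rw [(isKernelFamily_powKernel B k).rayIntegral_eq hr ha h0 h1 (half_pos hpi) (half_lt_self hpi)
    (le_max_left _ _) (le_max_right _ _)]
  set s : ℝ := k * a + 2 with hs
  have hs0 : 0 < s := by positivity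
  have hI : Complex.exp (Complex.I * (Real.pi / 2 : ℝ)) = Complex.I := by
    rw [mul_comm]; push_cast; exact Complex.exp_pi_div_two_mul_I
  have e : ∀ τ ∈ Ioi (0 : ℝ), rayIntegrand (powKernel k) (Real.pi / 2) 0 0 r a τ
      = ((-1) ^ (k + 1) / (k.factorial : ℂ) * (1 / Real.pi) *
        (Complex.exp ((k * a * (Real.pi / 2) : ℝ) * Complex.I) / Complex.I))
        * ((twoK (r * τ) * τ ^ (s - 1) : ℝ) : ℂ) := by
    intro τ hτ
    have hτ' : 0 < τ := hτ
    have h3 : τ ^ (s - 1) = τ * τ ^ (k * a) := by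
      rw [hs, show (k : ℝ) * a + 2 - 1 = 1 + k * a by ring, Real.rpow_add hτ', Real.rpow_one]
    have h4 := hankelInt_zero_I_mul (r * τ)
    push_cast at h4
    rw [rayIntegrand, rayKernel, hI, powKernel_zero_rayLog k a _ hτ', mul_assoc Complex.I, h4, h3,
      zero_add, zero_add, Complex.I_sq]
    push_cast
    have : (Real.pi : ℂ) ≠ 0 := by exact_mod_cast hpi.ne'
    have := Complex.I_ne_zero
    field_simp
    ring
  rw [rayIntegral, setIntegral_congr_fun measurableSet_Ioi e, integral_const_mul,
    integral_complex_ofReal, mellin_twoK hs0 hr, Complex.re_mul_ofReal]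
  have h5 : ((-1) ^ (k + 1) / (k.factorial : ℂ) * (1 / Real.pi) *
        (Complex.exp ((k * a * (Real.pi / 2) : ℝ) * Complex.I) / Complex.I))
      = (((-1) ^ (k + 1) / (k.factorial : ℝ) * (1 / Real.pi) : ℝ) : ℂ) *
        (Complex.exp ((k * a * (Real.pi / 2) : ℝ) * Complex.I) / Complex.I) := by push_cast; ring
  rw [h5, Complex.re_ofReal_mul, re_I_mul_exp_div, tailTerm]
  have h6 : (2 : ℝ) ^ (s - 1) = 2 * 2 ^ (k * a) := by
    rw [hs, show (k : ℝ) * a + 2 - 1 = 1 + k * a by ring, Real.rpow_add two_pos, Real.rpow_one]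
  rw [h6, Real.rpow_neg hr.le]
  simp only [zero_add, Nat.cast_zero, add_zero]
  rw [Finset.Icc_eq_empty (by norm_num), Finset.prod_empty, show k * a * Real.pi / 2 = k * a * (Real.pi / 2) by ring]
  rw [hs]
  field_simp

lemma tailTerm_zero_left (l : ℕ) (r a : ℝ) : tailTerm l 0 r a = 0 := by
  simp [tailTerm]

lemma hasDerivAt_tailTerm (l k : ℕ) {r : ℝ} (hr : 0 < r) (a : ℝ) :
    HasDerivAt (fun r => tailTerm l k r a) (-tailTerm (l + 1) k r a) r := by
  set p : ℝ := k * a + l + 2 with hp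
  set c : ℝ := (2 : ℝ) ^ (k * a) * (∏ i ∈ Finset.Icc 2 (l + 1), (k * a + i))
    * Real.Gamma ((k * a + 2) / 2) ^ 2 * Real.sin (k * a * Real.pi / 2) with hc
  have h := (Real.hasDerivAt_rpow_const (x := r) (p := -p) (Or.inl hr.ne')).const_mul c
  have e : (fun r => tailTerm l k r a) =ᶠ[𝓝 r] fun r => c * r ^ (-p) := by
    filter_upwards [lt_mem_nhds hr] with s hs
    rw [Real.rpow_neg hs.le, ← div_eq_mul_inv]; rfl
  refine (h.congr_of_eventuallyEq e).congr_deriv ?_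
  have e2 : r ^ (-p - 1) = (r ^ (k * a + ((l + 1 : ℕ) : ℝ) + 2))⁻¹ := by
    rw [← Real.rpow_neg hr.le]; congr 1; rw [hp]; push_cast; ring
  rw [tailTerm, e2, Finset.prod_Icc_succ_top (by omega), hc, hp]
  push_cast
  ring

/-- Both sides agree for `l = 0` on an open set and both families are closed under `∂/∂r`, so they
agree for every `l`. -/
lemma re_rayIntegral_powKernel_left (k l : ℕ) {φ r a : ℝ} (h0 : 0 < φ) (h1 : φ < Real.pi)
    {B : ℝ} (h : (r, a) ∈ rayDom B φ) :
    (rayIntegral (powKernel k) φ l 0 r a).re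
      = 2 / Real.pi * ((-1) ^ (k + 1) / (k.factorial : ℝ)) * (-1) ^ l * tailTerm l k r a := by
  have hV := isKernelFamily_powKernel B k
  rw [← iteratedDeriv_left_of_family (isOpen_rayDom B φ)
    (Q := fun l j r a => (rayIntegral (powKernel k) φ l j r a).re)
    (fun l j r a h => hV.hasDerivAt_rayIntegral_left h0 h1 l j h) 0
    (f := fun r a => (rayIntegral (powKernel k) φ 0 0 r a).re) (fun _ _ _ => rfl) l h]
  refine iteratedDeriv_left_of_family (isOpen_rayDom B φ)
    (f := fun r a => (rayIntegral (powKernel k) φ 0 0 r a).re)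
    (Q := fun l _ r a => 2 / Real.pi * ((-1) ^ (k + 1) / (k.factorial : ℝ)) * (-1) ^ l
      * tailTerm l k r a) (fun l j r a h => ?_) 0 (fun r a h => ?_) l h
  · refine ((hasDerivAt_tailTerm l k h.1 a).const_mul _).congr_deriv ?_
    ring
  · rw [re_rayIntegral_powKernel k h.1 h.2.1 h0 h1]; ring

lemma re_rayIntegral_powKernel_iteratedDeriv (k l j : ℕ) {φ r a : ℝ} (h0 : 0 < φ)
    (h1 : φ < Real.pi) {B : ℝ} (h : (r, a) ∈ rayDom B φ) :
    (rayIntegral (powKernel k) φ l j r a).re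
      = 2 / Real.pi * ((-1) ^ (k + 1) / (k.factorial : ℝ)) * (-1) ^ l
        * iteratedDeriv j (fun a => tailTerm l k r a) a := by
  have hV := isKernelFamily_powKernel B k
  rw [← iteratedDeriv_const_mul_field]
  exact (iteratedDeriv_right_of_family (isOpen_rayDom B φ)
    (Q := fun l j r a => (rayIntegral (powKernel k) φ l j r a).re)
    (fun l j r a h => hV.hasDerivAt_rayIntegral_right h0 h1 l j h) l
    (f := fun r a => 2 / Real.pi * ((-1) ^ (k + 1) / (k.factorial : ℝ)) * (-1) ^ l
      * tailTerm l k r a)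
    (fun r a h => (re_rayIntegral_powKernel_left k l h0 h1 h).symm) j h).symm

/-! ### Derivatives of the density and the error of the expansion -/

lemma iteratedDeriv_radialDensity (l j : ℕ) {φ r a : ℝ} (h0 : 0 < φ) (h1 : φ < Real.pi)
    (h : (r, a) ∈ rayDom (Real.pi / 2) φ) :
    iteratedDeriv l (fun s => iteratedDeriv j (fun a => radialDensity s a) a) r
      = 1 / (2 * Real.pi) * (rayIntegral expKernel φ l j r a).re := by
  have hV := isKernelFamily_expKernel (le_refl (Real.pi / 2))
  refine iteratedDeriv_left_of_family (isOpen_rayDom (Real.pi / 2) φ)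
    (f := fun s a => iteratedDeriv j (fun a => radialDensity s a) a)
    (Q := fun l j r a => 1 / (2 * Real.pi) * (rayIntegral expKernel φ l j r a).re)
    (fun l j r a h => (hV.hasDerivAt_rayIntegral_left h0 h1 l j h).const_mul _) j
    (fun r a h => ?_) l h
  exact iteratedDeriv_right_of_family (isOpen_rayDom (Real.pi / 2) φ)
    (Q := fun l j r a => 1 / (2 * Real.pi) * (rayIntegral expKernel φ l j r a).re)
    (fun l j r a h => (hV.hasDerivAt_rayIntegral_right h0 h1 l j h).const_mul _) 0
    (fun r a h => radialDensity_eq h.1 h.2.1 h0 h1 h.2.2.le) j h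

lemma rayIntegral_remKernel (n l j : ℕ) {φ r a : ℝ} (hr : 0 < r) (ha : 0 < a) (h0 : 0 < φ)
    (h1 : φ < Real.pi) (hB : a * φ ≤ Real.pi / 2) :
    rayIntegral (remKernel n) φ l j r a = rayIntegral expKernel φ l j r a
      - ∑ k ∈ Finset.range (n + 1), rayIntegral (powKernel k) φ l j r a := by
  have i1 := (isKernelFamily_expKernel le_rfl).integrableOn_rayIntegrand l j hr ha h0 h1 hB
  have i2 : ∀ k ∈ Finset.range (n + 1), IntegrableOn (rayIntegrand (powKernel k) φ l j r a) (Ioi 0) :=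
    fun k _ => (isKernelFamily_powKernel (Real.pi / 2) k).integrableOn_rayIntegrand l j hr ha h0 h1 hB
  simp only [rayIntegral]
  rw [← integral_finsetSum _ i2, ← integral_sub i1 (integrable_finsetSum _ i2)]
  congr 1
  funext τ
  simp only [rayIntegrand, remKernel, mul_sub, Finset.mul_sum]

/-- The difference of a mixed derivative of the density and its expansion. -/
noncomputable def expansionError (n l j : ℕ) (r a : ℝ) : ℝ :=
  iteratedDeriv l (fun s : ℝ => iteratedDeriv j (fun a : ℝ => radialDensity s a) a) r
    - (-1 : ℝ) ^ l / Real.pi ^ 2 * ∑ k ∈ Finset.Icc 1 n,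
      (-1 : ℝ) ^ (k + 1) / (k.factorial : ℝ) * iteratedDeriv j (fun a : ℝ => tailTerm l k r a) a

lemma expansionError_eq (n l j : ℕ) {φ r a : ℝ} (h0 : 0 < φ) (h1 : φ < Real.pi)
    (h : (r, a) ∈ rayDom (Real.pi / 2) φ) :
    expansionError n l j r a = 1 / (2 * Real.pi) * (rayIntegral (remKernel n) φ l j r a).re := by
  -- The Taylor polynomial contains the term `k = 0`, whose real part vanishes because `sin 0 = 0`;
  -- the expansion therefore starts at `k = 1`.
  have e : Finset.range (n + 1) = insert 0 (Finset.Icc 1 n) := by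
    ext k; simp only [Finset.mem_range, Finset.mem_insert, Finset.mem_Icc]; omega
  rw [expansionError, iteratedDeriv_radialDensity l j h0 h1 h,
    rayIntegral_remKernel n l j h.1 h.2.1 h0 h1 h.2.2.le, Complex.sub_re, Complex.re_sum, e,
    Finset.sum_insert (by simp)]
  simp only [re_rayIntegral_powKernel_iteratedDeriv _ l j h0 h1 h, tailTerm_zero_left]
  have hz : iteratedDeriv j (fun _ : ℝ => (0 : ℝ)) a = 0 := by
    rw [iteratedDeriv_const]; simp
  rw [hz, mul_zero, zero_add, mul_sub, Finset.mul_sum, Finset.mul_sum]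
  congr 1
  refine Finset.sum_congr rfl fun k _ => ?_
  have := Real.pi_ne_zero
  field_simp

lemma tendsto_integral_norm_rayIntegrand (n l j : ℕ) {φ r a : ℝ} (hr : 0 < r) (ha : 0 < a)
    (h0 : 0 < φ) (h1 : φ < Real.pi) (hB : a * φ ≤ Real.pi / 2) :
    Tendsto (fun ψ => ∫ τ in Ioi (0 : ℝ), ‖rayIntegrand (remKernel n) ψ l j r a τ‖) (𝓝[<] φ)
      (𝓝 (∫ τ in Ioi (0 : ℝ), ‖rayIntegrand (remKernel n) φ l j r a τ‖)) := by
  have hV := isKernelFamily_remKernel (le_refl (Real.pi / 2)) n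
  have hm : 0 < min (Real.sin (φ / 2)) (Real.sin φ) :=
    lt_min (Real.sin_pos_of_pos_of_lt_pi (half_pos h0) (by linarith))
      (Real.sin_pos_of_pos_of_lt_pi h0 h1)
  obtain ⟨N, hN⟩ := exists_nat_ge a
  obtain ⟨C, hC, p, hb⟩ := hV.norm_rayIntegrand_le l j N (mul_pos hr hm)
  have hev : ∀ᶠ ψ in 𝓝[<] φ, ψ ∈ Ioo (φ / 2) φ := Ioo_mem_nhdsLT (half_lt_self h0)
  refine tendsto_integral_filter_of_dominated_convergence
    (fun τ => C * (gauge τ ^ p * Real.exp (-(r * min (Real.sin (φ / 2)) (Real.sin φ) / 2) * τ)))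
    ?_ ?_ ((integrableOn_gauge_pow_mul_exp p (half_pos (mul_pos hr hm))).const_mul C) ?_
  · filter_upwards [hev] with ψ hψ
    exact ((hV.continuousOn_rayIntegrand l j hr (Real.sin_pos_of_pos_of_lt_pi
      ((half_pos h0).trans hψ.1) (hψ.2.trans h1)) a).aestronglyMeasurable measurableSet_Ioi).norm
  · filter_upwards [hev] with ψ hψ
    filter_upwards [ae_restrict_mem measurableSet_Ioi] with τ hτ
    rw [norm_norm]
    exact hb ψ r a τ (mul_le_mul_of_nonneg_left
      (sin_ge_min (half_pos h0).le h1.le ⟨hψ.1.le, hψ.2.le⟩) hr.le) ha hN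
      ((half_pos h0).trans hψ.1).le (hψ.2.trans h1).le
      ((mul_le_mul_of_nonneg_left hψ.2.le ha.le).trans hB) hτ
  · filter_upwards [ae_restrict_mem measurableSet_Ioi] with τ hτ
    have hτ' : 0 < τ := hτ
    have hs := Real.sin_pos_of_pos_of_lt_pi h0 h1
    have c1 : ContinuousAt (hankelInt l) (Complex.exp (Complex.I * φ) * r * τ) :=
      (hasDerivAt_hankelInt l (by rw [im_ray]; positivity)).continuousAt
    have c2 : ContinuousAt (fun ψ : ℝ => hankelInt l (Complex.exp (Complex.I * ψ) * r * τ)) φ :=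
      ContinuousAt.comp (f := fun ψ : ℝ => Complex.exp (Complex.I * ψ) * r * τ) c1
        (Continuous.continuousAt (by fun_prop))
    have c3 : ContinuousAt (fun ψ : ℝ => rayKernel ψ l r τ) φ := by
      unfold rayKernel; fun_prop
    have c4 : ContinuousAt (fun ψ : ℝ => rayIntegrand (remKernel n) ψ l j r a τ) φ :=
      c3.mul (continuous_remKernel n j a τ).continuousAt
    exact c4.norm.tendsto.mono_left nhdsWithin_le_nhds

/-- When `aφ = π/2` every neighbourhood of `a` leaves the region where the kernel is controlled. The
estimate is proved for angles `ψ < φ` and passes to the limit, since the left side does not involve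
the angle. -/
lemma abs_expansionError_le (n l j : ℕ) {φ r a : ℝ} (hr : 0 < r) (ha : 0 < a)
    (h0 : 0 < φ) (h1 : φ < Real.pi) (hB : a * φ ≤ Real.pi / 2) :
    |expansionError n l j r a|
      ≤ 1 / (2 * Real.pi) * ∫ τ in Ioi (0 : ℝ), ‖rayIntegrand (remKernel n) φ l j r a τ‖ := by
  refine ge_of_tendsto ((tendsto_integral_norm_rayIntegrand n l j hr ha h0 h1 hB).const_mul
    (1 / (2 * Real.pi))) ?_
  filter_upwards [Ioo_mem_nhdsLT h0] with ψ hψ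
  have hd : (r, a) ∈ rayDom (Real.pi / 2) ψ :=
    ⟨hr, ha, (mul_lt_mul_of_pos_left hψ.2 ha).trans_le hB⟩
  have hpi := Real.pi_pos
  rw [expansionError_eq n l j hψ.1 (hψ.2.trans h1) hd, abs_mul, abs_of_pos (by positivity)]
  gcongr
  exact (Complex.abs_re_le_norm _).trans (norm_integral_le_integral_norm _)

lemma norm_rayIntegrand_remKernel (n l j : ℕ) {φ r a τ : ℝ} (hr : 0 < r) (h0 : 0 < φ)
    (h1 : φ < Real.pi) (hτ : 0 < τ) :
    ‖rayIntegrand (remKernel n) φ l j r a τ‖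
      = ‖iteratedDeriv l hankel0 (Complex.exp (Complex.I * φ) * r * τ)‖ * τ ^ (l + 1)
        * ‖iteratedDeriv j (fun a : ℝ => remainderKernel n φ τ a) a‖ := by
  have hs := Real.sin_pos_of_pos_of_lt_pi h0 h1
  rw [iteratedDeriv_hankel0 l (by rw [im_ray]; positivity), iteratedDeriv_remainderKernel n j φ a hτ,
    rayIntegrand, norm_mul, norm_rayKernel_eq φ l r hτ]

/-! ### The Taylor remainder and the explicit bounds -/

/-- Along `t ↦ t w` the derivative of a remainder is `w` times the preceding one, so the bound
integrates up by induction from `|e^w| ≤ 1`. The segment stays in `Re ≤ 0`. -/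
lemma norm_exp_sub_sum_le (m : ℕ) {w : ℂ} (hw : w.re ≤ 0) :
    ‖Complex.exp w - ∑ k ∈ Finset.range m, w ^ k / (k.factorial : ℂ)‖
      ≤ ‖w‖ ^ m / (m.factorial : ℝ) := by
  induction m generalizing w with
  | zero =>
    simp only [Finset.range_zero, Finset.sum_empty, sub_zero, pow_zero, Nat.factorial_zero,
      Nat.cast_one, div_one]
    rw [Complex.norm_exp]; exact Real.exp_le_one_iff.2 hw
  | succ m ih =>
    set f : ℝ → ℂ := fun t =>
      Complex.exp (t * w) - ∑ k ∈ Finset.range (m + 1), (t * w) ^ k / (k.factorial : ℂ) with hf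
    set f' : ℝ → ℂ := fun t =>
      w * (Complex.exp (t * w) - ∑ k ∈ Finset.range m, (t * w) ^ k / (k.factorial : ℂ)) with hf'
    have hl : ∀ t : ℝ, HasDerivAt (fun t : ℝ => (t : ℂ) * w) w t := fun t => by
      simpa using ((hasDerivAt_id t).ofReal_comp).mul_const w
    have hd : ∀ t : ℝ, HasDerivAt f (f' t) t := by
      intro t
      have h1 := (hl t).cexp.sub (HasDerivAt.fun_sum (u := Finset.range (m + 1)) fun k _ =>
        ((hl t).fun_pow k).div_const (k.factorial : ℂ))
      refine h1.congr_deriv ?_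
      rw [Finset.sum_range_succ']
      simp only [hf', mul_sub, Finset.mul_sum, Nat.cast_zero, zero_mul, zero_div, add_zero, Nat.add_sub_cancel]
      congr 1
      · ring
      · refine Finset.sum_congr rfl fun k _ => ?_
        have h2 : (k.factorial : ℂ) ≠ 0 := by exact_mod_cast k.factorial_ne_zero
        have h3 : ((k : ℂ) + 1) ≠ 0 := by exact_mod_cast k.succ_ne_zero
        rw [Nat.factorial_succ]; push_cast
        field_simp
    have hB : ∀ t : ℝ, HasDerivAt (fun t : ℝ => ‖w‖ ^ (m + 1) / ((m + 1).factorial : ℝ) * t ^ (m + 1))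
        (‖w‖ ^ (m + 1) / (m.factorial : ℝ) * t ^ m) t := by
      intro t
      refine ((hasDerivAt_pow (m + 1) t).const_mul _).congr_deriv ?_
      have h2 : (m.factorial : ℝ) ≠ 0 := by exact_mod_cast m.factorial_ne_zero
      rw [Nat.factorial_succ, Nat.add_sub_cancel]; push_cast
      field_simp
    have key := image_norm_le_of_norm_deriv_right_le_deriv_boundary (a := 0) (b := 1) (f := f)
      (f' := f') (fun t _ => (hd t).continuousAt.continuousWithinAt)
      (fun t _ => (hd t).hasDerivWithinAt) ?_ hB ?_ (x := 1) ⟨zero_le_one, le_rfl⟩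
    · simpa [hf] using key
    · have : f 0 = 0 := by
        simp only [hf, Complex.ofReal_zero, zero_mul, Complex.exp_zero]
        rw [Finset.sum_range_succ']; simp
      simp [this]
    · intro t ht
      have h1 : ((t : ℂ) * w).re ≤ 0 := by
        rw [Complex.re_ofReal_mul]; exact mul_nonpos_of_nonneg_of_nonpos ht.1 hw
      have h2 := ih h1
      rw [norm_mul, Complex.norm_real, Real.norm_of_nonneg ht.1] at h2
      simp only [hf', norm_mul]
      calc _ ≤ ‖w‖ * ((t * ‖w‖) ^ m / (m.factorial : ℝ)) := by gcongr
        _ = _ := by rw [mul_pow, pow_succ]; ring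

lemma norm_remKernel_zero_le (n : ℕ) {φ a τ : ℝ} (ha : 0 < a) (h0 : 0 < φ)
    (hB : a * φ ≤ Real.pi / 2) (hτ : 0 < τ) :
    ‖remKernel n 0 a (rayLog φ τ)‖ ≤ τ ^ ((n + 1) * a) / ((n + 1).factorial : ℝ) := by
  have h := norm_exp_sub_sum_le (n + 1) (re_negPow_rayLog_nonpos ha.le h0.le hB hτ)
  rw [norm_negPow_rayLog a φ hτ, ← Real.rpow_natCast, ← Real.rpow_mul hτ.le, mul_comm a] at h
  push_cast at h
  simpa [remKernel, expKernel, powKernel, touchard] using h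

lemma piAlpha_pos (α : ℝ) : 0 < piAlpha α := by
  have := Real.pi_pos
  have : (0 : ℝ) < max α 1 := lt_max_of_lt_right one_pos
  unfold piAlpha; positivity

lemma piAlpha_lt_pi (α : ℝ) : piAlpha α < Real.pi := by
  have h := Real.pi_pos
  have h1 : (1 : ℝ) ≤ max α 1 := le_max_right _ _
  rw [piAlpha, div_lt_iff₀ (by positivity)]
  nlinarith

lemma mul_piAlpha_le (α : ℝ) : α * piAlpha α ≤ Real.pi / 2 := by
  have h := Real.pi_pos
  have h1 : (1 : ℝ) ≤ max α 1 := le_max_right _ _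
  have h2 : α ≤ max α 1 := le_max_left _ _
  rw [piAlpha, mul_div_assoc', div_le_iff₀ (by positivity)]
  nlinarith

/-- The integrand of the explicit bound for the remainder. -/
noncomputable def boundIntegrand (n l : ℕ) (φ a τ : ℝ) : ℝ :=
  ‖iteratedDeriv l hankel0 (Complex.exp (Complex.I * φ) * τ)‖ * τ ^ ((n + 1) * a + l + 1)

lemma rpow_add_nat_add_one (n l : ℕ) (a : ℝ) {τ : ℝ} (hτ : 0 < τ) :
    τ ^ ((n + 1) * a + l + 1) = τ ^ (l + 1) * τ ^ ((n + 1) * a) := by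
  rw [show (n + 1) * a + l + 1 = ((l + 1 : ℕ) : ℝ) + (n + 1) * a by push_cast; ring,
    Real.rpow_add hτ, Real.rpow_natCast]

lemma integrableOn_boundIntegrand (n l : ℕ) {φ a : ℝ} (ha : 0 < a) (h0 : 0 < φ)
    (h1 : φ < Real.pi) : IntegrableOn (boundIntegrand n l φ a) (Ioi 0) := by
  have hs := Real.sin_pos_of_pos_of_lt_pi h0 h1
  -- Up to the factor `(n+1)!`, the integrand is the norm of the power kernel of degree `n + 1` at
  -- `r = 1`.
  have h := ((isKernelFamily_powKernel (a * φ) (n + 1)).integrableOn_rayIntegrand l 0 one_pos ha h0 h1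
    le_rfl).norm.const_mul (((n + 1).factorial : ℕ) : ℝ)
  refine IntegrableOn.congr_fun h (fun τ hτ => ?_) measurableSet_Ioi
  have hτ' : 0 < τ := hτ
  have h2 : ((n + 1).factorial : ℝ) ≠ 0 := by positivity
  rw [boundIntegrand, rpow_add_nat_add_one n l a hτ', rayIntegrand, norm_mul,
    norm_rayKernel_eq φ l 1 hτ', powKernel_zero_rayLog _ _ _ hτ',
    iteratedDeriv_hankel0 l (by have := im_ray φ 1 τ; simp only [Complex.ofReal_one, mul_one] at this
                                rw [this]; positivity)]
  simp only [norm_mul, norm_div, norm_pow, norm_neg, norm_one, one_pow, Complex.norm_real,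
    Complex.norm_exp_ofReal_mul_I, Complex.norm_natCast, Complex.ofReal_one, mul_one]
  rw [Real.norm_of_nonneg (by positivity)]
  push_cast
  field_simp

lemma integral_norm_rayIntegrand_le (n l : ℕ) {φ r a : ℝ} (hr : 0 < r) (ha : 0 < a) (h0 : 0 < φ)
    (h1 : φ < Real.pi) (hB : a * φ ≤ Real.pi / 2) :
    ∫ τ in Ioi (0 : ℝ), ‖rayIntegrand (remKernel n) φ l 0 r a τ‖
      ≤ 1 / ((n + 1).factorial : ℝ) * (∫ τ in Ioi (0 : ℝ), boundIntegrand n l φ a τ)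
        * r ^ (-((n + 1) * a) - l - 2) := by
  have hs := Real.sin_pos_of_pos_of_lt_pi h0 h1
  have hint := integrableOn_boundIntegrand n l ha h0 h1
  -- The exponent is one larger than in the final bound; the missing `r⁻¹` is the Jacobian of `τ ↦
  -- rτ`.
  set c : ℝ := 1 / ((n + 1).factorial : ℝ) * r ^ (-((n + 1) * a) - l - 1) with hc
  have hscale : ∫ τ in Ioi (0 : ℝ), boundIntegrand n l φ a (r * τ)
      = r⁻¹ * ∫ τ in Ioi (0 : ℝ), boundIntegrand n l φ a τ := by
    have := integral_comp_mul_left_Ioi (boundIntegrand n l φ a) 0 hr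
    simpa using this
  have hint' : IntegrableOn (fun τ => boundIntegrand n l φ a (r * τ)) (Ioi 0) :=
    (integrableOn_Ioi_comp_mul_left_iff _ 0 hr).2 (by simpa using hint)
  have hV := isKernelFamily_remKernel (le_refl (Real.pi / 2)) n
  have hle : ∫ τ in Ioi (0 : ℝ), ‖rayIntegrand (remKernel n) φ l 0 r a τ‖
      ≤ ∫ τ in Ioi (0 : ℝ), c * boundIntegrand n l φ a (r * τ) := by
    refine setIntegral_mono_on (hV.integrableOn_rayIntegrand l 0 hr ha h0 h1 hB).norm
      (hint'.const_mul c) measurableSet_Ioi fun τ hτ => ?_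
    have hτ' : 0 < τ := hτ
    have h3 := norm_remKernel_zero_le n ha h0 hB hτ'
    have h4 : r ^ (-((n + 1) * a) - l - 1) * (r * τ) ^ ((n + 1) * a + l + 1)
        = τ ^ (l + 1) * τ ^ ((n + 1) * a) := by
      rw [Real.mul_rpow hr.le hτ'.le, ← mul_assoc, ← Real.rpow_add hr,
        ← rpow_add_nat_add_one n l a hτ']
      rw [show -((n + 1) * a) - l - 1 + ((n + 1) * a + l + 1) = 0 by ring, Real.rpow_zero, one_mul]
    rw [norm_rayIntegrand_remKernel n l 0 hr h0 h1 hτ', iteratedDeriv_zero,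
      remainderKernel_eq n φ a hτ', hc, boundIntegrand, Complex.ofReal_mul, ← mul_assoc (Complex.exp _)]
    calc _ ≤ ‖iteratedDeriv l hankel0 (Complex.exp (Complex.I * φ) * r * τ)‖ * τ ^ (l + 1)
          * (τ ^ ((n + 1) * a) / ((n + 1).factorial : ℝ)) := by gcongr
      _ = ‖iteratedDeriv l hankel0 (Complex.exp (Complex.I * φ) * r * τ)‖
          * (r ^ (-((n + 1) * a) - l - 1) * (r * τ) ^ ((n + 1) * a + l + 1))
          / ((n + 1).factorial : ℝ) := by rw [h4]; ring
      _ = _ := by ring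
  have e : r ^ (-((n + 1) * a) - (l : ℝ) - 2) = r ^ (-((n + 1) * a) - (l : ℝ) - 1) * r⁻¹ := by
    rw [← Real.rpow_neg_one r, ← Real.rpow_add hr]; congr 1; ring
  refine hle.trans (le_of_eq ?_)
  rw [integral_const_mul, hscale, hc, e]
  ring

lemma abs_expansionError_zero_le (n l : ℕ) {r a : ℝ} (hr : 0 < r) (ha : 0 < a) :
    |expansionError n l 0 r a| ≤ 1 / (2 * Real.pi * ((n + 1).factorial : ℝ))
      * (∫ τ in Ioi (0 : ℝ), boundIntegrand n l (piAlpha a) a τ) * r ^ (-((n + 1) * a) - l - 2) := by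
  have hpi := Real.pi_pos
  calc _ ≤ 1 / (2 * Real.pi) * (1 / ((n + 1).factorial : ℝ)
        * (∫ τ in Ioi (0 : ℝ), boundIntegrand n l (piAlpha a) a τ)
        * r ^ (-((n + 1) * a) - l - 2)) := by
        refine (abs_expansionError_le n l 0 hr ha (piAlpha_pos a) (piAlpha_lt_pi a)
          (mul_piAlpha_le a)).trans ?_
        gcongr
        exact integral_norm_rayIntegrand_le n l hr ha (piAlpha_pos a) (piAlpha_lt_pi a)
          (mul_piAlpha_le a)
    _ = _ := by field_simp

/-! ### Smoothness and the final assembly -/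

lemma contDiffOn_radialDensity :
    ContDiffOn ℝ ((⊤ : ℕ∞) : WithTop ℕ∞) (fun p : ℝ × ℝ => radialDensity p.1 p.2)
      (Ioi (0 : ℝ) ×ˢ Ioo (0 : ℝ) 2) := by
  have hpi := Real.pi_pos
  -- Since `α < 2`, the single angle `π/4` gives `αφ < π/2` on the whole domain.
  have h0 : 0 < Real.pi / 4 := by positivity
  have h1 : Real.pi / 4 < Real.pi := by linarith
  rw [contDiffOn_infty]
  intro n
  have h := (isKernelFamily_expKernel (le_refl (Real.pi / 2))).contDiffOn_rayIntegral h0 h1 n 0 0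
  have h2 : ContDiffOn ℝ n (fun p : ℝ × ℝ => 1 / (2 * Real.pi)
      * (rayIntegral expKernel (Real.pi / 4) 0 0 p.1 p.2).re) (rayDom (Real.pi / 2) (Real.pi / 4)) :=
    contDiffOn_const.mul (Complex.reCLM.contDiff.comp_contDiffOn h)
  have hsub : Ioi (0 : ℝ) ×ˢ Ioo (0 : ℝ) 2 ⊆ rayDom (Real.pi / 2) (Real.pi / 4) := by
    rintro ⟨r, a⟩ ⟨hr, ha⟩
    exact ⟨hr, ha.1, by have := ha.2; simp only at this ⊢; nlinarith⟩
  refine (h2.mono hsub).congr fun p hp => ?_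
  exact radialDensity_eq hp.1 hp.2.1 h0 h1 (hsub hp).2.2.le

lemma mul_lt_pi_div_two_of_lt {α φ : ℝ} (hα : 0 < α) (h : φ < Real.pi / max (2 * α) 1) :
    φ < Real.pi ∧ α * φ ≤ Real.pi / 2 := by
  have hpi := Real.pi_pos
  have h1 : (1 : ℝ) ≤ max (2 * α) 1 := le_max_right _ _
  have h2 : 2 * α ≤ max (2 * α) 1 := le_max_left _ _
  have a1 : Real.pi / max (2 * α) 1 ≤ Real.pi := div_le_self hpi.le h1
  have a2 : Real.pi / max (2 * α) 1 ≤ Real.pi / (2 * α) := by gcongr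
  refine ⟨h.trans_le a1, ?_⟩
  have a3 := (h.trans_le a2).le
  rw [le_div_iff₀ (by positivity)] at a3
  linarith

lemma sum_tailTerm_zero (n : ℕ) {r : ℝ} (hr : 0 < r) (α : ℝ) :
    ∑ k ∈ Finset.Icc 1 n, (-1 : ℝ) ^ (k + 1) / (k.factorial : ℝ) * tailTerm 0 k r α
      = ∑ k ∈ Finset.Icc 1 n, (-1 : ℝ) ^ (k + 1) * (2 : ℝ) ^ (k * α)
          * Real.Gamma ((k * α + 2) / 2) ^ 2 * Real.sin (k * α * Real.pi / 2)
          / (k.factorial : ℝ) * r ^ (-(k * α) - 2) := by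
  refine Finset.sum_congr rfl fun k _ => ?_
  have e : r ^ (-(k * α) - 2) = (r ^ (k * α + ((0 : ℕ) : ℝ) + 2))⁻¹ := by
    rw [← Real.rpow_neg hr.le]; congr 1; push_cast; ring
  rw [tailTerm, e, Finset.Icc_eq_empty (by norm_num), Finset.prod_empty]
  ring

lemma expansionError_zero_right (n l : ℕ) (r α : ℝ) :
    expansionError n l 0 r α = iteratedDeriv l (fun s : ℝ => radialDensity s α) r
      - (-1 : ℝ) ^ l / Real.pi ^ 2 * ∑ k ∈ Finset.Icc 1 n,
          (-1 : ℝ) ^ (k + 1) / (k.factorial : ℝ) * tailTerm l k r α := by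
  simp only [expansionError, iteratedDeriv_zero]

lemma expansionError_zero_zero (n : ℕ) {r : ℝ} (hr : 0 < r) (α : ℝ) :
    expansionError n 0 0 r α = radialDensity r α - 1 / Real.pi ^ 2 * ∑ k ∈ Finset.Icc 1 n,
      (-1 : ℝ) ^ (k + 1) * (2 : ℝ) ^ (k * α) * Real.Gamma ((k * α + 2) / 2) ^ 2
        * Real.sin (k * α * Real.pi / 2) / (k.factorial : ℝ) * r ^ (-(k * α) - 2) := by
  rw [expansionError_zero_right, iteratedDeriv_zero, pow_zero, sum_tailTerm_zero n hr]

lemma boundIntegrand_zero (n : ℕ) (φ a : ℝ) :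
    boundIntegrand n 0 φ a
      = fun τ : ℝ => ‖hankel0 (Complex.exp (Complex.I * φ) * τ)‖ * τ ^ ((n + 1) * a + 1) := by
  funext τ
  simp only [boundIntegrand, iteratedDeriv_zero, Nat.cast_zero, add_zero]

end BivariateStable

open BivariateStable in
theorem mainTheorem3 :
    ContDiffOn ℝ ((⊤ : ℕ∞) : WithTop ℕ∞) (fun p : ℝ × ℝ => radialDensity p.1 p.2)
      (Set.Ioi (0 : ℝ) ×ˢ Set.Ioo (0 : ℝ) 2) ∧
    ∀ α : ℝ, 0 < α → α < 2 → ∀ n : ℕ,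
      -- the expansion of the density and the explicit bound for its remainder
      (Asymptotics.IsBigO Filter.atTop
          (fun r : ℝ => radialDensity r α - 1 / Real.pi ^ 2 * ∑ k ∈ Finset.Icc 1 n,
            (-1 : ℝ) ^ (k + 1) * (2 : ℝ) ^ (k * α) * Real.Gamma ((k * α + 2) / 2) ^ 2
              * Real.sin (k * α * Real.pi / 2) / (k.factorial : ℝ) * r ^ (-(k * α) - 2))
          (fun r : ℝ => r ^ (-((n + 1) * α) - 2)) ∧
        MeasureTheory.IntegrableOn
          (fun τ : ℝ => ‖hankel0 (Complex.exp (Complex.I * piAlpha α) * τ)‖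
            * τ ^ ((n + 1) * α + 1)) (Set.Ioi 0) ∧
        ∀ r : ℝ, 0 < r →
          |radialDensity r α - 1 / Real.pi ^ 2 * ∑ k ∈ Finset.Icc 1 n,
            (-1 : ℝ) ^ (k + 1) * (2 : ℝ) ^ (k * α) * Real.Gamma ((k * α + 2) / 2) ^ 2
              * Real.sin (k * α * Real.pi / 2) / (k.factorial : ℝ) * r ^ (-(k * α) - 2)|
          ≤ 1 / (2 * Real.pi * ((n + 1).factorial : ℝ))
            * (∫ τ in Set.Ioi (0 : ℝ), ‖hankel0 (Complex.exp (Complex.I * piAlpha α) * τ)‖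
                * τ ^ ((n + 1) * α + 1))
            * r ^ (-((n + 1) * α) - 2)) ∧
      -- derivatives in `r`
      (∀ ℓ : ℕ,
        MeasureTheory.IntegrableOn
          (fun τ : ℝ => ‖iteratedDeriv ℓ hankel0 (Complex.exp (Complex.I * piAlpha α) * τ)‖
            * τ ^ ((n + 1) * α + ℓ + 1)) (Set.Ioi 0) ∧
        ∀ r : ℝ, 0 < r →
          |iteratedDeriv ℓ (fun s : ℝ => radialDensity s α) r
            - (-1 : ℝ) ^ ℓ / Real.pi ^ 2 * ∑ k ∈ Finset.Icc 1 n,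
                (-1 : ℝ) ^ (k + 1) / (k.factorial : ℝ) * tailTerm ℓ k r α|
          ≤ 1 / (2 * Real.pi * ((n + 1).factorial : ℝ))
            * (∫ τ in Set.Ioi (0 : ℝ),
                ‖iteratedDeriv ℓ hankel0 (Complex.exp (Complex.I * piAlpha α) * τ)‖
                  * τ ^ ((n + 1) * α + ℓ + 1))
            * r ^ (-((n + 1) * α) - ℓ - 2)) ∧
      -- mixed derivatives in `r` and `α`
      (∀ ℓ₁ ℓ₂ : ℕ, ∀ φ : ℝ,
        (0 < φ ∧ φ < Real.pi / max (2 * α) 1) ∨ φ = piAlpha α →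
        ∀ r : ℝ, 0 < r →
          MeasureTheory.IntegrableOn
            (fun τ : ℝ => ‖iteratedDeriv ℓ₁ hankel0 (Complex.exp (Complex.I * φ) * r * τ)‖
              * τ ^ (ℓ₁ + 1) * ‖iteratedDeriv ℓ₂ (fun a : ℝ => remainderKernel n φ τ a) α‖)
            (Set.Ioi 0) ∧
          |iteratedDeriv ℓ₁ (fun s : ℝ => iteratedDeriv ℓ₂ (fun a : ℝ => radialDensity s a) α) r
            - (-1 : ℝ) ^ ℓ₁ / Real.pi ^ 2 * ∑ k ∈ Finset.Icc 1 n,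
                (-1 : ℝ) ^ (k + 1) / (k.factorial : ℝ)
                  * iteratedDeriv ℓ₂ (fun a : ℝ => tailTerm ℓ₁ k r a) α|
          ≤ 1 / (2 * Real.pi)
            * ∫ τ in Set.Ioi (0 : ℝ),
                ‖iteratedDeriv ℓ₁ hankel0 (Complex.exp (Complex.I * φ) * r * τ)‖
                  * τ ^ (ℓ₁ + 1)
                  * ‖iteratedDeriv ℓ₂ (fun a : ℝ => remainderKernel n φ τ a) α‖) := by
  refine ⟨contDiffOn_radialDensity, fun α h0 _ n => ⟨?_, fun l => ⟨?_, fun r hr => ?_⟩,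
    fun l j φ hφ r hr => ?_⟩⟩
  · have key : ∀ r : ℝ, 0 < r → _ := fun r hr => abs_expansionError_zero_le n 0 hr h0
    simp only [boundIntegrand_zero, Nat.cast_zero, sub_zero] at key
    have hb : ∀ r : ℝ, 0 < r → _ := fun r hr => expansionError_zero_zero n hr α ▸ key r hr
    refine ⟨?_, ?_, hb⟩
    · refine Asymptotics.IsBigO.of_bound (1 / (2 * Real.pi * ((n + 1).factorial : ℝ))
        * ∫ τ in Set.Ioi (0 : ℝ), ‖hankel0 (Complex.exp (Complex.I * piAlpha α) * τ)‖
          * τ ^ ((n + 1) * α + 1)) ?_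
      filter_upwards [Filter.eventually_gt_atTop 0] with r hr
      rw [Real.norm_eq_abs, Real.norm_of_nonneg (Real.rpow_nonneg hr.le _)]
      exact hb r hr
    · rw [← boundIntegrand_zero]
      exact integrableOn_boundIntegrand n 0 h0 (piAlpha_pos α) (piAlpha_lt_pi α)
  · exact integrableOn_boundIntegrand n l h0 (piAlpha_pos α) (piAlpha_lt_pi α)
  · rw [← expansionError_zero_right]
    exact abs_expansionError_zero_le n l hr h0
  -- Both admissible choices of `φ` enter only through these inequalities.
  · obtain ⟨p0, p1, p2⟩ : 0 < φ ∧ φ < Real.pi ∧ α * φ ≤ Real.pi / 2 := by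
      rcases hφ with h | rfl
      · exact ⟨h.1, mul_lt_pi_div_two_of_lt h0 h.2⟩
      · exact ⟨piAlpha_pos α, piAlpha_lt_pi α, mul_piAlpha_le α⟩
    have e := fun τ (hτ : τ ∈ Set.Ioi (0 : ℝ)) =>
      norm_rayIntegrand_remKernel n l j (a := α) hr p0 p1 hτ
    refine ⟨MeasureTheory.IntegrableOn.congr_fun ((isKernelFamily_remKernel le_rfl
      n).integrableOn_rayIntegrand l j hr h0 p0 p1 p2).norm e measurableSet_Ioi, ?_⟩
    rw [← MeasureTheory.setIntegral_congr_fun measurableSet_Ioi e]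
    exact abs_expansionError_le n l j hr h0 p0 p1 p2
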